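/- **Circuits.** A *circuit* is a finite directed acyclic graph of gates, each gate having a type, with a distinguished output gate. The *inputs* of a gate $g$ are the gates $g'$ with a wire $(g',g)$; the *fan-in* of $g$ is the number of its inputs. The size $|C|$ of a circuit is its number of gates plus its number of wires. For a gate $g$, let $\Delta(g)$ be the set of gates to which $g$ has a directed path (including $g$); the *dependency size* is $\Delta(C)=\max_g|\Delta(g)|$. A *set-valued circuit* has gates of types $\mathrm{svar}$ (variables, fan-in $0$), $\cup$, and $\times$ (fan-in $0$ or $2$). Each gate $g$ captures a set $S(g)$ of assignments (sets of variables): $S(g)=\{\{g\}\}$ for a variable; $S(g)=\bigcup_{g'}S(g')$ over the inputs $g'$ of a $\cup$-gate; $S(g)=\{\emptyset\}$ for a $\times$-gate without inputs; $S(g)=\{a\cup b: a\in S(g_1), b\in S(g_2)\}$ for a $\times$-gate with inputs $g_1\ne g_2$. It is a *d-DNNF* if the sets captured by distinct inputs of a $\cup$-gate are always disjoint, and no variable has directed paths to both inputs of a $\times$-gate. A wire $(g,g')$ is *pure* if $g'$ is a $\cup$-gate, or $g'$ is a $\times$-gate whose other input $g''$ satisfies $\emptyset\in S(g'')$. The circuit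 is *upwards-deterministic* if every gate has at most one outgoing pure wire. A *hybrid circuit* has set-valued gates, of types $\mathrm{svar},\cup,\times,\boxtimes$, and Boolean gates, of types $\mathrm{bvar},\land,\lor,\neg$. The output gate is set-valued; $\mathrm{svar}$- and $\mathrm{bvar}$-gates have fan-in $0$; inputs of $\land,\lor,\neg$-gates are Boolean and $\neg$-gates have fan-in $1$; inputs of $\cup$- and $\times$-gates are set-valued and $\times$-gates have fan-in $0$ or $2$; each $\boxtimes$-gate has exactly one set-valued and one Boolean input. Given a valuation $\nu:C_{\mathrm{bvar}}\to\{0,1\}$, Boolean gates are evaluated as usual, and the *evaluation* $\nu(C)$ is the set-valued circuit obtained by replacing each Boolean gate of value $1$ (resp. $0$) by a $\times$-gate (resp. $\cup$-gate) without inputs, and each $\boxtimes$ by $\times$. Let $S_\nu(g)$ be the set captured by $g$ in $\nu(C)$, and $S_\nu(C)=S_\nu(g_0)$ for the output gate $g_0$. The hybrid circuit $C$ is a d-DNNF (resp. upwards-deterministic) if $\nu(C)$ is so for every $\nu$, and it is *homogenized* if $\emptyset\notin S_\nu(g)$ for all valuations $\nu$ and all set-valued gates $g$. **Theorem.** There is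 an algorithm for enumeration under updates, in the RAM model with uniform cost measure, such that for every fan-in bound $k$ there is a constant $K$ with the following property. Let $C$ be any upwards-deterministic, d-DNNF, homogenized hybrid circuit of maximal fan-in at most $k$ (given with any numbering of its gates and any listing of its wires), and let $\nu$ be any initial valuation of its Boolean variables. 1. *Preprocessing:* given $C$ and $\nu$, the algorithm computes an index and an initial enumeration state in time at most $K\cdot|C|$. 2. *Enumeration:* as long as the state is not the special state indicating that the enumeration is over, a call to the enumeration procedure, which cannot write to the index, outputs one assignment $A$ and a new state; the time and the number of working-memory cells accessed in this call are at most $K\cdot|A|$. The assignments produced until the enumeration is over are exactly the elements of $S_\nu(C)$ for the current valuation $\nu$, without duplicates. The total number of memory cells (outside the index) used by the enumeration is at most $K$ times the size of the largest assignment of $S_\nu(C)$. 3. *Updates:* at any time, for any Boolean variable $g$, the update procedure can be called to toggle the value $\nu(g)$; it updates the index and restarts the enumeration (for the new valuation), in time at most $K\cdot\Delta(C)$. This can be repeated any number of times. -/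

import Mathlib

/-! ### Circuits: directed acyclic graphs of typed gates -/

/-- A circuit with gate set `G` and gate types in `T`: a set of wires (the pair `(a, b)` is a wire
from `a` to `b`, that is, `a` is an input of `b`), an output gate, and a type for each gate.
The graph of the wires is acyclic. -/
structure Circuit (T G : Type) where
  wires : Finset (G × G)
  output : G
  type : G → T
  acyclic : ∀ g : G, ¬ Relation.TransGen (fun a b => (a, b) ∈ wires) g g

namespace Circuit

/-- There is a wire from `a` to `b`. -/
def Wire {T G : Type} (C : Circuit T G) (a b : G) : Prop := (a, b) ∈ C.wires

/-- The inputs of a gate. -/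
def inputs {T G : Type} [Fintype G] [DecidableEq G] (C : Circuit T G) (g : G) : Finset G :=
  Finset.univ.filter (fun a => (a, g) ∈ C.wires)

/-- The fan-in of a gate: its number of inputs. -/
def fanIn {T G : Type} [Fintype G] [DecidableEq G] (C : Circuit T G) (g : G) : ℕ :=
  (C.inputs g).card

/-- The maximal fan-in of a circuit. -/
def maxFanIn {T G : Type} [Fintype G] [DecidableEq G] (C : Circuit T G) : ℕ :=
  Finset.univ.sup C.fanIn

/-- There is a directed path (possibly of length zero) from `a` to `b`. -/
def Path {T G : Type} (C : Circuit T G) (a b : G) : Prop := Relation.ReflTransGen C.Wire a b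

/-- The set of gates that depend on `g`: the gates to which `g` has a directed path. -/
def dependents {T G : Type} (C : Circuit T G) (g : G) : Set G := {b | C.Path g b}

/-- The dependency size of a circuit: the largest number of gates that depend on a gate. -/
noncomputable def dependencySize {T G : Type} [Fintype G] (C : Circuit T G) : ℕ :=
  Finset.univ.sup (fun g => (C.dependents g).ncard)

/-- The size of a circuit: its number of gates plus its number of wires. -/
def size {T G : Type} [Fintype G] (C : Circuit T G) : ℕ := Fintype.card G + C.wires.card

theorem wire_wellFounded {T G : Type} [Fintype G] (C : Circuit T G) : WellFounded C.Wire := by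
  have h : WellFounded (Relation.TransGen C.Wire) := by
    have : Std.Irrefl (Relation.TransGen C.Wire) := ⟨C.acyclic⟩
    exact Finite.wellFounded_of_trans_of_irrefl _
  exact Subrelation.wf (fun hab => Relation.TransGen.single hab) h

end Circuit

/-! ### Set-valued circuits -/

/-- Gate types of set-valued circuits: variables, unions, relational products. -/
inductive SetGate
  | svar
  | cup
  | times
  deriving DecidableEq

/-- A set-valued circuit: variables have no inputs, products have zero or two inputs. -/
structure SetCircuit (G : Type) [Fintype G] [DecidableEq G] extends Circuit SetGate G where
  fanIn_svar : ∀ g, type g = .svar → toCircuit.fanIn g = 0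
  fanIn_times : ∀ g, type g = .times → toCircuit.fanIn g = 0 ∨ toCircuit.fanIn g = 2

namespace SetCircuit

/-- `C.Captures g A`: the assignment `A` (a set of variable gates) belongs to the set captured by
the gate `g`. A variable `g` captures `{{g}}`, a union captures the union of the sets captured by
its inputs, a product without inputs captures `{∅}`, and a product with two inputs captures
all the unions of an assignment captured by one input and an assignment captured by the other. -/
inductive Captures {G : Type} [Fintype G] [DecidableEq G] (C : SetCircuit G) :
    G → Finset G → Prop
  | svar {g : G} : C.type g = .svar → Captures C g {g}
  | cup {g a : G} {A : Finset G} : C.type g = .cup → a ∈ C.inputs g → Captures C a A →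
      Captures C g A
  | times_nil {g : G} : C.type g = .times → C.inputs g = ∅ → Captures C g ∅
  | times {g a b : G} {A B : Finset G} : C.type g = .times → C.inputs g = {a, b} → a ≠ b →
      Captures C a A → Captures C b B → Captures C g (A ∪ B)

/-- The set of assignments captured by a gate. -/
def captured {G : Type} [Fintype G] [DecidableEq G] (C : SetCircuit G) (g : G) :
    Set (Finset G) := {A | C.Captures g A}

/-- Every union is deterministic: distinct inputs capture disjoint sets. -/
def Deterministic {G : Type} [Fintype G] [DecidableEq G] (C : SetCircuit G) : Prop :=
  ∀ g, C.type g = .cup → ∀ a ∈ C.inputs g, ∀ b ∈ C.inputs g, a ≠ b →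
    Disjoint (C.captured a) (C.captured b)

/-- Every product is decomposable: no variable has a directed path to two distinct inputs. -/
def Decomposable {G : Type} [Fintype G] [DecidableEq G] (C : SetCircuit G) : Prop :=
  ∀ g, C.type g = .times → ∀ a ∈ C.inputs g, ∀ b ∈ C.inputs g, a ≠ b →
    ∀ x, C.type x = .svar → ¬ (C.Path x a ∧ C.Path x b)

/-- A set-valued d-DNNF. -/
def IsDDNNF {G : Type} [Fintype G] [DecidableEq G] (C : SetCircuit G) : Prop :=
  C.Deterministic ∧ C.Decomposable

/-- The wire from `a` to `b` is pure: `b` is a union, or `b` is a product whose other input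
captures the empty assignment. -/
def PureWire {G : Type} [Fintype G] [DecidableEq G] (C : SetCircuit G) (a b : G) : Prop :=
  a ∈ C.inputs b ∧
    (C.type b = .cup ∨
      (C.type b = .times ∧ ∃ c ∈ C.inputs b, c ≠ a ∧ (∅ : Finset G) ∈ C.captured c))

/-- Every gate has at most one outgoing pure wire. -/
def UpwardsDeterministic {G : Type} [Fintype G] [DecidableEq G] (C : SetCircuit G) : Prop :=
  ∀ a b c, C.PureWire a b → C.PureWire a c → b = c

end SetCircuit

/-! ### Hybrid circuits -/

/-- Gate types of hybrid circuits: set-valued variables, Boolean variables, unions, products,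
products of a set by a Boolean (`box`), conjunctions, disjunctions, negations. -/
inductive HybridGate
  | svar
  | bvar
  | cup
  | times
  | box
  | conj
  | disj
  | neg
  deriving DecidableEq

/-- Whether a gate type is Boolean; the other gate types are called set-valued. -/
def HybridGate.isBoolean : HybridGate → Bool
  | .bvar => true
  | .conj => true
  | .disj => true
  | .neg => true
  | _ => false

/-- A hybrid circuit. -/
structure HybridCircuit (G : Type) [Fintype G] [DecidableEq G] extends Circuit HybridGate G where
  output_set : (type output).isBoolean = false
  fanIn_var : ∀ g, type g = .svar ∨ type g = .bvar → toCircuit.fanIn g = 0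
  inputs_boolean : ∀ g, type g = .conj ∨ type g = .disj ∨ type g = .neg →
    ∀ a ∈ toCircuit.inputs g, (type a).isBoolean = true
  fanIn_neg : ∀ g, type g = .neg → toCircuit.fanIn g = 1
  inputs_set : ∀ g, type g = .cup ∨ type g = .times →
    ∀ a ∈ toCircuit.inputs g, (type a).isBoolean = false
  fanIn_times : ∀ g, type g = .times → toCircuit.fanIn g = 0 ∨ toCircuit.fanIn g = 2
  inputs_box : ∀ g, type g = .box → ∃ a b, toCircuit.inputs g = {a, b} ∧
    (type a).isBoolean = false ∧ (type b).isBoolean = true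

namespace HybridCircuit

/-- A valuation of the Boolean variables of a hybrid circuit. -/
abbrev Valuation {G : Type} [Fintype G] [DecidableEq G] (C : HybridCircuit G) : Type :=
  {g : G // C.type g = .bvar} → Bool

/-- The valuation obtained by toggling the value of one Boolean variable. -/
def toggle {G : Type} [Fintype G] [DecidableEq G] (C : HybridCircuit G) (ν : C.Valuation)
    (g : {g : G // C.type g = .bvar}) : C.Valuation :=
  Function.update ν g (!(ν g))

open Classical in
/-- The Boolean value of a Boolean gate under a valuation, computed bottom-up
(and `false`, by convention, on set-valued gates). -/
noncomputable def bval {G : Type} [Fintype G] [DecidableEq G] (C : HybridCircuit G)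
    (ν : C.Valuation) : G → Bool :=
  C.wire_wellFounded.fix fun g value =>
    match h : C.type g with
    | .bvar => ν ⟨g, h⟩
    | .conj => decide (∀ a, ∀ w : C.Wire a g, value a w = true)
    | .disj => decide (∃ a, ∃ w : C.Wire a g, value a w = true)
    | .neg => decide (¬ ∃ a, ∃ w : C.Wire a g, value a w = true)
    | _ => false

theorem bval_bvar {G : Type} [Fintype G] [DecidableEq G] (C : HybridCircuit G)
    (ν : C.Valuation) {g : G} (h : C.type g = .bvar) : C.bval ν g = ν ⟨g, h⟩ := by
  rw [bval, WellFounded.fix_eq]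
  split <;> simp_all

theorem bval_conj {G : Type} [Fintype G] [DecidableEq G] (C : HybridCircuit G)
    (ν : C.Valuation) {g : G} (h : C.type g = .conj) :
    C.bval ν g = true ↔ ∀ a, C.Wire a g → C.bval ν a = true := by
  rw [bval, WellFounded.fix_eq]
  split <;> simp_all

theorem bval_disj {G : Type} [Fintype G] [DecidableEq G] (C : HybridCircuit G)
    (ν : C.Valuation) {g : G} (h : C.type g = .disj) :
    C.bval ν g = true ↔ ∃ a, C.Wire a g ∧ C.bval ν a = true := by
  rw [bval, WellFounded.fix_eq]
  split <;> simp_all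

theorem bval_neg {G : Type} [Fintype G] [DecidableEq G] (C : HybridCircuit G)
    (ν : C.Valuation) {g : G} (h : C.type g = .neg) :
    C.bval ν g = true ↔ ¬ ∃ a, C.Wire a g ∧ C.bval ν a = true := by
  rw [bval, WellFounded.fix_eq]
  split <;> simp_all

/-- The gate types of the evaluation: a Boolean gate becomes a product if its value is `true` and a
union if its value is `false`; a `box` gate becomes a product. -/
noncomputable def evalType {G : Type} [Fintype G] [DecidableEq G] (C : HybridCircuit G)
    (ν : C.Valuation) (g : G) : SetGate :=
  match C.type g with
  | .svar => .svar
  | .cup => .cup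
  | .times => .times
  | .box => .times
  | _ => if C.bval ν g = true then .times else .cup

/-- The underlying circuit of the evaluation: the wires into Boolean gates are removed. -/
noncomputable def evalCircuit {G : Type} [Fintype G] [DecidableEq G] (C : HybridCircuit G)
    (ν : C.Valuation) : Circuit SetGate G where
  wires := C.wires.filter (fun w => (C.type w.2).isBoolean = false)
  output := C.output
  type := C.evalType ν
  acyclic := fun g h => C.acyclic g
    (Relation.TransGen.mono (fun _ _ hab => (Finset.mem_filter.mp hab).1) g g h)

theorem inputs_evalCircuit {G : Type} [Fintype G] [DecidableEq G] (C : HybridCircuit G)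
    (ν : C.Valuation) (g : G) :
    (C.evalCircuit ν).inputs g = if (C.type g).isBoolean = true then ∅ else C.inputs g := by
  ext a
  by_cases h : (C.type g).isBoolean = true <;> simp [Circuit.inputs, evalCircuit, h]

/-- The evaluation of a hybrid circuit under a valuation: the set-valued circuit obtained by
replacing each Boolean gate by a product without inputs (if its value is `true`) or by a union
without inputs (if its value is `false`), and by turning each `box` gate into a product. -/
noncomputable def eval {G : Type} [Fintype G] [DecidableEq G] (C : HybridCircuit G)
    (ν : C.Valuation) : SetCircuit G where
  toCircuit := C.evalCircuit ν
  fanIn_svar := by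
    intro g hg
    have ht : C.evalType ν g = .svar := hg
    have h1 : C.type g = .svar := by
      unfold evalType at ht
      split at ht <;> first | assumption | (split at ht <;> cases ht) | cases ht
    have h2 := C.fanIn_var g (Or.inl h1)
    simpa [Circuit.fanIn, inputs_evalCircuit, h1, HybridGate.isBoolean] using h2
  fanIn_times := by
    intro g hg
    unfold Circuit.fanIn
    rw [inputs_evalCircuit]
    by_cases hb : (C.type g).isBoolean = true
    · left
      simp [hb]
    · rw [if_neg hb]
      cases h : C.type g with
      | svar => exact Or.inl (C.fanIn_var g (Or.inl h))
      | times => exact C.fanIn_times g h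
      | box =>
        obtain ⟨a, b, hab, ha, hb'⟩ := C.inputs_box g h
        right
        rw [hab]
        apply Finset.card_pair
        rintro rfl
        rw [ha] at hb'
        cases hb'
      | cup =>
        have ht : C.evalType ν g = .times := hg
        simp [evalType, h] at ht
      | bvar => simp [h, HybridGate.isBoolean] at hb
      | conj => simp [h, HybridGate.isBoolean] at hb
      | disj => simp [h, HybridGate.isBoolean] at hb
      | neg => simp [h, HybridGate.isBoolean] at hb

/-- The set of assignments captured by a gate under a valuation. -/
def capturedBy {G : Type} [Fintype G] [DecidableEq G] (C : HybridCircuit G)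
    (ν : C.Valuation) (g : G) : Set (Finset G) := (C.eval ν).captured g

/-- The set of assignments captured by a hybrid circuit under a valuation. -/
def answers {G : Type} [Fintype G] [DecidableEq G] (C : HybridCircuit G)
    (ν : C.Valuation) : Set (Finset G) := C.capturedBy ν C.output

/-- A hybrid circuit is a d-DNNF if all its evaluations are. -/
def IsDDNNF {G : Type} [Fintype G] [DecidableEq G] (C : HybridCircuit G) : Prop :=
  ∀ ν : C.Valuation, (C.eval ν).IsDDNNF

/-- A hybrid circuit is upwards-deterministic if all its evaluations are. -/
def UpwardsDeterministic {G : Type} [Fintype G] [DecidableEq G] (C : HybridCircuit G) : Prop :=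
  ∀ ν : C.Valuation, (C.eval ν).UpwardsDeterministic

/-- A hybrid circuit is homogenized if its set-valued gates never capture the empty assignment. -/
def Homogenized {G : Type} [Fintype G] [DecidableEq G] (C : HybridCircuit G) : Prop :=
  ∀ (ν : C.Valuation) (g : G), (C.type g).isBoolean = false → (∅ : Finset G) ∉ C.capturedBy ν g

end HybridCircuit

/-! ### A random access machine with uniform cost

The memory consists of arrays of natural numbers, in two regions: the index and the working memory.
A program only mentions finitely many registers and arrays. The arithmetic is limited to successor
and predecessor, so that a step never makes the largest number that is present grow by
more than one. -/

/-- The two regions of the memory. -/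
inductive Region
  | index
  | work
  deriving DecidableEq

/-- Memory contents: `m r b i` is the cell number `i` of the array number `b` of the region `r`. -/
abbrev Memory : Type := Region → ℕ → ℕ → ℕ

/-- The elementary instructions; `d`, `s`, `i` are register numbers, `b` is an array number. -/
inductive Instr
  /-- set register `d` to the constant `c` -/
  | const (d c : ℕ)
  /-- copy register `s` to register `d` -/
  | move (d s : ℕ)
  /-- increment register `d` -/
  | succ (d : ℕ)
  /-- decrement register `d` (zero stays zero) -/
  | pred (d : ℕ)
  /-- copy to register `d` the cell of array `b` whose number is in register `i` -/
  | load (d : ℕ) (r : Region) (b i : ℕ)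
  /-- copy register `s` to the cell of array `b` whose number is in register `i` -/
  | store (r : Region) (b i s : ℕ)
  /-- append the contents of register `s` to the output -/
  | emit (s : ℕ)

/-- Machine states: registers, memory, output produced so far, and set of the cells of
the working memory (array number, cell number) that were accessed so far. -/
structure MachineState where
  reg : ℕ → ℕ
  mem : Memory
  out : List ℕ
  used : Finset (ℕ × ℕ)

namespace MachineState

def setReg (σ : MachineState) (d v : ℕ) : MachineState :=
  { σ with reg := Function.update σ.reg d v }

/-- Record an access to a cell. -/
def touch (σ : MachineState) (r : Region) (b i : ℕ) : MachineState :=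
  match r with
  | .index => σ
  | .work => { σ with used := insert (b, i) σ.used }

def setCell (σ : MachineState) (r : Region) (b i v : ℕ) : MachineState :=
  { σ with mem := fun r' b' i' => if r' = r ∧ b' = b ∧ i' = i then v else σ.mem r' b' i' }

/-- The state in which a program is called on memory `m` with argument `x`: the argument is in
register `0`, the other registers are zero, and nothing has been output or accessed. -/
def call (m : Memory) (x : ℕ) : MachineState where
  reg := Function.update (fun _ => 0) 0 x
  mem := m
  out := []
  used := ∅

end MachineState

/-- The effect of an elementary instruction. -/
def Instr.exec : Instr → MachineState → MachineState
  | .const d c, σ => σ.setReg d c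
  | .move d s, σ => σ.setReg d (σ.reg s)
  | .succ d, σ => σ.setReg d (σ.reg d + 1)
  | .pred d, σ => σ.setReg d (σ.reg d - 1)
  | .load d r b i, σ => (σ.touch r b (σ.reg i)).setReg d (σ.mem r b (σ.reg i))
  | .store r b i s, σ => (σ.touch r b (σ.reg i)).setCell r b (σ.reg i) (σ.reg s)
  | .emit s, σ => { σ with out := σ.out ++ [σ.reg s] }

/-- Tests between two registers. -/
inductive Test
  | eq (s s' : ℕ)
  | lt (s s' : ℕ)

def Test.holds : Test → MachineState → Prop
  | .eq s s', σ => σ.reg s = σ.reg s'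
  | .lt s s', σ => σ.reg s < σ.reg s'

/-- Programs of the machine: instructions, sequences, conditionals, and while-loops. -/
inductive Program
  | skip
  | instr (i : Instr)
  | seq (p q : Program)
  | branch (c : Test) (p q : Program)
  | loop (c : Test) (p : Program)

/-- `Runs p σ t σ'`: started in state `σ`, the program `p` halts in state `σ'` after `t` steps.
Each execution of an instruction and each evaluation of a test is one step. -/
inductive Runs : Program → MachineState → ℕ → MachineState → Prop
  | skip {σ : MachineState} : Runs .skip σ 1 σ
  | instr {i : Instr} {σ : MachineState} : Runs (.instr i) σ 1 (i.exec σ)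
  | seq {p q : Program} {σ₁ σ₂ σ₃ : MachineState} {t₁ t₂ : ℕ} :
      Runs p σ₁ t₁ σ₂ → Runs q σ₂ t₂ σ₃ → Runs (.seq p q) σ₁ (t₁ + t₂) σ₃
  | branch_true {c : Test} {p q : Program} {σ₁ σ₂ : MachineState} {t : ℕ} :
      c.holds σ₁ → Runs p σ₁ t σ₂ → Runs (.branch c p q) σ₁ (t + 1) σ₂
  | branch_false {c : Test} {p q : Program} {σ₁ σ₂ : MachineState} {t : ℕ} :
      ¬ c.holds σ₁ → Runs q σ₁ t σ₂ → Runs (.branch c p q) σ₁ (t + 1) σ₂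
  | loop_done {c : Test} {p : Program} {σ : MachineState} :
      ¬ c.holds σ → Runs (.loop c p) σ 1 σ
  | loop_step {c : Test} {p : Program} {σ₁ σ₂ σ₃ : MachineState} {t₁ t₂ : ℕ} :
      c.holds σ₁ → Runs p σ₁ t₁ σ₂ → Runs (.loop c p) σ₂ t₂ σ₃ →
      Runs (.loop c p) σ₁ (t₁ + t₂ + 1) σ₃

/-- The program never writes to the index. -/
def Program.IndexReadOnly : Program → Prop
  | .instr (.store .index _ _ _) => False
  | .seq p q => p.IndexReadOnly ∧ q.IndexReadOnly
  | .branch _ p q => p.IndexReadOnly ∧ q.IndexReadOnly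
  | .loop _ p => p.IndexReadOnly
  | _ => True

/-! ### Enumeration under updates -/

/-- Numerical code of a gate type. -/
def HybridGate.code : HybridGate → ℕ
  | .svar => 0
  | .bvar => 1
  | .cup => 2
  | .times => 3
  | .box => 4
  | .conj => 5
  | .disj => 6
  | .neg => 7

/-- The memory that holds a hybrid circuit (whose gates are numbered arbitrarily, and
whose wires are listed by `ws`) and a valuation. In the index region, array `0` holds the number
of gates, the number of wires and the output gate; array `1` the types of the gates; array `2` the
values of the Boolean variables; arrays `3` and `4` the origins and the targets of the wires.
Everything else is zero. -/
def encode {n : ℕ} (C : HybridCircuit (Fin n)) (ws : List (Fin n × Fin n)) (ν : C.Valuation) :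
    Memory
  | .index, 0, 0 => n
  | .index, 0, 1 => ws.length
  | .index, 0, 2 => (C.output : ℕ)
  | .index, 1, i => if h : i < n then (C.type ⟨i, h⟩).code else 0
  | .index, 2, i =>
      if h : i < n then
        if h' : C.type ⟨i, h⟩ = .bvar then (ν ⟨⟨i, h⟩, h'⟩).toNat else 0
      else 0
  | .index, 3, e => if h : e < ws.length then ((ws[e]'h).1 : ℕ) else 0
  | .index, 4, e => if h : e < ws.length then ((ws[e]'h).2 : ℕ) else 0
  | _, _, _ => 0

/-- The output `l` is a listing, without repetition, of (the numbers of) the elements of `B`. -/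
def ListsElements {n : ℕ} (l : List ℕ) (B : Finset (Fin n)) : Prop :=
  l.Nodup ∧ ∀ i : ℕ, i ∈ l ↔ ∃ g ∈ B, (g : ℕ) = i

/-- An algorithm for enumeration under updates: a preprocessing program, which turns the input into
an index and an initial enumeration state, an enumeration program, which produces the next
assignment and the next enumeration state and cannot write to the index, and an update program.
The enumeration state is the contents of the working memory. -/
structure EnumAlgorithm where
  preprocess : Program
  next : Program
  update : Program
  next_readOnly : next.IndexReadOnly

/-- The special enumeration state which indicates that the enumeration is over: cell `0` of
array `0` of the working memory is zero. -/
def EnumerationOver (m : Memory) : Prop := m .work 0 0 = 0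

/-- `Session 𝒜 C ws ν₀ ν L U m`: some sequence of calls to `𝒜`, starting with the preprocessing of
`C` and `ν₀`, may lead to the situation where the current valuation is `ν`, the assignments
produced since the last update (or since the preprocessing, if there was no update) are
those of `L`, in this order, the cells of the working memory that the enumeration program accessed
meanwhile are those of `U`, and the memory contents are `m`. The enumeration program
is called only if the enumeration is not over. The update program may be called at any time; it
receives the Boolean variable to toggle, and it restarts the enumeration. -/
inductive Session {n : ℕ} (𝒜 : EnumAlgorithm) (C : HybridCircuit (Fin n))
    (ws : List (Fin n × Fin n)) (ν₀ : C.Valuation) :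
    C.Valuation → List (Finset (Fin n)) → Finset (ℕ × ℕ) → Memory → Prop
  | start {t : ℕ} {σ : MachineState} :
      Runs 𝒜.preprocess (MachineState.call (encode C ws ν₀) 0) t σ →
      Session 𝒜 C ws ν₀ ν₀ [] ∅ σ.mem
  | next {ν : C.Valuation} {L : List (Finset (Fin n))} {U : Finset (ℕ × ℕ)} {m : Memory}
      {t : ℕ} {σ : MachineState} {B : Finset (Fin n)} :
      Session 𝒜 C ws ν₀ ν L U m → ¬ EnumerationOver m →
      Runs 𝒜.next (MachineState.call m 0) t σ → ListsElements σ.out B →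
      Session 𝒜 C ws ν₀ ν (L ++ [B]) (U ∪ σ.used) σ.mem
  | update {ν : C.Valuation} {L : List (Finset (Fin n))} {U : Finset (ℕ × ℕ)} {m : Memory}
      {t : ℕ} {σ : MachineState} (g : {g : Fin n // C.type g = .bvar}) :
      Session 𝒜 C ws ν₀ ν L U m →
      Runs 𝒜.update (MachineState.call m (g : Fin n)) t σ →
      Session 𝒜 C ws ν₀ (C.toggle ν g) [] ∅ σ.mem

/-- The algorithm `𝒜`, given `C` and the initial valuation `ν₀`, enumerates the captured set under
updates, with all resource bounds holding with the constant `K`. -/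
structure EnumeratesUnderUpdates {n : ℕ} (𝒜 : EnumAlgorithm) (K : ℕ) (C : HybridCircuit (Fin n))
    (ws : List (Fin n × Fin n)) (ν₀ : C.Valuation) : Prop where
  /-- The preprocessing halts, in time linear in the circuit. -/
  preprocessing : ∃ t σ, Runs 𝒜.preprocess (MachineState.call (encode C ws ν₀) 0) t σ ∧
    t ≤ K * C.size
  /-- As long as the enumeration is not over, the next call produces a new captured assignment,
  in time, and accessing a number of working memory cells, linear in that assignment. -/
  production : ∀ ν L U m, Session 𝒜 C ws ν₀ ν L U m → ¬ EnumerationOver m →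
    ∃ t σ B, Runs 𝒜.next (MachineState.call m 0) t σ ∧ ListsElements σ.out B ∧
      B ∈ C.answers ν ∧ B ∉ L ∧ t ≤ K * B.card ∧ σ.used.card ≤ K * B.card
  /-- When the enumeration is over, all captured assignments have been produced. -/
  exhaustion : ∀ ν L U m, Session 𝒜 C ws ν₀ ν L U m → EnumerationOver m →
    ∀ B ∈ C.answers ν, B ∈ L
  /-- The number of working memory cells that the enumeration uses overall is linear in the size of
  the largest captured assignment. -/
  memory : ∀ ν L U m, Session 𝒜 C ws ν₀ ν L U m →
    ∀ M : ℕ, (∀ B ∈ C.answers ν, B.card ≤ M) → U.card ≤ K * M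
  /-- Toggling one Boolean variable takes time linear in the dependency size. -/
  updating : ∀ ν L U m, Session 𝒜 C ws ν₀ ν L U m → ∀ g : {g : Fin n // C.type g = .bvar},
    ∃ t σ, Runs 𝒜.update (MachineState.call m (g : Fin n)) t σ ∧ t ≤ K * C.dependencySize

/-!
A gate is *alive* if it captures some assignment. The *exits* of a set-valued gate are the variables
and products, alive, from which it can be reached by pure wires through gates that are alive; the
gate captures the disjoint union of the sets captured by its exits
(`HybridCircuit.Admissible.mem_capturedBy_iff`, `HybridCircuit.Admissible.exits_pairwise`).
Upwards-determinism makes the pure wires a forest. List the exits of each gate from left to right: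
along a pure wire the exits of the origin are consecutive exits of the target, and hence the
successor of an exit is the same in all the lists in which it has one
(`HybridCircuit.Admissible.consecutive_unique`). One array of links thus represents the lists of
exits of all gates at once, each gate being given by pointers to its first and last exit. This
information at a gate is computed from that at its inputs in time linear in the fan-in, without
destroying the lists of other gates.

The index consists of these links and pointers. Toggling a variable affects the gates that depend
on it only; they are collected by an exploration, which counts for each of them the inputs among
them, and are recomputed in topological order (`updateProgram_spec`). Preprocessing is the same
computation for all gates, after the adjacency lists have been built (`preprocessProgram_spec`).

Expanding the output gate by one of its exits, the inputs of a product by one of their exits, and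
so on, gives a *derivation*, which is a binary tree with variables at the leaves. Homogenization
ensures that no exit is a product without inputs, so that a derivation of an assignment `A` has
`2 * |A| - 1` nodes (`HybridCircuit.Admissible.length_add_length`). By determinism and
decomposability the derivations correspond bijectively to the captured assignments
(`HybridCircuit.Admissible.mem_stackCaptured_iff`, `HybridCircuit.Admissible.map_vars_nodup`). They
are enumerated in lexicographic order of their preorder listings: the enumeration state is the
listing of a derivation up to the last position where a further exit can be tried, with
the exit at this position already advanced along the links. The next derivation is obtained by
always choosing the first exit from there on, which never fails as all the gates met are
alive (`nextProgram_spec`). The gates that remain to be expanded at a position form a stack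
that all the later positions share: it is stored as one link, to the product whose second input
is at the top of the stack (`HybridCircuit.IsLink`).

Layout of the index: arrays `0` to `4` hold the input; arrays `5` and `6` (`7` and `8`) hold for
each gate the linked list of the wires that leave (enter) it, where the pointer to a wire is its
number plus one; array `9` holds the counters and array `10` the queue used by the updates; arrays `11`,
`12`, `13` tell for each gate whether it is alive and which are its first and last exits; array `14`
holds the links between exits. Layout of the working memory: cell `0` of array `0` holds the number
of positions of the enumeration state; arrays `1`, `2`, `3` hold for each position the
exit, the last exit that can be tried, and the link to the product.
-/

/-! ### Total correctness and running times of machine programs -/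

/-- Sequential composition of programs. -/
infixr:60 " ;; " => Program.seq

/-- Total correctness: started in `σ`, the program halts, and `Q` holds of the number of steps
and of the final state. -/
def Halts (p : Program) (σ : MachineState) (Q : ℕ → MachineState → Prop) : Prop :=
  ∃ t σ', Runs p σ t σ' ∧ Q t σ'

theorem Runs.deterministic {p : Program} {σ σ₁ σ₂ : MachineState} {t₁ t₂ : ℕ}
    (h₁ : Runs p σ t₁ σ₁) (h₂ : Runs p σ t₂ σ₂) : t₁ = t₂ ∧ σ₁ = σ₂ := by
  induction h₁ generalizing t₂ σ₂ with
  | skip => cases h₂; exact ⟨rfl, rfl⟩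
  | instr => cases h₂; exact ⟨rfl, rfl⟩
  | seq _ _ ih₁ ih₂ =>
    cases h₂ with
    | seq a b =>
      obtain ⟨rfl, rfl⟩ := ih₁ a
      obtain ⟨rfl, rfl⟩ := ih₂ b
      exact ⟨rfl, rfl⟩
  | branch_true hc _ ih =>
    cases h₂ with
    | branch_true _ a => obtain ⟨rfl, rfl⟩ := ih a; exact ⟨rfl, rfl⟩
    | branch_false hn _ => exact absurd hc hn
  | branch_false hc _ ih =>
    cases h₂ with
    | branch_true hn _ => exact absurd hn hc
    | branch_false _ a => obtain ⟨rfl, rfl⟩ := ih a; exact ⟨rfl, rfl⟩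
  | loop_done hc =>
    cases h₂ with
    | loop_done => exact ⟨rfl, rfl⟩
    | loop_step hn _ _ => exact absurd hn hc
  | loop_step hc _ _ ih₁ ih₂ =>
    cases h₂ with
    | loop_done hn => exact absurd hc hn
    | loop_step _ a b =>
      obtain ⟨rfl, rfl⟩ := ih₁ a
      obtain ⟨rfl, rfl⟩ := ih₂ b
      exact ⟨rfl, rfl⟩

namespace Halts

theorem mono {p : Program} {σ : MachineState} {Q Q' : ℕ → MachineState → Prop}
    (h : Halts p σ Q) (hQ : ∀ t σ', Q t σ' → Q' t σ') : Halts p σ Q' := by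
  obtain ⟨t, σ', hr, hq⟩ := h
  exact ⟨t, σ', hr, hQ _ _ hq⟩

/-- What is known to hold after some run holds after every run, as runs are deterministic. -/
theorem of_runs {p : Program} {σ σ' : MachineState} {t : ℕ} {Q : ℕ → MachineState → Prop}
    (h : Halts p σ Q) (hr : Runs p σ t σ') : Q t σ' := by
  obtain ⟨t', σ'', hr', hq⟩ := h
  obtain ⟨rfl, rfl⟩ := hr'.deterministic hr
  exact hq

theorem skip_iff {σ : MachineState} {Q : ℕ → MachineState → Prop} :
    Halts .skip σ Q ↔ Q 1 σ := by
  constructor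
  · rintro ⟨t, σ', hr, hq⟩
    cases hr
    exact hq
  · exact fun h => ⟨_, _, .skip, h⟩

theorem instr_iff {i : Instr} {σ : MachineState} {Q : ℕ → MachineState → Prop} :
    Halts (.instr i) σ Q ↔ Q 1 (i.exec σ) := by
  constructor
  · rintro ⟨t, σ', hr, hq⟩
    cases hr
    exact hq
  · exact fun h => ⟨_, _, .instr, h⟩

theorem seq_iff {p q : Program} {σ : MachineState} {Q : ℕ → MachineState → Prop} :
    Halts (p ;; q) σ Q ↔
      Halts p σ (fun t σ' => Halts q σ' (fun t' σ'' => Q (t + t') σ'')) := by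
  constructor
  · rintro ⟨t, σ', hr, hq⟩
    cases hr with
    | seq a b => exact ⟨_, _, a, _, _, b, hq⟩
  · rintro ⟨t, σ', a, t', σ'', b, hq⟩
    exact ⟨_, _, .seq a b, hq⟩

theorem branch_iff {c : Test} {p q : Program} {σ : MachineState}
    {Q : ℕ → MachineState → Prop} :
    Halts (.branch c p q) σ Q ↔
      (c.holds σ → Halts p σ (fun t σ' => Q (t + 1) σ')) ∧
      (¬ c.holds σ → Halts q σ (fun t σ' => Q (t + 1) σ')) := by
  constructor
  · rintro ⟨t, σ', hr, hq⟩
    cases hr with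
    | branch_true hc a => exact ⟨fun _ => ⟨_, _, a, hq⟩, fun hn => absurd hc hn⟩
    | branch_false hc a => exact ⟨fun hn => absurd hn hc, fun _ => ⟨_, _, a, hq⟩⟩
  · rintro ⟨h₁, h₂⟩
    by_cases hc : c.holds σ
    · obtain ⟨t, σ', a, hq⟩ := h₁ hc
      exact ⟨_, _, .branch_true hc a, hq⟩
    · obtain ⟨t, σ', a, hq⟩ := h₂ hc
      exact ⟨_, _, .branch_false hc a, hq⟩

theorem loop_done {c : Test} {p : Program} {σ : MachineState} {Q : ℕ → MachineState → Prop}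
    (hc : ¬ c.holds σ) (hq : Q 1 σ) : Halts (.loop c p) σ Q :=
  ⟨_, _, .loop_done hc, hq⟩

theorem loop_step {c : Test} {p : Program} {σ : MachineState} {Q : ℕ → MachineState → Prop}
    (hc : c.holds σ)
    (h : Halts p σ (fun t σ' => Halts (.loop c p) σ' (fun t' σ'' => Q (t + t' + 1) σ''))) :
    Halts (.loop c p) σ Q := by
  obtain ⟨t, σ', a, t', σ'', b, hq⟩ := h
  exact ⟨_, _, .loop_step hc a b, hq⟩

end Halts

namespace MachineState

variable (σ : MachineState) (d v : ℕ) (r : Region) (b i : ℕ)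

@[simp] theorem setReg_reg : (σ.setReg d v).reg = Function.update σ.reg d v := rfl
@[simp] theorem setReg_mem : (σ.setReg d v).mem = σ.mem := rfl
@[simp] theorem setReg_out : (σ.setReg d v).out = σ.out := rfl
@[simp] theorem setReg_used : (σ.setReg d v).used = σ.used := rfl
@[simp] theorem touch_reg : (σ.touch r b i).reg = σ.reg := by cases r <;> rfl
@[simp] theorem touch_mem : (σ.touch r b i).mem = σ.mem := by cases r <;> rfl
@[simp] theorem touch_out : (σ.touch r b i).out = σ.out := by cases r <;> rfl
@[simp] theorem touch_index_used : (σ.touch .index b i).used = σ.used := rfl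
@[simp] theorem touch_work_used : (σ.touch .work b i).used = insert (b, i) σ.used := rfl
@[simp] theorem setCell_reg : (σ.setCell r b i v).reg = σ.reg := rfl
@[simp] theorem setCell_out : (σ.setCell r b i v).out = σ.out := rfl
@[simp] theorem setCell_used : (σ.setCell r b i v).used = σ.used := rfl

/-- Writing to a cell changes one array only, at one place only. -/
@[simp] theorem setCell_mem (r' : Region) (b' : ℕ) :
    (σ.setCell r b i v).mem r' b' =
      if r' = r ∧ b' = b then Function.update (σ.mem r b) i v else σ.mem r' b' := by
  funext i'
  by_cases h : r' = r ∧ b' = b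
  · obtain ⟨rfl, rfl⟩ := h
    by_cases hi : i' = i <;> simp [setCell, hi]
  · have : ¬ (r' = r ∧ b' = b ∧ i' = i) := fun h' => h ⟨h'.1, h'.2.1⟩
    simp only [setCell, if_neg h, if_neg this]

@[simp] theorem call_mem (m : Memory) (x : ℕ) : (call m x).mem = m := rfl
@[simp] theorem call_out (m : Memory) (x : ℕ) : (call m x).out = [] := rfl
@[simp] theorem call_used (m : Memory) (x : ℕ) : (call m x).used = ∅ := rfl
@[simp] theorem call_reg_zero (m : Memory) (x : ℕ) : (call m x).reg 0 = x := rfl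
theorem call_reg (m : Memory) (x r : ℕ) (h : r ≠ 0) : (call m x).reg r = 0 := by
  simp [call, h]

end MachineState

namespace Instr

variable (σ : MachineState) (d c s b i : ℕ) (r : Region)

@[simp] theorem exec_const : (Instr.const d c).exec σ = σ.setReg d c := rfl
@[simp] theorem exec_move : (Instr.move d s).exec σ = σ.setReg d (σ.reg s) := rfl
@[simp] theorem exec_succ : (Instr.succ d).exec σ = σ.setReg d (σ.reg d + 1) := rfl
@[simp] theorem exec_pred : (Instr.pred d).exec σ = σ.setReg d (σ.reg d - 1) := rfl
@[simp] theorem exec_load : (Instr.load d r b i).exec σ =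
    (σ.touch r b (σ.reg i)).setReg d (σ.mem r b (σ.reg i)) := rfl
@[simp] theorem exec_store : (Instr.store r b i s).exec σ =
    (σ.touch r b (σ.reg i)).setCell r b (σ.reg i) (σ.reg s) := rfl
@[simp] theorem exec_emit_reg : ((Instr.emit s).exec σ).reg = σ.reg := rfl
@[simp] theorem exec_emit_mem : ((Instr.emit s).exec σ).mem = σ.mem := rfl
@[simp] theorem exec_emit_used : ((Instr.emit s).exec σ).used = σ.used := rfl
@[simp] theorem exec_emit_out : ((Instr.emit s).exec σ).out = σ.out ++ [σ.reg s] := rfl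

end Instr

@[simp] theorem Test.holds_eq (s s' : ℕ) (σ : MachineState) :
    (Test.eq s s').holds σ ↔ σ.reg s = σ.reg s' := Iff.rfl
@[simp] theorem Test.holds_lt (s s' : ℕ) (σ : MachineState) :
    (Test.lt s s').holds σ ↔ σ.reg s < σ.reg s' := Iff.rfl

/-! ### Sets captured by the gates of a hybrid circuit -/

namespace SetCircuit

variable {G : Type} [Fintype G] [DecidableEq G] (E : SetCircuit G)

theorem mem_captured_times {g a b : G} (h : E.type g = .times) (hi : E.inputs g = {a, b})
    (hab : a ≠ b) {A : Finset G} :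
    A ∈ E.captured g ↔ ∃ A₁ ∈ E.captured a, ∃ A₂ ∈ E.captured b, A₁ ∪ A₂ = A := by
  constructor
  · intro hA
    cases hA with
    | svar h' => rw [h] at h'; cases h'
    | cup h' => rw [h] at h'; cases h'
    | times_nil _ h' => rw [hi] at h'; exact absurd h' (Finset.insert_ne_empty _ _)
    | @times _ a' b' A₁ A₂ _ h' hab' h₁ h₂ =>
      rw [hi] at h'
      have ha : a' = a ∨ a' = b := by
        have : a' ∈ ({a, b} : Finset G) := by rw [h']; simp
        simpa using this
      have hb : b' = a ∨ b' = b := by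
        have : b' ∈ ({a, b} : Finset G) := by rw [h']; simp
        simpa using this
      rcases ha with rfl | rfl <;> rcases hb with rfl | rfl
      · exact absurd rfl hab'
      · exact ⟨A₁, h₁, A₂, h₂, rfl⟩
      · exact ⟨A₂, h₂, A₁, h₁, Finset.union_comm _ _⟩
      · exact absurd rfl hab'
  · rintro ⟨A₁, h₁, A₂, h₂, rfl⟩
    exact .times h hi hab h₁ h₂

/-- A captured assignment consists of variables that have a path to the gate. -/
theorem Captures.support {g : G} {A : Finset G} (h : E.Captures g A) :
    ∀ x ∈ A, E.type x = .svar ∧ E.Path x g := by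
  have wire : ∀ {a g : G}, a ∈ E.inputs g → E.Wire a g := by
    intro a g ha
    simpa [Circuit.inputs, Circuit.Wire] using ha
  induction h with
  | svar h =>
    intro x hx
    rw [Finset.mem_singleton] at hx
    subst hx
    exact ⟨h, .refl⟩
  | cup _ ha _ ih => exact fun x hx => ⟨(ih x hx).1, (ih x hx).2.tail (wire ha)⟩
  | times_nil => simp
  | times _ hi _ _ _ ih₁ ih₂ =>
    intro x hx
    rcases Finset.mem_union.mp hx with hx | hx
    · exact ⟨(ih₁ x hx).1, (ih₁ x hx).2.tail (wire (by rw [hi]; simp))⟩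
    · exact ⟨(ih₂ x hx).1, (ih₂ x hx).2.tail (wire (by rw [hi]; simp))⟩

end SetCircuit

namespace HybridCircuit

section Captured

variable {G : Type} [Fintype G] [DecidableEq G] (C : HybridCircuit G) (ν : C.Valuation)

theorem mem_inputs {a g : G} : a ∈ C.inputs g ↔ C.Wire a g := by
  simp [Circuit.inputs, Circuit.Wire]

theorem inputs_eval {g : G} (h : (C.type g).isBoolean = false) :
    (C.eval ν).inputs g = C.inputs g :=
  (C.inputs_evalCircuit ν g).trans (by simp [h])

theorem type_eval (g : G) : (C.eval ν).type g = C.evalType ν g := rfl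

theorem type_eval_svar {g : G} : (C.eval ν).type g = .svar ↔ C.type g = .svar := by
  rw [type_eval, evalType]
  split <;> simp_all
  all_goals split <;> simp

theorem mem_capturedBy_svar {g : G} (h : C.type g = .svar) {A : Finset G} :
    A ∈ C.capturedBy ν g ↔ A = {g} := by
  have ht : (C.eval ν).type g = .svar := by rw [type_eval, evalType, h]
  constructor
  · intro hA
    cases hA with
    | svar => rfl
    | cup h' => rw [ht] at h'; cases h'
    | times_nil h' => rw [ht] at h'; cases h'
    | times h' => rw [ht] at h'; cases h'
  · rintro rfl
    exact .svar ht

theorem mem_capturedBy_boolean {g : G} (h : (C.type g).isBoolean = true) {A : Finset G} :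
    A ∈ C.capturedBy ν g ↔ C.bval ν g = true ∧ A = ∅ := by
  have ht : (C.eval ν).type g = if C.bval ν g = true then .times else .cup := by
    rw [type_eval, evalType]
    split <;> first | rfl | simp_all [HybridGate.isBoolean]
  have hi : (C.eval ν).inputs g = ∅ :=
    (C.inputs_evalCircuit ν g).trans (by simp [h])
  constructor
  · intro hA
    cases hA with
    | svar h' => rw [ht] at h'; split at h' <;> cases h'
    | cup _ h' => rw [hi] at h'; simp at h'
    | times_nil h' =>
      rw [ht] at h'
      split at h'
      · exact ⟨by assumption, rfl⟩
      · cases h'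
    | times _ h' => rw [hi] at h'; exact absurd h'.symm (Finset.insert_ne_empty _ _)
  · rintro ⟨hb, rfl⟩
    exact .times_nil (by rw [ht, if_pos hb]) hi

theorem mem_capturedBy_cup {g : G} (h : C.type g = .cup) {A : Finset G} :
    A ∈ C.capturedBy ν g ↔ ∃ a, C.Wire a g ∧ A ∈ C.capturedBy ν a := by
  have ht : (C.eval ν).type g = .cup := by rw [type_eval, evalType, h]
  have hi : (C.eval ν).inputs g = C.inputs g :=
    C.inputs_eval ν (by rw [h]; rfl)
  constructor
  · intro hA
    cases hA with
    | svar h' => rw [ht] at h'; cases h'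
    | @cup _ a _ _ ha hA =>
      rw [hi, mem_inputs] at ha
      exact ⟨a, ha, hA⟩
    | times_nil h' => rw [ht] at h'; cases h'
    | times h' => rw [ht] at h'; cases h'
  · rintro ⟨a, ha, hA⟩
    exact .cup ht (by rw [hi, mem_inputs]; exact ha) hA

theorem mem_capturedBy_times {g a b : G} (h : C.type g = .times) (hi : C.inputs g = {a, b})
    (hab : a ≠ b) {A : Finset G} :
    A ∈ C.capturedBy ν g ↔ ∃ A₁ ∈ C.capturedBy ν a, ∃ A₂ ∈ C.capturedBy ν b, A₁ ∪ A₂ = A :=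
  (C.eval ν).mem_captured_times (by rw [type_eval, evalType, h])
    (by rw [C.inputs_eval ν (by rw [h]; rfl), hi]) hab

theorem mem_capturedBy_box {g a b : G} (h : C.type g = .box) (hi : C.inputs g = {a, b})
    (ha : (C.type a).isBoolean = false) (hb : (C.type b).isBoolean = true) {A : Finset G} :
    A ∈ C.capturedBy ν g ↔ C.bval ν b = true ∧ A ∈ C.capturedBy ν a := by
  have hab : a ≠ b := by
    rintro rfl
    rw [ha] at hb
    cases hb
  have := (C.eval ν).mem_captured_times (A := A) (by rw [type_eval, evalType, h])
    (by rw [C.inputs_eval ν (by rw [h]; rfl), hi]) hab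
  refine this.trans ⟨?_, ?_⟩
  · rintro ⟨A₁, h₁, A₂, h₂, rfl⟩
    obtain ⟨hv, rfl⟩ := (C.mem_capturedBy_boolean ν hb).mp h₂
    rw [Finset.union_empty]
    exact ⟨hv, h₁⟩
  · rintro ⟨hv, hA⟩
    exact ⟨A, hA, ∅, (C.mem_capturedBy_boolean ν hb).mpr ⟨hv, rfl⟩, Finset.union_empty _⟩

/-- A gate is alive under a valuation if the set that it captures is not empty. A Boolean gate is
alive if its value is `true`. -/
def Alive (g : G) : Prop := (C.capturedBy ν g).Nonempty

theorem alive_boolean {g : G} (h : (C.type g).isBoolean = true) :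
    C.Alive ν g ↔ C.bval ν g = true := by
  constructor
  · rintro ⟨A, hA⟩
    exact ((C.mem_capturedBy_boolean ν h).mp hA).1
  · exact fun hv => ⟨∅, (C.mem_capturedBy_boolean ν h).mpr ⟨hv, rfl⟩⟩

theorem alive_svar {g : G} (h : C.type g = .svar) : C.Alive ν g :=
  ⟨{g}, (C.mem_capturedBy_svar ν h).mpr rfl⟩

theorem alive_bvar {g : G} (h : C.type g = .bvar) : C.Alive ν g ↔ ν ⟨g, h⟩ = true := by
  rw [C.alive_boolean ν (by rw [h]; rfl), C.bval_bvar ν h]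

theorem boolean_input {a g : G} (h : C.type g = .conj ∨ C.type g = .disj ∨ C.type g = .neg)
    (ha : C.Wire a g) : (C.type a).isBoolean = true :=
  C.inputs_boolean g h a (C.mem_inputs.mpr ha)

theorem alive_any {g : G} (h : C.type g = .cup ∨ C.type g = .disj) :
    C.Alive ν g ↔ ∃ a, C.Wire a g ∧ C.Alive ν a := by
  rcases h with h | h
  · constructor
    · rintro ⟨A, hA⟩
      obtain ⟨a, ha, hA⟩ := (C.mem_capturedBy_cup ν h).mp hA
      exact ⟨a, ha, A, hA⟩
    · rintro ⟨a, ha, A, hA⟩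
      exact ⟨A, (C.mem_capturedBy_cup ν h).mpr ⟨a, ha, hA⟩⟩
  · rw [C.alive_boolean ν (by rw [h]; rfl), C.bval_disj ν h]
    exact exists_congr fun a => and_congr_right fun ha =>
      (C.alive_boolean ν (C.boolean_input (.inr (.inl h)) ha)).symm

theorem alive_neg {g : G} (h : C.type g = .neg) :
    C.Alive ν g ↔ ¬ ∃ a, C.Wire a g ∧ C.Alive ν a := by
  rw [C.alive_boolean ν (by rw [h]; rfl), C.bval_neg ν h]
  exact not_congr (exists_congr fun a => and_congr_right fun ha =>
    (C.alive_boolean ν (C.boolean_input (.inr (.inr h)) ha)).symm)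

/-- In a homogenized circuit every product has two inputs, as a product without inputs
captures the empty assignment. -/
theorem Homogenized.inputs_times {C : HybridCircuit G} (hH : C.Homogenized) {g : G}
    (h : C.type g = .times) : (C.inputs g).card = 2 := by
  refine (C.fanIn_times g h).resolve_left fun h0 => ?_
  have hb : (C.type g).isBoolean = false := by rw [h]; rfl
  refine hH (fun _ => false) g hb (.times_nil ?_ ?_)
  · rw [type_eval, evalType, h]
  · rw [C.inputs_eval _ hb]
    exact Finset.card_eq_zero.mp h0

theorem alive_all (hH : C.Homogenized) {g : G}
    (h : C.type g = .times ∨ C.type g = .box ∨ C.type g = .conj) :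
    C.Alive ν g ↔ ∀ a, C.Wire a g → C.Alive ν a := by
  rcases h with h | h | h
  · obtain ⟨a, b, hab, hi⟩ := Finset.card_eq_two.mp (hH.inputs_times h)
    have hw : ∀ c, C.Wire c g ↔ c = a ∨ c = b := fun c => by rw [← mem_inputs, hi]; simp
    simp only [hw, forall_eq_or_imp, forall_eq]
    constructor
    · rintro ⟨A, hA⟩
      obtain ⟨A₁, h₁, A₂, h₂, _⟩ := (C.mem_capturedBy_times ν h hi hab).mp hA
      exact ⟨⟨A₁, h₁⟩, ⟨A₂, h₂⟩⟩
    · rintro ⟨⟨A₁, h₁⟩, ⟨A₂, h₂⟩⟩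
      exact ⟨A₁ ∪ A₂, (C.mem_capturedBy_times ν h hi hab).mpr ⟨A₁, h₁, A₂, h₂, rfl⟩⟩
  · obtain ⟨a, b, hi, ha, hb⟩ := C.inputs_box g h
    have hw : ∀ c, C.Wire c g ↔ c = a ∨ c = b := fun c => by rw [← mem_inputs, hi]; simp
    simp only [hw, forall_eq_or_imp, forall_eq, C.alive_boolean ν hb]
    constructor
    · rintro ⟨A, hA⟩
      obtain ⟨hv, hA⟩ := (C.mem_capturedBy_box ν h hi ha hb).mp hA
      exact ⟨⟨A, hA⟩, hv⟩
    · rintro ⟨⟨A, hA⟩, hv⟩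
      exact ⟨A, (C.mem_capturedBy_box ν h hi ha hb).mpr ⟨hv, hA⟩⟩
  · rw [C.alive_boolean ν (by rw [h]; rfl), C.bval_conj ν h]
    exact forall_congr' fun a => imp_congr_right fun ha =>
      (C.alive_boolean ν (C.boolean_input (.inl h) ha)).symm

/-- Gates that do not depend on a Boolean variable keep their status when it is toggled. -/
theorem alive_toggle (hH : C.Homogenized) (v : {g : G // C.type g = .bvar}) (g : G)
    (hg : ¬ C.Path v g) : C.Alive (C.toggle ν v) g ↔ C.Alive ν g := by
  induction g using C.wire_wellFounded.induction with
  | h g ih =>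
    have ih' : ∀ a, C.Wire a g → (C.Alive (C.toggle ν v) a ↔ C.Alive ν a) :=
      fun a ha => ih a ha fun hp => hg (hp.tail ha)
    have hex : (∃ a, C.Wire a g ∧ C.Alive (C.toggle ν v) a) ↔ ∃ a, C.Wire a g ∧ C.Alive ν a :=
      exists_congr fun a => and_congr_right fun ha => ih' a ha
    have hall : (∀ a, C.Wire a g → C.Alive (C.toggle ν v) a) ↔ ∀ a, C.Wire a g → C.Alive ν a :=
      forall_congr' fun a => imp_congr_right fun ha => ih' a ha
    cases h : C.type g with
    | svar => exact iff_of_true (C.alive_svar _ h) (C.alive_svar _ h)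
    | bvar =>
      rw [C.alive_bvar _ h, C.alive_bvar _ h, toggle, Function.update_of_ne]
      rintro rfl
      exact hg .refl
    | cup => rw [C.alive_any _ (.inl h), C.alive_any _ (.inl h), hex]
    | disj => rw [C.alive_any _ (.inr h), C.alive_any _ (.inr h), hex]
    | neg => rw [C.alive_neg _ h, C.alive_neg _ h, hex]
    | times => rw [C.alive_all _ hH (.inl h), C.alive_all _ hH (.inl h), hall]
    | box => rw [C.alive_all _ hH (.inr (.inl h)), C.alive_all _ hH (.inr (.inl h)), hall]
    | conj => rw [C.alive_all _ hH (.inr (.inr h)), C.alive_all _ hH (.inr (.inr h)), hall]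

end Captured

/-! ### The exits of a gate -/

section Exits

variable {G : Type} [Fintype G] [DecidableEq G] (C : HybridCircuit G) (inL : G → List G)

/-- The standing assumptions on the circuit, together with a choice of an order on the
inputs of each gate. -/
structure Admissible : Prop where
  homogenized : C.Homogenized
  upwards : C.UpwardsDeterministic
  ddnnf : C.IsDDNNF
  mem : ∀ g a, a ∈ inL g ↔ C.Wire a g
  nodup : ∀ g, (inL g).Nodup

open Classical in
/-- The exits of a gate: the variables and products, alive, from which the gate can be reached
by pure wires. They are listed in the order of a left to right traversal of the tree
of these pure paths. -/
noncomputable def exits (ν : C.Valuation) : G → List G :=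
  C.wire_wellFounded.fix fun g rec =>
    if ¬ C.Alive ν g then []
    else if C.type g = .svar ∨ C.type g = .times then [g]
    else (inL g).flatMap fun a => if w : C.Wire a g then rec a w else []

variable {C inL}

namespace Admissible

open Classical in
theorem exits_eq (hC : C.Admissible inL) (ν : C.Valuation) (g : G) :
    C.exits inL ν g =
      if ¬ C.Alive ν g then []
      else if C.type g = .svar ∨ C.type g = .times then [g]
      else (inL g).flatMap (C.exits inL ν) := by
  rw [exits, WellFounded.fix_eq]
  congr 2
  refine List.flatMap_congr fun a ha => ?_
  rw [dif_pos ((hC.mem g a).mp ha)]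

theorem exits_dead (hC : C.Admissible inL) {ν : C.Valuation} {g : G} (h : ¬ C.Alive ν g) :
    C.exits inL ν g = [] := by
  rw [hC.exits_eq, if_pos h]

theorem exits_self (hC : C.Admissible inL) {ν : C.Valuation} {g : G} (h : C.Alive ν g)
    (ht : C.type g = .svar ∨ C.type g = .times) : C.exits inL ν g = [g] := by
  rw [hC.exits_eq, if_neg (not_not.mpr h), if_pos ht]

theorem exits_join (hC : C.Admissible inL) {ν : C.Valuation} {g : G} (h : C.Alive ν g)
    (ht : ¬ (C.type g = .svar ∨ C.type g = .times)) :
    C.exits inL ν g = (inL g).flatMap (C.exits inL ν) := by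
  rw [hC.exits_eq, if_neg (not_not.mpr h), if_neg ht]

theorem join_boolean (hC : C.Admissible inL) (ν : C.Valuation) {g : G}
    (h : (C.type g).isBoolean = true) : (inL g).flatMap (C.exits inL ν) = [] := by
  induction g using C.wire_wellFounded.induction with
  | h g ih =>
    rw [List.flatMap_eq_nil_iff]
    intro a ha
    have hw := (hC.mem g a).mp ha
    have hb : (C.type a).isBoolean = true := by
      cases ht : C.type g with
      | bvar =>
        have := Finset.card_eq_zero.mp (C.fanIn_var g (.inr ht))
        have ha := C.mem_inputs.mpr hw
        rw [this] at ha
        simp at ha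
      | conj => exact C.boolean_input (.inl ht) hw
      | disj => exact C.boolean_input (.inr (.inl ht)) hw
      | neg => exact C.boolean_input (.inr (.inr ht)) hw
      | svar => rw [ht] at h; cases h
      | cup => rw [ht] at h; cases h
      | times => rw [ht] at h; cases h
      | box => rw [ht] at h; cases h
    by_cases hal : C.Alive ν a
    · rw [hC.exits_join hal, ih a hw hb]
      rintro (ht | ht) <;> rw [ht] at hb <;> cases hb
    · exact hC.exits_dead hal

theorem exits_boolean (hC : C.Admissible inL) (ν : C.Valuation) {g : G}
    (h : (C.type g).isBoolean = true) : C.exits inL ν g = [] := by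
  by_cases hal : C.Alive ν g
  · rw [hC.exits_join hal, hC.join_boolean ν h]
    rintro (ht | ht) <;> rw [ht] at h <;> cases h
  · exact hC.exits_dead hal

/-- A `box` gate passes on the exits of its set-valued input, as Boolean gates have no exits. -/
theorem inL_box (hC : C.Admissible inL) {g : G} (h : C.type g = .box) :
    ∃ a b, C.inputs g = {a, b} ∧ (C.type a).isBoolean = false ∧ (C.type b).isBoolean = true ∧
      ∀ ν, (inL g).flatMap (C.exits inL ν) = C.exits inL ν a := by
  obtain ⟨a, b, hi, ha, hb⟩ := C.inputs_box g h
  refine ⟨a, b, hi, ha, hb, fun ν => ?_⟩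
  have hab : a ≠ b := by
    rintro rfl
    rw [ha] at hb
    cases hb
  have hp : (inL g).Perm [a, b] := by
    refine (List.perm_ext_iff_of_nodup (hC.nodup g) (by simp [hab])).mpr fun c => ?_
    rw [hC.mem, ← C.mem_inputs, hi]
    simp
  rcases List.perm_pair.mp hp with h | h <;> simp [h, hC.exits_boolean ν hb]

/-- A gate captures the disjoint union of the sets captured by its exits; this is the union
part, see `exits_pairwise` for disjointness. -/
theorem mem_capturedBy_iff (hC : C.Admissible inL) (ν : C.Valuation) {g : G}
    (h : (C.type g).isBoolean = false) {A : Finset G} :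
    A ∈ C.capturedBy ν g ↔ ∃ e ∈ C.exits inL ν g, A ∈ C.capturedBy ν e := by
  induction g using C.wire_wellFounded.induction with
  | h g ih =>
    by_cases hal : C.Alive ν g
    · cases ht : C.type g with
      | svar => simp [hC.exits_self hal (.inl ht)]
      | times => simp [hC.exits_self hal (.inr ht)]
      | cup =>
        rw [hC.exits_join hal (by simp [ht]), C.mem_capturedBy_cup ν ht]
        simp only [List.mem_flatMap, hC.mem]
        constructor
        · rintro ⟨a, ha, hA⟩
          have hb := C.inputs_set g (.inl ht) a (C.mem_inputs.mpr ha)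
          obtain ⟨e, he, hA⟩ := (ih a ha hb).mp hA
          exact ⟨e, ⟨a, ha, he⟩, hA⟩
        · rintro ⟨e, ⟨a, ha, he⟩, hA⟩
          have hb := C.inputs_set g (.inl ht) a (C.mem_inputs.mpr ha)
          exact ⟨a, ha, (ih a ha hb).mpr ⟨e, he, hA⟩⟩
      | box =>
        obtain ⟨a, b, hi, ha, hb, hj⟩ := hC.inL_box ht
        have hwa : C.Wire a g := C.mem_inputs.mp (by rw [hi]; simp)
        have hwb : C.Wire b g := C.mem_inputs.mp (by rw [hi]; simp)
        have hv : C.bval ν b = true := (C.alive_boolean ν hb).mp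
          ((C.alive_all ν hC.homogenized (.inr (.inl ht))).mp hal b hwb)
        rw [hC.exits_join hal (by simp [ht]), hj, C.mem_capturedBy_box ν ht hi ha hb,
          ih a hwa ha]
        simp [hv]
      | bvar => rw [ht] at h; cases h
      | conj => rw [ht] at h; cases h
      | disj => rw [ht] at h; cases h
      | neg => rw [ht] at h; cases h
    · rw [hC.exits_dead hal]
      simp only [List.not_mem_nil, false_and, exists_false, iff_false]
      exact fun hA => hal ⟨A, hA⟩

theorem exits_ne_nil (hC : C.Admissible inL) (ν : C.Valuation) {g : G}
    (h : (C.type g).isBoolean = false) : C.exits inL ν g ≠ [] ↔ C.Alive ν g := by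
  constructor
  · exact fun hn => by_contra fun hal => hn (hC.exits_dead hal)
  · rintro ⟨A, hA⟩ hn
    obtain ⟨e, he, _⟩ := (hC.mem_capturedBy_iff ν h).mp hA
    rw [hn] at he
    simp at he

theorem of_mem_exits (hC : C.Admissible inL) {ν : C.Valuation} {g e : G}
    (h : e ∈ C.exits inL ν g) :
    C.Alive ν e ∧ (C.type e = .svar ∨ C.type e = .times) := by
  induction g using C.wire_wellFounded.induction with
  | h g ih =>
    by_cases hal : C.Alive ν g
    · by_cases ht : C.type g = .svar ∨ C.type g = .times
      · rw [hC.exits_self hal ht, List.mem_singleton] at h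
        subst h
        exact ⟨hal, ht⟩
      · rw [hC.exits_join hal ht, List.mem_flatMap] at h
        obtain ⟨a, ha, he⟩ := h
        exact ih a ((hC.mem g a).mp ha) he
    · rw [hC.exits_dead hal] at h
      simp at h

theorem isBoolean_of_mem_exits (hC : C.Admissible inL) {ν : C.Valuation} {g e : G}
    (h : e ∈ C.exits inL ν g) : (C.type g).isBoolean = false := by
  by_contra hb
  rw [hC.exits_boolean ν (by simpa using hb)] at h
  simp at h

/-- Distinct exits of a gate capture disjoint sets, by determinism. -/
theorem exits_pairwise (hC : C.Admissible inL) (ν : C.Valuation) (g : G) :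
    (C.exits inL ν g).Pairwise
      (fun e e' => Disjoint (C.capturedBy ν e) (C.capturedBy ν e')) := by
  induction g using C.wire_wellFounded.induction with
  | h g ih =>
    by_cases hal : C.Alive ν g
    · cases ht : C.type g with
      | svar => simp [hC.exits_self hal (.inl ht)]
      | times => simp [hC.exits_self hal (.inr ht)]
      | box =>
        obtain ⟨a, b, hi, ha, hb, hj⟩ := hC.inL_box ht
        rw [hC.exits_join hal (by simp [ht]), hj]
        exact ih a (C.mem_inputs.mp (by rw [hi]; simp))
      | cup =>
        rw [hC.exits_join hal (by simp [ht]), List.pairwise_flatMap]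
        refine ⟨fun a ha => ih a ((hC.mem g a).mp ha), ?_⟩
        have key : ∀ a, C.Wire a g → (C.type a).isBoolean = false ∧
            a ∈ (C.eval ν).inputs g := fun a ha =>
          ⟨C.inputs_set g (.inl ht) a (C.mem_inputs.mpr ha), by
            rw [C.inputs_eval ν (by rw [ht]; rfl)]; exact C.mem_inputs.mpr ha⟩
        refine (hC.nodup g).imp_of_mem ?_
        intro a b ha hb hab e he e' he'
        obtain ⟨ha, ha'⟩ := key a ((hC.mem g a).mp ha)
        obtain ⟨hb, hb'⟩ := key b ((hC.mem g b).mp hb)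
        have hd := (hC.ddnnf ν).1 g (by rw [type_eval, evalType, ht]) a ha' b hb' hab
        exact Set.disjoint_of_subset
          (fun A hA => (hC.mem_capturedBy_iff ν ha).mpr ⟨e, he, hA⟩)
          (fun A hA => (hC.mem_capturedBy_iff ν hb).mpr ⟨e', he', hA⟩) hd
      | bvar => rw [hC.exits_boolean ν (by rw [ht]; rfl)]; exact .nil
      | conj => rw [hC.exits_boolean ν (by rw [ht]; rfl)]; exact .nil
      | disj => rw [hC.exits_boolean ν (by rw [ht]; rfl)]; exact .nil
      | neg => rw [hC.exits_boolean ν (by rw [ht]; rfl)]; exact .nil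
    · rw [hC.exits_dead hal]
      exact .nil

theorem exits_nodup (hC : C.Admissible inL) (ν : C.Valuation) (g : G) :
    (C.exits inL ν g).Nodup := by
  refine (hC.exits_pairwise ν g).imp_of_mem ?_
  rintro e e' he - hd rfl
  obtain ⟨A, hA⟩ := (hC.of_mem_exits he).1
  exact Set.disjoint_left.mp hd hA hA

/-- An exit has a path of pure wires to the gate. -/
theorem reflTransGen_of_mem_exits (hC : C.Admissible inL) {ν : C.Valuation} {g e : G}
    (h : e ∈ C.exits inL ν g) : Relation.ReflTransGen (C.eval ν).PureWire e g := by
  induction g using C.wire_wellFounded.induction with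
  | h g ih =>
    by_cases hal : C.Alive ν g
    · by_cases ht : C.type g = .svar ∨ C.type g = .times
      · rw [hC.exits_self hal ht, List.mem_singleton] at h
        subst h
        exact .refl
      · have hg := hC.isBoolean_of_mem_exits h
        rw [hC.exits_join hal ht, List.mem_flatMap] at h
        obtain ⟨a, ha, he⟩ := h
        have hw := (hC.mem g a).mp ha
        have ha' := hC.isBoolean_of_mem_exits he
        refine (ih a hw he).tail ⟨?_, ?_⟩
        · rw [C.inputs_eval ν hg]
          exact C.mem_inputs.mpr hw
        · cases hg' : C.type g with
          | cup => exact .inl (by rw [type_eval, evalType, hg'])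
          | box =>
            refine .inr ⟨by rw [type_eval, evalType, hg'], ?_⟩
            obtain ⟨a', b, hi, -, hb⟩ := C.inputs_box g hg'
            have hbm : b ∈ C.inputs g := by rw [hi]; simp
            refine ⟨b, by rw [C.inputs_eval ν hg]; exact hbm, ?_, ?_⟩
            · rintro rfl
              rw [ha'] at hb
              cases hb
            -- The Boolean input of a `box` gate that is alive is `true`: the wire is pure.
            · refine (C.mem_capturedBy_boolean ν hb).mpr ⟨(C.alive_boolean ν hb).mp ?_, rfl⟩
              exact (C.alive_all ν hC.homogenized (.inr (.inl hg'))).mp hal b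
                (C.mem_inputs.mp hbm)
          | svar => exact absurd (.inl hg') ht
          | times => exact absurd (.inr hg') ht
          | bvar => rw [hg'] at hg; cases hg
          | conj => rw [hg'] at hg; cases hg
          | disj => rw [hg'] at hg; cases hg
          | neg => rw [hg'] at hg; cases hg
    · rw [hC.exits_dead hal] at h
      simp at h

/-- Along a pure wire the exits of the origin are consecutive exits of the target. -/
theorem exits_infix (hC : C.Admissible inL) {ν : C.Valuation} {a g : G}
    (h : (C.eval ν).PureWire a g) : C.exits inL ν a <:+: C.exits inL ν g := by
  obtain ⟨hi, h⟩ := h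
  have hg : (C.type g).isBoolean = false := by
    by_contra hg
    have := (C.inputs_evalCircuit ν g).trans (if_pos (by simpa using hg))
    rw [show (C.eval ν).inputs g = ∅ from this] at hi
    simp at hi
  rw [C.inputs_eval ν hg] at hi
  have hw := C.mem_inputs.mp hi
  by_cases hal : C.Alive ν a
  · have hgt : C.Alive ν g ∧ ¬ (C.type g = .svar ∨ C.type g = .times) := by
      rcases h with h | ⟨h, c, hc, hca, he⟩
      · rw [type_eval, evalType] at h
        have ht : C.type g = .cup := by
          cases ht : C.type g <;> simp_all [HybridGate.isBoolean]
        exact ⟨(C.alive_any ν (.inl ht)).mpr ⟨a, hw, hal⟩, by simp [ht]⟩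
      · rw [C.inputs_eval ν hg] at hc
        -- Only Boolean gates capture the empty assignment, so that the target is a `box` gate.
        have hcb : (C.type c).isBoolean = true := by
          by_contra hcb
          exact hC.homogenized ν c (by simpa using hcb) he
        rw [type_eval, evalType] at h
        have ht : C.type g = .box := by
          cases ht : C.type g with
          | times =>
            have := C.inputs_set g (.inr ht) c hc
            rw [this] at hcb
            cases hcb
          | box => rfl
          | _ => simp_all [HybridGate.isBoolean]
        refine ⟨?_, by simp [ht]⟩
        refine (C.alive_all ν hC.homogenized (.inr (.inl ht))).mpr fun d hd => ?_
        obtain ⟨a', b, hi', ha', hb⟩ := C.inputs_box g ht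
        rw [← C.mem_inputs] at hd
        rw [hi'] at hi hc hd
        have hcb' : c = b := by
          rcases (by simpa using hc : c = a' ∨ c = b) with rfl | rfl
          · rw [ha'] at hcb; cases hcb
          · rfl
        subst hcb'
        have haa : a = a' := by
          rcases (by simpa using hi : a = a' ∨ a = c) with rfl | rfl
          · rfl
          · exact absurd rfl hca
        subst haa
        rcases (by simpa using hd : d = a ∨ d = c) with rfl | rfl
        · exact hal
        · exact ⟨∅, he⟩
    rw [hC.exits_join hgt.1 hgt.2]
    obtain ⟨s, t, hst⟩ := List.append_of_mem ((hC.mem g a).mpr hw)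
    rw [hst]
    exact ⟨s.flatMap (C.exits inL ν), t.flatMap (C.exits inL ν), by simp⟩
  · rw [hC.exits_dead hal]
    exact List.nil_infix

/-- The pairs of consecutive exits of the gates form a functional relation: the gates with a given
exit lie on one pure path, so that their lists of exits extend each other. -/
theorem consecutive_unique (hC : C.Admissible inL) {ν : C.Valuation} {g g' x y y' : G}
    (h : [x, y] <:+: C.exits inL ν g) (h' : [x, y'] <:+: C.exits inL ν g') : y = y' := by
  have mono : ∀ {a b}, Relation.ReflTransGen (C.eval ν).PureWire a b →
      C.exits inL ν a <:+: C.exits inL ν b := by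
    intro a b hab
    induction hab with
    | refl => exact List.infix_rfl
    | tail _ hw ih => exact ih.trans (hC.exits_infix hw)
  have aux : ∀ l : List G, l.Nodup → [x, y] <:+: l → [x, y'] <:+: l → y = y' := by
    rintro l hl ⟨s, t, hs⟩ ⟨s', t', hs'⟩
    have e : s.length = s'.length := by
      have h1 : l[s.length]? = some x := by simp [← hs]
      have h2 : l[s'.length]? = some x := by simp [← hs']
      obtain ⟨i1, _⟩ := List.getElem?_eq_some_iff.mp h1
      exact (List.getElem?_inj i1 hl).mp (h1.trans h2.symm)
    have h1 : l[s.length + 1]? = some y := by simp [← hs]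
    have h2 : l[s'.length + 1]? = some y' := by simp [← hs']
    rw [e, h2] at h1
    exact (Option.some_inj.mp h1).symm
  have hx : x ∈ C.exits inL ν g := h.subset (by simp)
  have hx' : x ∈ C.exits inL ν g' := h'.subset (by simp)
  rcases Relation.ReflTransGen.total_of_right_unique
      (fun a b c hb hc => hC.upwards ν a b c hb hc)
      (hC.reflTransGen_of_mem_exits hx) (hC.reflTransGen_of_mem_exits hx') with hg | hg
  · exact aux _ (hC.exits_nodup ν g') (h.trans (mono hg)) h'
  · exact aux _ (hC.exits_nodup ν g) h (h'.trans (mono hg))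

/-- Consecutive elements in the concatenation of the exits of the inputs are
consecutive exits of some gate. -/
theorem consecutive_join (hC : C.Admissible inL) {ν : C.Valuation} {g x y : G}
    (ht : C.type g ≠ .times) (h : [x, y] <:+: (inL g).flatMap (C.exits inL ν)) :
    ∃ g', [x, y] <:+: C.exits inL ν g' := by
  have ne : (inL g).flatMap (C.exits inL ν) ≠ [] := by
    intro h'
    rw [h'] at h
    simp at h
  have hsv : C.type g ≠ .svar := by
    intro ht
    have hnil : inL g = [] := by
      rw [List.eq_nil_iff_forall_not_mem]
      intro a ha
      have := Finset.card_eq_zero.mp (C.fanIn_var g (.inl ht))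
      have ha := C.mem_inputs.mpr ((hC.mem g a).mp ha)
      rw [this] at ha
      simp at ha
    simp [hnil] at ne
  by_cases hal : C.Alive ν g
  · exact ⟨g, by rw [hC.exits_join hal (by simp [ht, hsv])]; exact h⟩
  · by_cases hbox : C.type g = .box
    · obtain ⟨a, b, -, -, -, hj⟩ := hC.inL_box hbox
      exact ⟨a, by rw [← hj]; exact h⟩
    · by_cases hcup : C.type g = .cup
      · exfalso
        rw [C.alive_any ν (.inl hcup)] at hal
        refine ne (List.flatMap_eq_nil_iff.mpr fun a ha => hC.exits_dead fun hal' => ?_)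
        exact hal ⟨a, (hC.mem g a).mp ha, hal'⟩
      · refine absurd (hC.join_boolean ν ?_) ne
        cases ht' : C.type g <;> simp_all [HybridGate.isBoolean]

theorem exits_toggle (hC : C.Admissible inL) (ν : C.Valuation)
    (v : {g : G // C.type g = .bvar}) (g : G) (hg : ¬ C.Path v g) :
    C.exits inL (C.toggle ν v) g = C.exits inL ν g := by
  induction g using C.wire_wellFounded.induction with
  | h g ih =>
    rw [hC.exits_eq, hC.exits_eq, C.alive_toggle ν hC.homogenized v g hg]
    congr 2
    refine List.flatMap_congr fun a ha => ?_
    have hw := (hC.mem g a).mp ha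
    exact ih a hw fun hp => hg (hp.tail hw)

end Admissible
end Exits
end HybridCircuit

/-! ### Derivations -/

namespace HybridCircuit

section Words

variable {G : Type} [Fintype G] [DecidableEq G] (C : HybridCircuit G) (inL : G → List G)

/-- The gates that remain to be expanded after an exit: the two inputs of a product, and nothing
for a variable. -/
def children (e : G) : List G := if C.type e = .times then inL e else []

open Classical in
/-- The number of gates that have a path to a gate. -/
noncomputable def rank (g : G) : ℕ := (Finset.univ.filter fun a => C.Path a g).card

theorem rank_lt {a g : G} (h : C.Wire a g) : C.rank a < C.rank g := by
  classical
  refine Finset.card_lt_card ⟨fun x hx => ?_, fun hs => ?_⟩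
  · rw [Finset.mem_filter] at hx ⊢
    exact ⟨hx.1, hx.2.tail h⟩
  · have : g ∈ Finset.univ.filter fun x => C.Path x g := by
      rw [Finset.mem_filter]
      exact ⟨Finset.mem_univ _, .refl⟩
    have hga := (Finset.mem_filter.mp (hs this)).2
    exact C.acyclic g (Relation.TransGen.tail' hga h)

theorem rank_le {a g : G} (h : C.Path a g) : C.rank a ≤ C.rank g := by
  induction h with
  | refl => exact le_rfl
  | tail _ hw ih => exact ih.trans (C.rank_lt hw).le

/-- A measure on lists of gates that decreases when the first gate is replaced by the inputs of
one of its exits. -/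
noncomputable def weight (st : List G) : ℕ := (st.map fun g => 3 ^ C.rank g).sum

open Classical in
/-- The derivations from a stack of gates: the first gate is replaced by one of its exits, which is
recorded, and the children of the exit are put on the stack, until the stack is
empty. They are listed in lexicographic order. -/
noncomputable def words (ν : C.Valuation) : List G → List (List G) :=
  (InvImage.wf C.weight Nat.lt_wfRel.wf).fix fun st rec =>
    match st, rec with
    | [], _ => [[]]
    | g :: st, rec => (C.exits inL ν g).flatMap fun e =>
        if w : C.weight (C.children inL e ++ st) < C.weight (g :: st) then
          (rec (C.children inL e ++ st) w).map (e :: ·)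
        else []

/-- The assignment produced by a derivation: the variables among its exits. -/
def vars (w : List G) : List G := w.filter fun e => C.type e = .svar

theorem vars_cons_svar {e : G} (h : C.type e = .svar) (w : List G) :
    C.vars (e :: w) = e :: C.vars w := by simp [vars, h]

theorem vars_cons_times {e : G} (h : C.type e = .times) (w : List G) :
    C.vars (e :: w) = C.vars w := by simp [vars, h]

/-- The assignments captured by a stack of gates, that is, by the product of its gates. -/
def stackCaptured (ν : C.Valuation) : List G → Set (Finset G)
  | [] => {∅}
  | g :: st => {A | ∃ A₁ ∈ C.capturedBy ν g, ∃ A₂ ∈ stackCaptured ν st, A₁ ∪ A₂ = A}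

/-- A stack of set-valued gates such that no variable has a path to two of them. -/
def Independent (ν : C.Valuation) (st : List G) : Prop :=
  (∀ g ∈ st, (C.type g).isBoolean = false) ∧
  st.Pairwise fun a b => ∀ x, C.type x = .svar →
    ¬ ((C.eval ν).Path x a ∧ (C.eval ν).Path x b)

variable {C inL}

theorem path_of_path_eval {ν : C.Valuation} {a b : G} (h : (C.eval ν).Path a b) : C.Path a b :=
  Relation.ReflTransGen.mono (fun _ _ hab => (Finset.mem_filter.mp hab).1) _ _ h

theorem path_eval_of_mem_exits (hC : C.Admissible inL) {ν : C.Valuation} {g e : G}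
    (h : e ∈ C.exits inL ν g) : (C.eval ν).Path e g :=
  Relation.ReflTransGen.mono
    (fun a b hab => by
      have := hab.1
      simpa [Circuit.inputs, Circuit.Wire] using this) _ _
    (hC.reflTransGen_of_mem_exits h)

namespace Admissible

theorem children_svar {e : G} (h : C.type e = .svar) : C.children inL e = [] := by
  simp [children, h]

theorem children_times (hC : C.Admissible inL) {e : G} (h : C.type e = .times) :
    ∃ a b, a ≠ b ∧ C.children inL e = [a, b] ∧ inL e = [a, b] ∧ C.inputs e = {a, b} := by
  have hi := hC.homogenized.inputs_times h
  have hs : C.inputs e = (inL e).toFinset := by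
    ext a
    rw [C.mem_inputs, List.mem_toFinset, hC.mem]
  have hl : (inL e).length = 2 := by
    rw [← List.toFinset_card_of_nodup (hC.nodup e), ← hs, hi]
  obtain ⟨a, b, hab⟩ := List.length_eq_two.mp hl
  have hn := hC.nodup e
  rw [hab] at hn hs
  refine ⟨a, b, by simpa using hn, by simp [children, h, hab], hab, by simpa using hs⟩

/-- The powers of `3` make room for the two inputs of a product. -/
theorem weight_lt (hC : C.Admissible inL) {ν : C.Valuation} {g e : G} {st : List G}
    (h : e ∈ C.exits inL ν g) : C.weight (C.children inL e ++ st) < C.weight (g :: st) := by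
  have hle : 3 ^ C.rank e ≤ 3 ^ C.rank g := Nat.pow_le_pow_right (by norm_num)
    (C.rank_le (path_of_path_eval (path_eval_of_mem_exits hC h)))
  rcases (hC.of_mem_exits h).2 with ht | ht
  · rw [children_svar ht]
    have : 0 < 3 ^ C.rank e := by positivity
    simp [weight]
  · obtain ⟨a, b, hab, hc, -, hi⟩ := hC.children_times ht
    have ha := C.rank_lt (C.mem_inputs.mp (by rw [hi]; simp : a ∈ C.inputs e))
    have hb := C.rank_lt (C.mem_inputs.mp (by rw [hi]; simp : b ∈ C.inputs e))
    have ha' : 3 ^ (C.rank a + 1) ≤ 3 ^ C.rank e := Nat.pow_le_pow_right (by norm_num) ha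
    have hb' : 3 ^ (C.rank b + 1) ≤ 3 ^ C.rank e := Nat.pow_le_pow_right (by norm_num) hb
    have : 0 < 3 ^ C.rank a := by positivity
    rw [hc]
    simp only [weight, List.cons_append, List.nil_append, List.map_cons, List.sum_cons]
    rw [pow_succ] at ha' hb'
    omega

theorem words_nil (ν : C.Valuation) : C.words inL ν [] = [[]] := by
  rw [words, WellFounded.fix_eq]

theorem words_cons (hC : C.Admissible inL) (ν : C.Valuation) (g : G) (st : List G) :
    C.words inL ν (g :: st) = (C.exits inL ν g).flatMap fun e =>
      (C.words inL ν (C.children inL e ++ st)).map (e :: ·) := by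
  rw [words, WellFounded.fix_eq]
  refine List.flatMap_congr fun e he => ?_
  rw [dif_pos (hC.weight_lt he)]

/-- Induction on stacks along derivations. -/
theorem stack_induction (hC : C.Admissible inL) (ν : C.Valuation) {P : List G → Prop}
    (nil : P [])
    (cons : ∀ g st, (∀ e ∈ C.exits inL ν g, P (C.children inL e ++ st)) → P (g :: st))
    (st : List G) : P st := by
  induction st using (InvImage.wf C.weight Nat.lt_wfRel.wf).induction with
  | h st ih =>
    cases st with
    | nil => exact nil
    | cons g st => exact cons g st fun e he => ih _ (hC.weight_lt he)

theorem stackCaptured_support {ν : C.Valuation} {st : List G} {A : Finset G}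
    (h : A ∈ C.stackCaptured ν st) :
    ∀ x ∈ A, C.type x = .svar ∧ ∃ g ∈ st, (C.eval ν).Path x g := by
  induction st generalizing A with
  | nil =>
    rw [stackCaptured, Set.mem_singleton_iff] at h
    simp [h]
  | cons g st ih =>
    obtain ⟨A₁, h₁, A₂, h₂, rfl⟩ := h
    intro x hx
    rcases Finset.mem_union.mp hx with hx | hx
    · have := SetCircuit.Captures.support _ h₁ x hx
      exact ⟨(C.type_eval_svar ν).mp this.1, g, by simp, this.2⟩
    · obtain ⟨ht, g', hg', hp⟩ := ih h₂ x hx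
      exact ⟨ht, g', by simp [hg'], hp⟩

/-- In an independent stack, the part of an assignment that is due to the first gate is
disjoint from the part that is due to the other gates. -/
theorem disjoint_of_independent {ν : C.Valuation} {g : G} {st : List G}
    (hi : C.Independent ν (g :: st)) {A B : Finset G}
    (hA : ∀ x ∈ A, C.type x = .svar ∧ (C.eval ν).Path x g) (hB : B ∈ C.stackCaptured ν st) :
    Disjoint A B := by
  rw [Finset.disjoint_left]
  intro x hx hx'
  obtain ⟨ht, g', hg', hp⟩ := stackCaptured_support hB x hx'
  exact (List.pairwise_cons.mp hi.2).1 g' hg' x ht ⟨(hA x hx).2, hp⟩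

theorem independent_step (hC : C.Admissible inL) {ν : C.Valuation} {g e : G} {st : List G}
    (h : e ∈ C.exits inL ν g) (hi : C.Independent ν (g :: st)) :
    C.Independent ν (C.children inL e ++ st) := by
  obtain ⟨hb, hp⟩ := hi
  obtain ⟨hg, hp⟩ := List.pairwise_cons.mp hp
  rcases (hC.of_mem_exits h).2 with ht | ht
  · rw [children_svar ht]
    exact ⟨fun g' hg' => hb g' (List.mem_cons_of_mem _ hg'), hp⟩
  · obtain ⟨a, b, hab, hc, -, hin⟩ := hC.children_times ht
    have hin' : (C.eval ν).inputs e = {a, b} := by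
      rw [C.inputs_eval ν (by rw [ht]; rfl), hin]
    have hte : (C.eval ν).type e = .times := by rw [type_eval, evalType, ht]
    have hw : ∀ c, c = a ∨ c = b → (C.eval ν).Path c g := by
      intro c hcab
      refine Relation.ReflTransGen.head ?_ (path_eval_of_mem_exits hC h)
      have : c ∈ (C.eval ν).inputs e := by rw [hin']; simpa using hcab
      simpa [Circuit.inputs, Circuit.Wire] using this
    have hbool : ∀ c, c = a ∨ c = b → (C.type c).isBoolean = false := fun c hcab =>
      C.inputs_set e (.inr ht) c (by rw [hin]; simpa using hcab)
    rw [hc]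
    refine ⟨?_, ?_⟩
    · intro c hc
      simp only [List.cons_append, List.nil_append, List.mem_cons] at hc
      rcases hc with rfl | rfl | hc
      · exact hbool _ (.inl rfl)
      · exact hbool _ (.inr rfl)
      · exact hb c (by simp [hc])
    · have hd := (hC.ddnnf ν).2 e hte a (by rw [hin']; simp) b (by rw [hin']; simp) hab
      refine List.pairwise_cons.mpr ⟨?_, List.pairwise_cons.mpr ⟨?_, hp⟩⟩
      · intro c hc x hx
        rcases List.mem_cons.mp hc with rfl | hc
        · exact hd x ((C.type_eval_svar ν).mpr hx)
        · exact fun h' => hg c hc x hx ⟨h'.1.trans (hw a (.inl rfl)), h'.2⟩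
      · exact fun c hc x hx h' => hg c hc x hx ⟨h'.1.trans (hw b (.inr rfl)), h'.2⟩

theorem stackCaptured_children (hC : C.Admissible inL) {ν : C.Valuation} {e : G}
    (ht : C.type e = .times) (st : List G) :
    C.stackCaptured ν (C.children inL e ++ st) = C.stackCaptured ν (e :: st) := by
  obtain ⟨a, b, hab, hc, -, hin⟩ := hC.children_times ht
  ext A
  simp only [hc, List.cons_append, List.nil_append, stackCaptured, Set.mem_ofPred_eq,
    C.mem_capturedBy_times ν ht hin hab]
  constructor
  · rintro ⟨A₁, h₁, _, ⟨A₂, h₂, A₃, h₃, rfl⟩, rfl⟩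
    exact ⟨A₁ ∪ A₂, ⟨A₁, h₁, A₂, h₂, rfl⟩, A₃, h₃, Finset.union_assoc _ _ _⟩
  · rintro ⟨_, ⟨A₁, h₁, A₂, h₂, rfl⟩, A₃, h₃, rfl⟩
    exact ⟨A₁, h₁, A₂ ∪ A₃, ⟨A₂, h₂, A₃, h₃, rfl⟩, (Finset.union_assoc _ _ _).symm⟩

theorem mem_words_cons (hC : C.Admissible inL) {ν : C.Valuation} {g : G} {st w : List G} :
    w ∈ C.words inL ν (g :: st) ↔
      ∃ e ∈ C.exits inL ν g, ∃ w' ∈ C.words inL ν (C.children inL e ++ st), e :: w' = w := by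
  rw [hC.words_cons]
  simp

/-- The derivations produce exactly the captured assignments. -/
theorem mem_stackCaptured_iff (hC : C.Admissible inL) (ν : C.Valuation) (st : List G) :
    (∀ g ∈ st, (C.type g).isBoolean = false) →
    ∀ A, A ∈ C.stackCaptured ν st ↔ ∃ w ∈ C.words inL ν st, (C.vars w).toFinset = A := by
  induction st using hC.stack_induction ν with
  | nil =>
    intro _ A
    simp [stackCaptured, words_nil, vars, eq_comm]
  | cons g st ih =>
    intro hb A
    have hg := hb g (by simp)
    have hst : ∀ e ∈ C.exits inL ν g, ∀ c ∈ C.children inL e ++ st,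
        (C.type c).isBoolean = false := by
      intro e he c hc
      rcases List.mem_append.mp hc with hc | hc
      · rcases (hC.of_mem_exits he).2 with ht | ht
        · simp [children_svar ht] at hc
        · rw [children, if_pos ht, hC.mem, ← C.mem_inputs] at hc
          exact C.inputs_set e (.inr ht) c hc
      · exact hb c (by simp [hc])
    have step : ∀ e ∈ C.exits inL ν g, (∃ A₁ ∈ C.capturedBy ν e,
        ∃ A₂ ∈ C.stackCaptured ν st, A₁ ∪ A₂ = A) ↔
        ∃ w' ∈ C.words inL ν (C.children inL e ++ st), (C.vars (e :: w')).toFinset = A := by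
      intro e he
      have ih := ih e he (hst e he)
      rcases (hC.of_mem_exits he).2 with ht | ht
      · simp only [C.mem_capturedBy_svar ν ht, exists_eq_left]
        rw [children_svar ht] at ih ⊢
        constructor
        · rintro ⟨A₂, h₂, rfl⟩
          obtain ⟨w, hw, rfl⟩ := (ih A₂).mp h₂
          exact ⟨w, hw, by
            rw [C.vars_cons_svar ht, List.toFinset_cons, Finset.insert_eq]⟩
        · rintro ⟨w, hw, rfl⟩
          exact ⟨_, (ih _).mpr ⟨w, hw, rfl⟩, by
            rw [C.vars_cons_svar ht, List.toFinset_cons, Finset.insert_eq]⟩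
      · simp only [C.vars_cons_times ht]
        rw [← ih A, hC.stackCaptured_children ht]
        rfl
    constructor
    · rintro ⟨A₁, h₁, A₂, h₂, hA⟩
      obtain ⟨e, he, h₁⟩ := (hC.mem_capturedBy_iff ν hg).mp h₁
      obtain ⟨w, hw, hwA⟩ := (step e he).mp ⟨A₁, h₁, A₂, h₂, hA⟩
      exact ⟨e :: w, hC.mem_words_cons.mpr ⟨e, he, w, hw, rfl⟩, hwA⟩
    · rintro ⟨_, hw', hwA⟩
      obtain ⟨e, he, w, hw, rfl⟩ := hC.mem_words_cons.mp hw'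
      obtain ⟨A₁, h₁, A₂, h₂, hA⟩ := (step e he).mpr ⟨w, hw, hwA⟩
      exact ⟨A₁, (hC.mem_capturedBy_iff ν hg).mpr ⟨e, he, h₁⟩, A₂, h₂, hA⟩

/-- A derivation is a binary forest, with variables as leaves and products as inner nodes. -/
theorem length_add_length (hC : C.Admissible inL) (ν : C.Valuation) (st : List G) :
    ∀ w ∈ C.words inL ν st, w.length + st.length = 2 * (C.vars w).length := by
  induction st using hC.stack_induction ν with
  | nil => simp [words_nil, vars]
  | cons g st ih =>
    intro _ hw'
    obtain ⟨e, he, w, hw, rfl⟩ := hC.mem_words_cons.mp hw'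
    have ih := ih e he w hw
    rcases (hC.of_mem_exits he).2 with ht | ht
    · rw [children_svar ht] at ih
      simp only [List.nil_append] at ih
      rw [C.vars_cons_svar ht]
      simp only [List.length_cons]
      omega
    · obtain ⟨a, b, -, hc, -, -⟩ := hC.children_times ht
      rw [hc] at ih
      rw [C.vars_cons_times ht]
      simp only [List.cons_append, List.nil_append, List.length_cons] at ih ⊢
      omega

theorem notMem_vars (hC : C.Admissible inL) {ν : C.Valuation} {g e : G} {st w : List G}
    (hi : C.Independent ν (g :: st)) (he : e ∈ C.exits inL ν g) (ht : C.type e = .svar)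
    (hw : w ∈ C.words inL ν st) : e ∉ C.vars w := by
  have hA := (hC.mem_stackCaptured_iff ν st (fun c hc => hi.1 c (by simp [hc])) _).mpr
    ⟨w, hw, rfl⟩
  have hd := disjoint_of_independent (A := {e}) hi (by
    intro x hx
    rw [Finset.mem_singleton] at hx
    subst hx
    exact ⟨ht, path_eval_of_mem_exits hC he⟩) hA
  simpa using hd

theorem vars_nodup (hC : C.Admissible inL) (ν : C.Valuation) (st : List G) :
    C.Independent ν st → ∀ w ∈ C.words inL ν st, (C.vars w).Nodup := by
  induction st using hC.stack_induction ν with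
  | nil => simp [words_nil, vars]
  | cons g st ih =>
    intro hi _ hw'
    obtain ⟨e, he, w, hw, rfl⟩ := hC.mem_words_cons.mp hw'
    have ih := ih e he (hC.independent_step he hi) w hw
    rcases (hC.of_mem_exits he).2 with ht | ht
    · rw [children_svar ht, List.nil_append] at hw
      rw [C.vars_cons_svar ht]
      exact List.nodup_cons.mpr ⟨hC.notMem_vars hi he ht hw, ih⟩
    · rwa [C.vars_cons_times ht]

/-- Distinct derivations produce distinct assignments. -/
theorem map_vars_nodup (hC : C.Admissible inL) (ν : C.Valuation) (st : List G) :
    C.Independent ν st → ((C.words inL ν st).map fun w => (C.vars w).toFinset).Nodup := by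
  induction st using hC.stack_induction ν with
  | nil => simp [words_nil]
  | cons g st ih =>
    intro hi
    rw [hC.words_cons, List.map_flatMap, List.nodup_flatMap]
    refine ⟨fun e he => ?_, ?_⟩
    · have ih := ih e he (hC.independent_step he hi)
      rw [List.map_map]
      rcases (hC.of_mem_exits he).2 with ht | ht
      · rw [children_svar ht, List.nil_append] at ih ⊢
        rw [List.Nodup, List.pairwise_map] at ih ⊢
        refine ih.imp_of_mem fun {w w'} hw hw' hne heq => hne ?_
        have h1 : ∀ w, (C.vars (e :: w)).toFinset = insert e (C.vars w).toFinset := fun w => by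
          rw [C.vars_cons_svar ht, List.toFinset_cons]
        simp only [Function.comp_apply, h1] at heq
        have hn := hC.notMem_vars hi he ht hw
        have hn' := hC.notMem_vars hi he ht hw'
        rw [← Finset.erase_insert (a := e) (s := (C.vars w).toFinset) (by simpa using hn), heq,
          Finset.erase_insert (by simpa using hn')]
      · have : ((fun w => (C.vars w).toFinset) ∘ fun w => e :: w) =
            fun w => (C.vars w).toFinset := by
          funext w
          rw [Function.comp_apply, C.vars_cons_times ht]
        rw [this]
        exact ih
    · refine (hC.exits_pairwise ν g).imp_of_mem ?_
      intro e e' he he' hd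
      have key : ∀ e ∈ C.exits inL ν g, ∀ A ∈ List.map (fun w => (C.vars w).toFinset)
          ((C.words inL ν (C.children inL e ++ st)).map (e :: ·)),
          ∃ A₁ ∈ C.capturedBy ν e, ∃ A₂ ∈ C.stackCaptured ν st, A₁ ∪ A₂ = A ∧
            ∀ x ∈ A₁, C.type x = .svar ∧ (C.eval ν).Path x g := by
        intro e he A hA
        simp only [List.map_map, List.mem_map, Function.comp_apply] at hA
        obtain ⟨w, hw, rfl⟩ := hA
        have hsup : ∀ A₁ ∈ C.capturedBy ν e, ∀ x ∈ A₁,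
            C.type x = .svar ∧ (C.eval ν).Path x g := by
          intro A₁ h₁ x hx
          have := SetCircuit.Captures.support _ h₁ x hx
          exact ⟨(C.type_eval_svar ν).mp this.1, this.2.trans (path_eval_of_mem_exits hC he)⟩
        have hm := (hC.mem_stackCaptured_iff ν _ (hC.independent_step he hi).1 _).mpr
          ⟨w, hw, rfl⟩
        rcases (hC.of_mem_exits he).2 with ht | ht
        · rw [children_svar ht, List.nil_append] at hm
          have h1 := (C.mem_capturedBy_svar ν ht).mpr (rfl : ({e} : Finset G) = {e})
          refine ⟨{e}, h1, _, hm, ?_, hsup _ h1⟩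
          rw [C.vars_cons_svar ht, List.toFinset_cons, Finset.insert_eq]
        · rw [hC.stackCaptured_children ht] at hm
          obtain ⟨A₁, h₁, A₂, h₂, hA⟩ := hm
          refine ⟨A₁, h₁, A₂, h₂, ?_, hsup _ h₁⟩
          rw [hA, C.vars_cons_times ht]
      rw [Function.onFun, List.disjoint_left]
      intro A hA hA'
      obtain ⟨A₁, h₁, A₂, h₂, hu, hs⟩ := key e he A hA
      obtain ⟨B₁, k₁, B₂, k₂, hu', hs'⟩ := key e' he' A hA'
      -- Both are the set of the variables of `A` that have a path to `g`.
      have hAB : A₁ = B₁ := by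
        have sub : ∀ {A₁ A₂ B₁ B₂ : Finset G}, A₁ ∪ A₂ = A → B₁ ∪ B₂ = A →
            Disjoint A₁ B₂ → A₁ ⊆ B₁ := by
          intro A₁ A₂ B₁ B₂ h h' hdj x hx
          have : x ∈ B₁ ∪ B₂ := by rw [h', ← h]; exact Finset.mem_union_left _ hx
          exact (Finset.mem_union.mp this).resolve_right (Finset.disjoint_left.mp hdj hx)
        exact (sub hu hu' (disjoint_of_independent hi hs k₂)).antisymm
          (sub hu' hu (disjoint_of_independent hi hs' h₂))
      subst hAB
      exact Set.disjoint_left.mp hd h₁ k₁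

end Admissible
end Words
end HybridCircuit

/-! ### Exploring the dependent gates -/

/-- `Chained val nxt p l`: following the pointers `nxt` from `p` to the null pointer `0`
visits cells that hold the elements of `l`. The value of the cell with pointer `p` is
`val (p - 1)`. Pointers decrease, so that adding a cell at a larger address leaves
the lists that already exist alone. -/
def Chained {n : ℕ} (val nxt : ℕ → ℕ) : ℕ → List (Fin n) → Prop
  | p, [] => p = 0
  | p, x :: l => 0 < p ∧ nxt p < p ∧ val (p - 1) = x ∧ Chained val nxt (nxt p) l

/-- The first cells of the array `A` hold the elements of `q`. -/
def QueueIs {n : ℕ} (A : ℕ → ℕ) (q : List (Fin n)) : Prop :=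
  ∀ (i : ℕ) (h : i < q.length), A i = q[i]

theorem QueueIs.snoc {n : ℕ} {A : ℕ → ℕ} {q : List (Fin n)} (h : QueueIs A q) (x : Fin n) :
    QueueIs (Function.update A q.length x) (q ++ [x]) := by
  intro i hi
  rcases Nat.lt_or_ge i q.length with hlt | hge
  · rw [Function.update_of_ne hlt.ne, List.getElem_append_left hlt]
    exact h i hlt
  · have : i = q.length := by simp at hi; omega
    subst this
    simp

/-- Count at its target the wire with the pointer in register `5`, and append the target to
the queue if this is its first wire. The register `20` is never written, here and in all the other
programs: it provides the constant zero. -/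
def exploreWire : Program :=
  .instr (.move 6 5) ;; .instr (.pred 6) ;; .instr (.load 6 .index 4 6) ;;
  .instr (.load 7 .index 9 6) ;;
  .branch (.eq 7 20) (.instr (.store .index 10 3 6) ;; .instr (.succ 3)) .skip ;;
  .instr (.succ 7) ;; .instr (.store .index 9 6 7) ;;
  .instr (.load 5 .index 6 5)

/-- Count all the wires that leave a gate, the first of which has the pointer in
register `5`. -/
def exploreWires : Program :=
  .loop (.lt 20 5) exploreWire

theorem exploreWires_spec {n : ℕ} (l : List (Fin n)) (q : List (Fin n)) (σ : MachineState)
    (hz : σ.reg 20 = 0) (hl : Chained (σ.mem .index 4) (σ.mem .index 6) (σ.reg 5) l)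
    (hnd : l.Nodup) (hq : QueueIs (σ.mem .index 10) q) (hw : σ.reg 3 = q.length) :
    Halts exploreWires σ fun t σ' =>
      t ≤ 12 * l.length + 1 ∧
      QueueIs (σ'.mem .index 10) (q ++ l.filter (fun x : Fin n => σ.mem .index 9 x = 0)) ∧
      σ'.reg 3 = (q ++ l.filter (fun x : Fin n => σ.mem .index 9 x = 0)).length ∧
      (∀ x : Fin n, σ'.mem .index 9 x = σ.mem .index 9 x + if x ∈ l then 1 else 0) ∧
      (∀ b, b ≠ 9 → b ≠ 10 → σ'.mem .index b = σ.mem .index b) ∧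
      σ'.reg 1 = σ.reg 1 ∧ σ'.reg 2 = σ.reg 2 ∧ σ'.reg 20 = 0 := by
  induction l generalizing σ q with
  | nil =>
    refine Halts.loop_done ?_ ?_
    · simp only [Chained] at hl
      simp [hl, hz]
    · simp [hq, hw, hz]
  | cons x l ih =>
    obtain ⟨hp, hlt, hx, hl⟩ := hl
    obtain ⟨hxl, hnd⟩ := List.nodup_cons.mp hnd
    refine Halts.loop_step (by simpa [hz] using hp) ?_
    rw [← exploreWires]
    simp only [exploreWire, Halts.seq_iff, Halts.instr_iff, Halts.branch_iff, Halts.skip_iff]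
    have key : ∀ y : Fin n, (y : ℕ) = x ↔ y = x := fun y => Fin.ext_iff.symm
    have hf : ∀ v, l.filter (fun y : Fin n =>
        Function.update (σ.mem .index 9) (x : ℕ) v y = 0) =
        l.filter (fun y : Fin n => σ.mem .index 9 y = 0) := by
      intro v
      refine List.filter_congr fun y hy => ?_
      rw [Function.update_of_ne]
      rw [Ne, key]
      rintro rfl
      exact hxl hy
    simp only [Instr.exec_move, Instr.exec_pred, Instr.exec_load, Instr.exec_store,
      Instr.exec_succ]
    constructor
    · intro h0
      simp [hz, hx] at h0
      refine (ih (q ++ [x]) _ (by simp [hz]) ?_ hnd ?_ ?_).mono ?_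
      · simpa [hz, hx] using hl
      · simpa [hz, hx, hw] using hq.snoc x
      · simp [hx, hw]
      · simp [hx, hf, h0]
        intro t σ' ht h1 h2 h3 h4 h5 h6 h7
        refine ⟨by omega, h1, by omega, fun y => ?_, fun b hb hb' => ?_, h5, h6, h7⟩
        · rw [h3 y, Function.update_apply]
          by_cases hy : y = x
          · subst hy; simp [hxl, h0]
          · simp [key, hy]
        · rw [h4 b hb hb']
          simp [hb, hb']
    · intro h0
      simp [hz, hx] at h0
      refine (ih q _ (by simp [hz]) ?_ hnd ?_ ?_).mono ?_
      · simpa [hz, hx] using hl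
      · simpa [hz, hx, hw] using hq
      · simp [hx, hw]
      · simp [hx, hf, h0]
        intro t σ' ht h1 h2 h3 h4 h5 h6 h7
        refine ⟨by omega, h1, by omega, fun y => ?_, fun b hb hb' => ?_, h5, h6, h7⟩
        · rw [h3 y, Function.update_apply]
          by_cases hy : y = x
          · subst hy; simp [hxl]
          · simp [key, hy]
        · rw [h4 b hb hb']
          simp [hb]

theorem QueueIs.prefix {n : ℕ} {A : ℕ → ℕ} {q q' : List (Fin n)} (h : QueueIs A q')
    (hp : q <+: q') : QueueIs A q := by
  intro i hi
  rw [h i (hi.trans_le hp.length_le), hp.getElem hi]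

/-- The exploration. Register `1` holds the number of gates in the queue initially (array `10`),
registers `2` and `3` the beginning and the end of the part of the queue that still has
to be treated. Afterwards the queue holds all the gates that depend on the initial
ones, and the array `9` holds the number of inputs of each gate among these gates. -/
def explore : Program :=
  .instr (.const 2 0) ;; .instr (.move 3 1) ;;
  .loop (.lt 2 3)
    (.instr (.load 4 .index 10 2) ;; .instr (.succ 2) ;; .instr (.load 5 .index 5 4) ;;
     exploreWires)

/-- The queue consists of the gates `done`, whose outgoing wires have been counted, followed by the
gates `todo`. The bound `k` on the number of remaining rounds exists as the queue
contains no gate twice. -/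
theorem exploreLoop_spec {n : ℕ} (outL : Fin n → List (Fin n)) (S : List (Fin n))
    (D : Finset (Fin n)) (hnd : ∀ g, (outL g).Nodup) (hD : ∀ h ∈ D, ∀ x ∈ outL h, x ∈ D)
    (hsrc : ∀ h ∈ D, ∀ x ∈ outL h, x ∉ S) (k : ℕ) (done todo : List (Fin n))
    (hk : D.card ≤ done.length + k) (σ : MachineState)
    (hz : σ.reg 20 = 0)
    (hout : ∀ g : Fin n,
      Chained (σ.mem .index 4) (σ.mem .index 6) (σ.mem .index 5 g) (outL g))
    (hq : QueueIs (σ.mem .index 10) (done ++ todo)) (h2 : σ.reg 2 = done.length)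
    (h3 : σ.reg 3 = (done ++ todo).length) (hqn : (done ++ todo).Nodup)
    (hqD : ∀ x ∈ done ++ todo, x ∈ D)
    (hmem : ∀ x, x ∈ done ++ todo ↔ x ∈ S ∨ 0 < done.countP (x ∈ outL ·))
    (h9 : ∀ x : Fin n, σ.mem .index 9 x = done.countP (x ∈ outL ·)) :
    Halts (.loop (.lt 2 3)
      (.instr (.load 4 .index 10 2) ;; .instr (.succ 2) ;; .instr (.load 5 .index 5 4) ;;
        exploreWires)) σ fun t σ' => ∃ rest,
      todo <+: rest ∧ (done ++ rest).Nodup ∧ (∀ x ∈ done ++ rest, x ∈ D) ∧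
      (∀ x, x ∈ done ++ rest ↔ x ∈ S ∨ 0 < (done ++ rest).countP (x ∈ outL ·)) ∧
      (∀ x : Fin n, σ'.mem .index 9 x = (done ++ rest).countP (x ∈ outL ·)) ∧
      QueueIs (σ'.mem .index 10) (done ++ rest) ∧
      (∀ b, b ≠ 9 → b ≠ 10 → σ'.mem .index b = σ.mem .index b) ∧
      σ'.reg 1 = σ.reg 1 ∧ σ'.reg 20 = 0 ∧
      t ≤ (rest.map fun h => 12 * (outL h).length + 6).sum + 1 := by
  induction k generalizing done todo σ with
  | zero =>
    have hlen : (done ++ todo).length ≤ D.card := by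
      rw [← List.toFinset_card_of_nodup hqn]
      exact Finset.card_le_card fun x hx => hqD x (by simpa using hx)
    have : todo = [] := by
      rw [List.length_append] at hlen
      exact List.length_eq_zero_iff.mp (by omega)
    subst this
    exact Halts.loop_done (by simp [h2, h3])
      ⟨[], List.prefix_rfl, hqn, hqD, by simpa using hmem, by simpa using h9, hq,
        fun _ _ _ => rfl, rfl, hz, by simp⟩
  | succ k ih =>
    cases todo with
    | nil =>
      exact Halts.loop_done (by simp [h2, h3])
        ⟨[], List.prefix_rfl, hqn, hqD, by simpa using hmem, by simpa using h9, hq,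
          fun _ _ _ => rfl, rfl, hz, by simp⟩
    | cons h todo =>
      have hh : σ.mem .index 10 done.length = (h : ℕ) := by
        rw [hq done.length (by simp)]
        simp
      have hhD : h ∈ D := hqD h (by simp)
      refine Halts.loop_step (by simp [h2, h3]) ?_
      simp only [Halts.seq_iff, Halts.instr_iff, Instr.exec_load, Instr.exec_succ]
      refine (exploreWires_spec (outL h) (done ++ h :: todo) _ (by simp [hz]) ?_ (hnd h)
        ?_ ?_).mono ?_
      · simpa [h2, hh] using hout h
      · simpa using hq
      · simpa using h3
      intro t σ₁
      simp only [MachineState.setReg_mem, MachineState.touch_mem, MachineState.setReg_reg,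
        MachineState.touch_reg, h9]
      rintro ⟨ht, hq₁, h3₁, h9₁, hf₁, h1₁, h2₁, h20₁⟩
      set new := (outL h).filter fun x => decide (done.countP (x ∈ outL ·) = 0) with hnew
      have hnewm : ∀ x, x ∈ new ↔ x ∈ outL h ∧ done.countP (x ∈ outL ·) = 0 := by
        intro x
        rw [hnew, List.mem_filter, decide_eq_true_iff]
      have happ : done ++ h :: todo ++ new = (done ++ [h]) ++ (todo ++ new) := by simp
      have hcnt : ∀ x, (done ++ [h]).countP (x ∈ outL ·) =
          done.countP (x ∈ outL ·) + if x ∈ outL h then 1 else 0 := by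
        intro x
        simp [List.countP_append, List.countP_cons]
      rw [happ] at hq₁ h3₁
      refine (ih (done ++ [h]) (todo ++ new) (by simp; omega) σ₁ h20₁ ?_ hq₁ ?_ h3₁ ?_ ?_ ?_
        ?_).mono ?_
      · intro g
        rw [hf₁ 4 (by simp) (by simp), hf₁ 5 (by simp) (by simp), hf₁ 6 (by simp) (by simp)]
        exact hout g
      · simp [h2₁, h2]
      · rw [← happ, List.nodup_append]
        refine ⟨hqn, (hnd h).filter _, ?_⟩
        rintro x hx y hy rfl
        obtain ⟨hy, hy0⟩ := (hnewm x).mp hy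
        rcases (hmem x).mp hx with hs | hc
        · exact hsrc h hhD x hy hs
        · omega
      · rw [← happ]
        intro x hx
        rcases List.mem_append.mp hx with hx | hx
        · exact hqD x hx
        · exact hD h hhD x ((hnewm x).mp hx).1
      · intro x
        rw [← happ, List.mem_append, hmem, hnewm, hcnt]
        by_cases hx : x ∈ outL h
        · rcases Nat.eq_zero_or_pos (done.countP (x ∈ outL ·)) with h0 | h0
          · exact iff_of_true (.inr ⟨hx, h0⟩) (.inr (by simp [hx]))
          · exact iff_of_true (.inl (.inr h0)) (.inr (by simp [hx]))
        · simp only [hx, false_and, or_false, if_false, Nat.add_zero]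
      · intro x
        rw [h9₁, hcnt]
      · rintro t' σ₂ ⟨rest, hp, hn, hrD, hrm, h9₂, hq₂, hf₂, h1₂, h20₂, ht₂⟩
        have e : done ++ [h] ++ rest = done ++ h :: rest := by simp
        rw [e] at hn hrD hrm h9₂ hq₂
        refine ⟨h :: rest, ?_, hn, hrD, hrm, h9₂, hq₂, fun b hb hb' => ?_, ?_, h20₂, ?_⟩
        · exact List.cons_prefix_cons.mpr ⟨rfl, (List.prefix_append _ _).trans hp⟩
        · rw [hf₂ b hb hb', hf₁ b hb hb']
        · rw [h1₂, h1₁]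
          simp
        · simp only [List.map_cons, List.sum_cons]
          omega

theorem explore_spec {n : ℕ} (outL : Fin n → List (Fin n)) (S : List (Fin n))
    (D : Finset (Fin n)) (hnd : ∀ g, (outL g).Nodup) (hD : ∀ h ∈ D, ∀ x ∈ outL h, x ∈ D)
    (hsrc : ∀ h ∈ D, ∀ x ∈ outL h, x ∉ S) (hS : S.Nodup) (hSD : ∀ s ∈ S, s ∈ D)
    (σ : MachineState) (hz : σ.reg 20 = 0)
    (hout : ∀ g : Fin n,
      Chained (σ.mem .index 4) (σ.mem .index 6) (σ.mem .index 5 g) (outL g))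
    (hq : QueueIs (σ.mem .index 10) S) (h1 : σ.reg 1 = S.length)
    (h9 : ∀ x : Fin n, σ.mem .index 9 x = 0) :
    Halts explore σ fun t σ' => ∃ dl,
      S <+: dl ∧ dl.Nodup ∧ (∀ x ∈ dl, x ∈ D) ∧
      (∀ x, x ∈ dl ↔ x ∈ S ∨ 0 < dl.countP (x ∈ outL ·)) ∧
      (∀ x : Fin n, σ'.mem .index 9 x = dl.countP (x ∈ outL ·)) ∧
      QueueIs (σ'.mem .index 10) dl ∧
      (∀ b, b ≠ 9 → b ≠ 10 → σ'.mem .index b = σ.mem .index b) ∧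
      σ'.reg 1 = σ.reg 1 ∧ σ'.reg 20 = 0 ∧
      t ≤ (dl.map fun h => 12 * (outL h).length + 6).sum + 3 := by
  simp only [explore, Halts.seq_iff, Halts.instr_iff, Instr.exec_const, Instr.exec_move]
  refine (exploreLoop_spec outL S D hnd hD hsrc D.card [] S (by simp) _ (by simp [hz])
    (by simpa using hout) (by simpa using hq) (by simp) (by simp [h1]) (by simpa using hS)
    (by simpa using hSD) (by simp) (by simpa using h9)).mono ?_
  rintro t σ' ⟨rest, hp, hn, hrD, hrm, h9', hq', hf, h1', h20, ht⟩
  rw [List.nil_append] at hn hrD hrm h9' hq'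
  exact ⟨rest, hp, hn, hrD, hrm, h9', hq', fun b hb hb' => by rw [hf b hb hb']; simp,
    by rw [h1']; simp, h20, by omega⟩

/-! ### Recomputing the index at a gate -/

/-- The number `v` is a bit that tells whether `p` holds. -/
def IsBit (v : ℕ) (p : Prop) : Prop := (p → v = 1) ∧ (¬ p → v = 0)

theorem IsBit.congr {v : ℕ} {p q : Prop} (h : IsBit v p) (hpq : p ↔ q) : IsBit v q :=
  ⟨fun hq => h.1 (hpq.mpr hq), fun hq => h.2 fun hp => hq (hpq.mp hp)⟩

theorem IsBit.eq_zero_iff {v : ℕ} {p : Prop} (h : IsBit v p) : v = 0 ↔ ¬ p := by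
  by_cases hp : p
  · simp [h.1 hp, hp]
  · simp [h.2 hp, hp]

/-- The pointer to a gate is its number plus one; the null pointer is `0`. This is the pointer to
the first element of a list. -/
def headPtr {n : ℕ} (l : List (Fin n)) : ℕ := l.head?.elim 0 fun x => x + 1

/-- The pointer to the last element of a list. -/
def lastPtr {n : ℕ} (l : List (Fin n)) : ℕ := l.getLast?.elim 0 fun x => x + 1

theorem headPtr_eq_zero {n : ℕ} {l : List (Fin n)} : headPtr l = 0 ↔ l = [] := by
  cases l <;> simp [headPtr]

theorem lastPtr_eq_zero {n : ℕ} {l : List (Fin n)} : lastPtr l = 0 ↔ l = [] := by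
  rcases List.eq_nil_or_concat l with rfl | ⟨l, x, rfl⟩ <;> simp [lastPtr]

theorem headPtr_append {n : ℕ} {l l' : List (Fin n)} (h : l ≠ []) :
    headPtr (l ++ l') = headPtr l := by
  cases l with
  | nil => exact absurd rfl h
  | cons x l => simp [headPtr]

theorem lastPtr_append {n : ℕ} {l l' : List (Fin n)} (h : l' ≠ []) :
    lastPtr (l ++ l') = lastPtr l' := by
  rcases List.eq_nil_or_concat l' with rfl | ⟨l', x, rfl⟩
  · exact absurd rfl h
  · simp [lastPtr]

/-- The array `A` maps each element of `l`, except the last one, to the next element. -/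
def Linked {n : ℕ} (A : ℕ → ℕ) (l : List (Fin n)) : Prop :=
  ∀ x y, [x, y] <:+: l → A (x + 1) = y + 1

/-- A pair of consecutive elements of a concatenation is a pair of one of the two lists, or it
goes from the last element of the first list to the first element of the second one. -/
theorem pair_infix_append {α : Type*} {l l' : List α} {x y : α} (h : [x, y] <:+: l ++ l') :
    [x, y] <:+: l ∨ [x, y] <:+: l' ∨ (l.getLast? = some x ∧ l'.head? = some y) := by
  rw [List.infix_append_iff] at h
  rcases h with h | h | ⟨t, s, hts, ht, hs⟩
  · exact .inl h
  · exact .inr (.inl h)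
  · rcases t with _ | ⟨a, _ | ⟨b, t⟩⟩
    · simp only [List.nil_append] at hts
      subst hts
      exact .inr (.inl hs.isInfix)
    · simp only [List.cons_append, List.nil_append, List.cons.injEq] at hts
      obtain ⟨rfl, rfl⟩ := hts
      obtain ⟨l₁, rfl⟩ := ht
      obtain ⟨l₂, rfl⟩ := hs
      exact .inr (.inr (by simp))
    · simp only [List.cons_append, List.cons.injEq, List.nil_eq, List.append_eq_nil_iff] at hts
      obtain ⟨rfl, rfl, rfl, rfl⟩ := hts
      exact .inl ht.isInfix

/-- The index holds the circuit, with the lists of the outputs and of the inputs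
of each gate. -/
structure HoldsCircuit {n : ℕ} (C : HybridCircuit (Fin n)) (inL outL : Fin n → List (Fin n))
    (m : Memory) : Prop where
  output : m .index 0 2 = C.output
  type : ∀ g : Fin n, m .index 1 g = (C.type g).code
  outs : ∀ g : Fin n, Chained (m .index 4) (m .index 6) (m .index 5 g) (outL g)
  ins : ∀ g : Fin n, Chained (m .index 3) (m .index 8) (m .index 7 g) (inL g)

theorem HoldsCircuit.congr {n : ℕ} {C : HybridCircuit (Fin n)} {inL outL : Fin n → List (Fin n)}
    {m m' : Memory} (h : HoldsCircuit C inL outL m)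
    (hm : ∀ b, b < 9 → b ≠ 2 → m' .index b = m .index b) : HoldsCircuit C inL outL m' := by
  constructor
  · rw [hm 0 (by simp) (by simp)]
    exact h.output
  · rw [hm 1 (by simp) (by simp)]
    exact h.type
  · rw [hm 4 (by simp) (by simp), hm 5 (by simp) (by simp), hm 6 (by simp) (by simp)]
    exact h.outs
  · rw [hm 3 (by simp) (by simp), hm 7 (by simp) (by simp), hm 8 (by simp) (by simp)]
    exact h.ins

/-- What the index must say about a gate: whether it is alive, and where its list of exits
begins and ends. The lists of exits of all gates share one array of links. -/
structure Correct {n : ℕ} (C : HybridCircuit (Fin n)) (inL : Fin n → List (Fin n))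
    (ν : C.Valuation) (m : Memory) (g : Fin n) : Prop where
  alive : IsBit (m .index 11 g) (C.Alive ν g)
  first : m .index 12 g = headPtr (C.exits inL ν g)
  last : m .index 13 g = lastPtr (C.exits inL ν g)
  linked : Linked (m .index 14) (C.exits inL ν g)

/-- Take into account the input given by the wire with the pointer in register `5`: clear
register `10` if it is not alive, and set register `9` otherwise. -/
def scanInput : Program :=
  .instr (.move 6 5) ;; .instr (.pred 6) ;; .instr (.load 6 .index 3 6) ;;
  .instr (.load 7 .index 11 6) ;;
  .branch (.eq 7 20) (.instr (.const 10 0)) (.instr (.const 9 1)) ;;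
  .instr (.load 5 .index 8 5)

/-- Determine whether some input (register `9`), and whether every input (register `10`)
of a gate is alive. -/
def scanInputs : Program := .loop (.lt 20 5) scanInput

theorem scanInputs_spec {n : ℕ} {P : Fin n → Prop} (l : List (Fin n)) (p q : Prop)
    (σ : MachineState) (hz : σ.reg 20 = 0)
    (hl : Chained (σ.mem .index 3) (σ.mem .index 8) (σ.reg 5) l)
    (hP : ∀ a ∈ l, IsBit (σ.mem .index 11 a) (P a))
    (h9 : IsBit (σ.reg 9) p) (h10 : IsBit (σ.reg 10) q) :
    Halts scanInputs σ fun t σ' =>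
      t ≤ 8 * l.length + 1 ∧ σ'.mem = σ.mem ∧
      IsBit (σ'.reg 9) (p ∨ ∃ a ∈ l, P a) ∧ IsBit (σ'.reg 10) (q ∧ ∀ a ∈ l, P a) ∧
      σ'.reg 1 = σ.reg 1 ∧ σ'.reg 2 = σ.reg 2 ∧ σ'.reg 3 = σ.reg 3 ∧ σ'.reg 4 = σ.reg 4 ∧
      σ'.reg 20 = 0 := by
  induction l generalizing σ p q with
  | nil =>
    refine Halts.loop_done ?_ ?_
    · simp only [Chained] at hl
      simp [hl, hz]
    · simp [hz, h9, h10]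
  | cons x l ih =>
    obtain ⟨hp, hlt, hx, hl⟩ := hl
    refine Halts.loop_step (by simpa [hz] using hp) ?_
    rw [← scanInputs]
    simp only [scanInput, Halts.seq_iff, Halts.instr_iff, Halts.branch_iff,
      Instr.exec_move, Instr.exec_pred, Instr.exec_load, Instr.exec_const]
    have hb := hP x (by simp)
    constructor
    · intro h0
      simp [hz, hx, hb.eq_zero_iff] at h0
      refine (ih p False _ (by simp [hz]) ?_ ?_ ?_ ?_).mono ?_
      · simpa [hz, hx] using hl
      · simpa using fun a ha => hP a (List.mem_cons_of_mem _ ha)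
      · simpa using h9
      · simp [IsBit]
      · simp [hx, h0]
        intro t σ' ht h1 h2 h3 h4 h5 h6 h7 h8
        exact ⟨by omega, h1, h2, h3, h4, h5, h6, h7, h8⟩
    · intro h0
      simp [hz, hx, hb.eq_zero_iff] at h0
      refine (ih True q _ (by simp [hz]) ?_ ?_ ?_ ?_).mono ?_
      · simpa [hz, hx] using hl
      · simpa using fun a ha => hP a (List.mem_cons_of_mem _ ha)
      · simp [IsBit]
      · simpa using h10
      · simp [hx, h0]
        intro t σ' ht h1 h2 h3 h4 h5 h6 h7 h8
        exact ⟨by omega, h1, h2, h3, h4, h5, h6, h7, h8⟩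

/-- Append to the list between the pointers in registers `11` and `12` the exits of the input given
by the wire with the pointer in register `5`. -/
def linkInput : Program :=
  .instr (.move 6 5) ;; .instr (.pred 6) ;; .instr (.load 6 .index 3 6) ;;
  .instr (.load 13 .index 12 6) ;;
  .branch (.eq 13 20) .skip
    (.branch (.eq 12 20) (.instr (.move 11 13)) (.instr (.store .index 14 12 13)) ;;
     .instr (.load 12 .index 13 6)) ;;
  .instr (.load 5 .index 8 5)

/-- Concatenate the lists of exits of the inputs of a gate; the registers `11` and `12` hold
the pointers to the first and to the last element. -/
def linkInputs : Program := .loop (.lt 20 5) linkInput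

/-- Concatenating the lists of exits of the inputs destroys no other list of exits, since by `huniq`
a link that is written never contradicts another list. -/
theorem linkInputs_spec {n : ℕ} {exits : Fin n → List (Fin n)}
    (huniq : ∀ {g g' x y y' : Fin n}, [x, y] <:+: exits g → [x, y'] <:+: exits g' → y = y')
    (l : List (Fin n)) (acc : List (Fin n)) (σ : MachineState) (hz : σ.reg 20 = 0)
    (hl : Chained (σ.mem .index 3) (σ.mem .index 8) (σ.reg 5) l)
    (hfirst : ∀ a ∈ l, σ.mem .index 12 a = headPtr (exits a))
    (hlast : ∀ a ∈ l, σ.mem .index 13 a = lastPtr (exits a))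
    (hlink : ∀ a ∈ l, Linked (σ.mem .index 14) (exits a))
    (hpair : ∀ x y, [x, y] <:+: acc ++ l.flatMap exits → ∃ g, [x, y] <:+: exits g)
    (h11 : σ.reg 11 = headPtr acc) (h12 : σ.reg 12 = lastPtr acc)
    (hacc : Linked (σ.mem .index 14) acc) :
    Halts linkInputs σ fun t σ' =>
      t ≤ 11 * l.length + 1 ∧
      (∀ b, b ≠ 14 → σ'.mem .index b = σ.mem .index b) ∧
      (∀ g, Linked (σ.mem .index 14) (exits g) → Linked (σ'.mem .index 14) (exits g)) ∧
      σ'.reg 11 = headPtr (acc ++ l.flatMap exits) ∧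
      σ'.reg 12 = lastPtr (acc ++ l.flatMap exits) ∧
      Linked (σ'.mem .index 14) (acc ++ l.flatMap exits) ∧
      σ'.reg 1 = σ.reg 1 ∧ σ'.reg 2 = σ.reg 2 ∧ σ'.reg 3 = σ.reg 3 ∧ σ'.reg 4 = σ.reg 4 ∧
      σ'.reg 20 = 0 ∧ σ'.reg 7 = σ.reg 7 ∧ σ'.reg 8 = σ.reg 8 := by
  induction l generalizing σ acc with
  | nil =>
    refine Halts.loop_done ?_ ?_
    · simp only [Chained] at hl
      simp [hl, hz]
    · simp [hz, h11, h12, hacc]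
  | cons x l ih =>
    obtain ⟨hp, hlt, hx, hl⟩ := hl
    refine Halts.loop_step (by simpa [hz] using hp) ?_
    rw [← linkInputs]
    simp only [linkInput, Halts.seq_iff, Halts.instr_iff, Halts.branch_iff, Halts.skip_iff,
      Instr.exec_move, Instr.exec_pred, Instr.exec_load, Instr.exec_store]
    have hf := hfirst x (by simp)
    have hla := hlast x (by simp)
    rw [List.flatMap_cons, ← List.append_assoc] at hpair
    have e : acc ++ (x :: l).flatMap exits = (acc ++ exits x) ++ l.flatMap exits := by simp
    rw [e]
    constructor
    · intro h0
      simp [hz, hx, hf, headPtr_eq_zero] at h0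
      simp only [h0, List.append_nil] at hpair ⊢
      refine (ih acc _ (by simp [hz]) ?_ ?_ ?_ ?_ hpair ?_ ?_ ?_).mono ?_
      · simpa [hz, hx] using hl
      · simpa using fun a ha => hfirst a (List.mem_cons_of_mem _ ha)
      · simpa using fun a ha => hlast a (List.mem_cons_of_mem _ ha)
      · simpa using fun a ha => hlink a (List.mem_cons_of_mem _ ha)
      · simpa using h11
      · simpa using h12
      · simpa using hacc
      · rintro t σ' ⟨ht, h1, h2⟩
        refine ⟨by simp only [List.length_cons]; omega, ?_⟩
        simpa using ⟨h1, h2⟩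
    · intro h0
      simp [hz, hx, hf, headPtr_eq_zero] at h0
      constructor
      · intro h1
        simp [hz, h12, lastPtr_eq_zero] at h1
        subst h1
        rw [List.nil_append] at hpair ⊢
        refine (ih (exits x) _ (by simp [hz]) ?_ ?_ ?_ ?_ hpair ?_ ?_ ?_).mono ?_
        · simpa [hz, hx] using hl
        · simpa using fun a ha => hfirst a (List.mem_cons_of_mem _ ha)
        · simpa using fun a ha => hlast a (List.mem_cons_of_mem _ ha)
        · simpa using fun a ha => hlink a (List.mem_cons_of_mem _ ha)
        · simp [hx, hf]
        · simp [hx, hla]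
        · simpa using hlink x (by simp)
        · rintro t σ' ⟨ht, h1, h2⟩
          refine ⟨by simp only [List.length_cons]; omega, ?_⟩
          simpa using ⟨h1, h2⟩
      · intro h1
        simp [hz, h12, lastPtr_eq_zero] at h1
        obtain ⟨u, hu⟩ := Option.ne_none_iff_exists'.mp
          (fun h => h1 (List.getLast?_eq_none_iff.mp h))
        obtain ⟨v, hv⟩ := Option.ne_none_iff_exists'.mp
          (fun h => h0 (List.head?_eq_none_iff.mp h))
        have hu' : lastPtr acc = u + 1 := by simp [lastPtr, hu]
        have hv' : headPtr (exits x) = v + 1 := by simp [headPtr, hv]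
        have huv : [u, v] <:+: acc ++ exits x := by
          obtain ⟨s, rfl⟩ := List.getLast?_eq_some_iff.mp hu
          obtain ⟨s', hs'⟩ := List.head?_eq_some_iff.mp hv
          rw [hs']
          exact ⟨s, s', by simp⟩
        obtain ⟨g₀, hg₀⟩ := hpair u v (huv.trans (List.prefix_append _ _).isInfix)
        -- The new link agrees with every list of exits, as these agree with each other.
        have keep : ∀ l' : List (Fin n), (∀ a b, [a, b] <:+: l' → ∃ g, [a, b] <:+: exits g) →
            Linked (σ.mem .index 14) l' →
            Linked (Function.update (σ.mem .index 14) ((u : ℕ) + 1) (v + 1)) l' := by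
          intro l' hl' hlk a b hab
          by_cases hau : a = u
          · subst hau
            obtain ⟨g, hg⟩ := hl' a b hab
            rw [huniq hg hg₀]
            simp
          · rw [Function.update_of_ne (by simpa [Fin.ext_iff] using hau)]
            exact hlk a b hab
        have hnew : Linked (Function.update (σ.mem .index 14) ((u : ℕ) + 1) (v + 1))
            (acc ++ exits x) := by
          intro a b hab
          rcases pair_infix_append hab with h | h | ⟨h, h'⟩
          · exact keep acc (fun a b h => hpair a b
              (h.trans ((List.prefix_append _ _).trans (List.prefix_append _ _)).isInfix))
              hacc a b h
          · exact keep _ (fun _ _ h => ⟨x, h⟩) (hlink x (by simp)) a b h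
          · rw [hu, Option.some_inj] at h
            rw [hv, Option.some_inj] at h'
            subst h h'
            simp
        refine (ih (acc ++ exits x) _ (by simp [hz]) ?_ ?_ ?_ ?_ hpair ?_ ?_ ?_).mono ?_
        · simpa [hz, hx] using hl
        · simpa using fun a ha => hfirst a (List.mem_cons_of_mem _ ha)
        · simpa using fun a ha => hlast a (List.mem_cons_of_mem _ ha)
        · simpa [hx, hf, h12, hu', hv'] using fun a ha =>
            keep _ (fun _ _ h => ⟨a, h⟩) (hlink a (List.mem_cons_of_mem _ ha))
        · simp [h11, headPtr_append h1]
        · simp [hx, hla, lastPtr_append h0]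
        · simpa [hx, hf, h12, hu', hv'] using hnew
        · rintro t σ' ⟨ht, h1, h2, h3⟩
          refine ⟨by simp only [List.length_cons]; omega, ?_, ?_, ?_⟩
          · intro b hb
            rw [h1 b hb]
            simp [hb]
          · intro g hg
            refine h2 g ?_
            simpa [hx, hf, h12, hu', hv'] using keep _ (fun _ _ h => ⟨g, h⟩) hg
          · simpa using h3

/-- Whether a gate is alive (register `7`), from its type (register `8`) and the two bits computed
by `scanInputs`. -/
def gateValue : Program :=
  .branch (.eq 8 20) (.instr (.const 7 1))
    (.instr (.const 13 1) ;; .branch (.eq 8 13) (.instr (.load 7 .index 2 4))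
    (.instr (.const 13 2) ;; .branch (.eq 8 13) (.instr (.move 7 9))
    (.instr (.const 13 6) ;; .branch (.eq 8 13) (.instr (.move 7 9))
    (.instr (.const 13 7) ;; .branch (.eq 8 13)
      (.branch (.eq 9 20) (.instr (.const 7 1)) (.instr (.const 7 0)))
      (.instr (.move 7 10))))))

theorem gateValue_spec {n : ℕ} {C : HybridCircuit (Fin n)} (hH : C.Homogenized)
    (ν : C.Valuation) (g : Fin n) (σ : MachineState) (hz : σ.reg 20 = 0) (h4 : σ.reg 4 = g)
    (h8 : σ.reg 8 = (C.type g).code)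
    (h2 : ∀ h : C.type g = .bvar, IsBit (σ.mem .index 2 g) (ν ⟨g, h⟩ = true))
    (h9 : IsBit (σ.reg 9) (∃ a, C.Wire a g ∧ C.Alive ν a))
    (h10 : IsBit (σ.reg 10) (∀ a, C.Wire a g → C.Alive ν a)) :
    Halts gateValue σ fun t σ' =>
      t ≤ 11 ∧ σ'.mem = σ.mem ∧ IsBit (σ'.reg 7) (C.Alive ν g) ∧
      σ'.reg 1 = σ.reg 1 ∧ σ'.reg 2 = σ.reg 2 ∧ σ'.reg 3 = σ.reg 3 ∧ σ'.reg 4 = σ.reg 4 ∧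
      σ'.reg 8 = σ.reg 8 ∧ σ'.reg 20 = 0 := by
  simp only [gateValue, Halts.seq_iff, Halts.instr_iff, Halts.branch_iff,
    Instr.exec_move, Instr.exec_load, Instr.exec_const]
  cases ht : C.type g with
  | svar =>
    rw [ht] at h8
    simp [hz, h8, HybridGate.code, IsBit, C.alive_svar ν ht]
  | bvar =>
    rw [ht] at h8
    simpa [hz, h8, HybridGate.code, h4] using (h2 ht).congr (C.alive_bvar ν ht).symm
  | cup =>
    rw [ht] at h8
    simpa [hz, h8, HybridGate.code] using h9.congr (C.alive_any ν (.inl ht)).symm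
  | times =>
    rw [ht] at h8
    simpa [hz, h8, HybridGate.code] using h10.congr (C.alive_all ν hH (.inl ht)).symm
  | box =>
    rw [ht] at h8
    simpa [hz, h8, HybridGate.code] using h10.congr (C.alive_all ν hH (.inr (.inl ht))).symm
  | conj =>
    rw [ht] at h8
    simpa [hz, h8, HybridGate.code] using h10.congr (C.alive_all ν hH (.inr (.inr ht))).symm
  | disj =>
    rw [ht] at h8
    simpa [hz, h8, HybridGate.code] using h9.congr (C.alive_any ν (.inr ht)).symm
  | neg =>
    rw [ht] at h8
    simp [hz, h8, HybridGate.code, h9.eq_zero_iff, -not_exists, -forall_exists_index,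
      -and_imp, ← C.alive_neg ν ht]
    exact ⟨fun h => ⟨fun _ => rfl, fun hn => absurd h hn⟩,
      fun h => ⟨fun hn => absurd hn h, fun _ => rfl⟩⟩

/-- The first and the last exit of a gate (registers `11` and `12`), both null if the gate is
not alive. The exits of the inputs are linked in any case: the links that are written are
consistent even if the gate is not alive, see `consecutive_join`. -/
def gateExits : Program :=
  .branch (.eq 8 20) (.instr (.move 11 4) ;; .instr (.succ 11) ;; .instr (.move 12 11))
    (.instr (.const 13 3) ;; .branch (.eq 8 13)
      (.instr (.move 11 4) ;; .instr (.succ 11) ;; .instr (.move 12 11))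
      (.instr (.const 11 0) ;; .instr (.const 12 0) ;; .instr (.load 5 .index 7 4) ;;
        linkInputs)) ;;
  .branch (.eq 7 20) (.instr (.const 11 0) ;; .instr (.const 12 0)) .skip

theorem gateExits_spec {n : ℕ} {C : HybridCircuit (Fin n)} {inL outL : Fin n → List (Fin n)}
    (hC : C.Admissible inL) (ν : C.Valuation) (g : Fin n) (σ : MachineState)
    (hz : σ.reg 20 = 0) (hm : HoldsCircuit C inL outL σ.mem) (h4 : σ.reg 4 = g)
    (h8 : σ.reg 8 = (C.type g).code) (h7 : IsBit (σ.reg 7) (C.Alive ν g))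
    (hin : ∀ a ∈ inL g, Correct C inL ν σ.mem a) :
    Halts gateExits σ fun t σ' =>
      t ≤ 11 * (inL g).length + 12 ∧
      (∀ b, b ≠ 14 → σ'.mem .index b = σ.mem .index b) ∧
      (∀ h, Linked (σ.mem .index 14) (C.exits inL ν h) →
        Linked (σ'.mem .index 14) (C.exits inL ν h)) ∧
      σ'.reg 11 = headPtr (C.exits inL ν g) ∧ σ'.reg 12 = lastPtr (C.exits inL ν g) ∧
      Linked (σ'.mem .index 14) (C.exits inL ν g) ∧
      σ'.reg 1 = σ.reg 1 ∧ σ'.reg 2 = σ.reg 2 ∧ σ'.reg 3 = σ.reg 3 ∧ σ'.reg 4 = σ.reg 4 ∧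
      σ'.reg 20 = 0 ∧ σ'.reg 7 = σ.reg 7 := by
  have hself : (C.type g = .svar ∨ C.type g = .times) → C.Alive ν g →
      C.exits inL ν g = [g] := fun ht hal => hC.exits_self hal ht
  have single : ∀ A : ℕ → ℕ, Linked A [g] := by
    intro A x y h
    have := h.length_le
    simp at this
  have nil : ∀ A : ℕ → ℕ, Linked A ([] : List (Fin n)) := by
    intro A x y h
    have := h.length_le
    simp at this
  have hdead : ¬ C.Alive ν g → C.exits inL ν g = [] := hC.exits_dead
  simp only [gateExits, Halts.seq_iff, Halts.instr_iff, Halts.branch_iff, Halts.skip_iff,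
    Instr.exec_move, Instr.exec_load, Instr.exec_const, Instr.exec_succ]
  by_cases hsv : C.type g = .svar
  · rw [hsv] at h8
    have hal := C.alive_svar ν hsv
    have he := hself (.inl hsv) hal
    simp [hz, h8, HybridGate.code, h7.eq_zero_iff, hal, he, h4, headPtr, lastPtr, single]
  by_cases htm : C.type g = .times
  · rw [htm] at h8
    by_cases hal : C.Alive ν g
    · have he := hself (.inr htm) hal
      simp [hz, h8, HybridGate.code, h7.eq_zero_iff, hal, he, h4, headPtr, lastPtr, single]
    · have he := hdead hal
      simp [hz, h8, HybridGate.code, h7.eq_zero_iff, hal, he, headPtr, lastPtr, nil]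
  have hc0 : (C.type g).code ≠ 0 := by
    cases ht : C.type g <;> simp_all [HybridGate.code]
  have hc3 : (C.type g).code ≠ 3 := by
    cases ht : C.type g <;> simp_all [HybridGate.code]
  have hj : C.Alive ν g → C.exits inL ν g = (inL g).flatMap (C.exits inL ν) :=
    fun hal => hC.exits_join hal (by simp [hsv, htm])
  refine ⟨fun h => absurd h (by simp [h8, hz, hc0]), fun _ => ⟨fun h => absurd h
    (by simp [h8, hc3]), fun _ => ?_⟩⟩
  refine (linkInputs_spec (exits := C.exits inL ν) hC.consecutive_unique (inL g) [] _
    (by simp [hz]) ?_ ?_ ?_ ?_ ?_ (by simp [headPtr]) (by simp [lastPtr]) (nil _)).mono ?_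
  · simpa [h4] using hm.ins g
  · simpa using fun a ha => (hin a ha).first
  · simpa using fun a ha => (hin a ha).last
  · simpa using fun a ha => (hin a ha).linked
  · rw [List.nil_append]
    exact fun x y h => hC.consecutive_join htm h
  · rintro t σ' ⟨ht, h1, h2, h3, h4, h5, h6, h7', h8, h9, h10, h11, h12⟩
    simp only [List.nil_append] at h3 h4 h5
    by_cases hal : C.Alive ν g
    · have := hj hal
      rw [← this] at h3 h4 h5
      simp at h1 h2 h6 h7' h8 h9 h11
      simp [h10, h11, h7.eq_zero_iff, hal, h3, h4, h5, h6, h7', h8, h9]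
      exact ⟨by omega, h1, h2⟩
    · have := hdead hal
      simp at h1 h2 h6 h7' h8 h9 h11
      simp [h10, h11, h7.eq_zero_iff, hal, h6, h7', h8, h9, this, nil, headPtr, lastPtr]
      exact ⟨by omega, h1, h2⟩

/-- Recompute what the index says about the gate in register `4`, from what it says about
the inputs of this gate. -/
def recompute : Program :=
  .instr (.const 9 0) ;; .instr (.const 10 1) ;; .instr (.load 5 .index 7 4) ;;
  scanInputs ;; .instr (.load 8 .index 1 4) ;; gateValue ;; gateExits ;;
  .instr (.store .index 11 4 7) ;; .instr (.store .index 12 4 11) ;;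
  .instr (.store .index 13 4 12)

theorem recompute_spec {n : ℕ} {C : HybridCircuit (Fin n)} {inL outL : Fin n → List (Fin n)}
    (hC : C.Admissible inL) (ν : C.Valuation) (g : Fin n) (σ : MachineState)
    (hz : σ.reg 20 = 0) (hm : HoldsCircuit C inL outL σ.mem) (h4 : σ.reg 4 = g)
    (h2 : ∀ h : C.type g = .bvar, IsBit (σ.mem .index 2 g) (ν ⟨g, h⟩ = true))
    (hin : ∀ a ∈ inL g, Correct C inL ν σ.mem a) :
    Halts recompute σ fun t σ' =>
      t ≤ 19 * (inL g).length + 32 ∧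
      (∀ b, b < 11 → σ'.mem .index b = σ.mem .index b) ∧
      Correct C inL ν σ'.mem g ∧
      (∀ h, h ≠ g → Correct C inL ν σ.mem h → Correct C inL ν σ'.mem h) ∧
      σ'.reg 1 = σ.reg 1 ∧ σ'.reg 2 = σ.reg 2 ∧ σ'.reg 3 = σ.reg 3 ∧ σ'.reg 4 = σ.reg 4 ∧
      σ'.reg 20 = 0 := by
  simp only [recompute, Halts.seq_iff, Halts.instr_iff, Instr.exec_load, Instr.exec_const,
    Instr.exec_store]
  refine (scanInputs_spec (P := C.Alive ν) (inL g) False True _ (by simp [hz]) ?_ ?_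
    (by simp [IsBit]) (by simp [IsBit])).mono ?_
  · simpa [h4] using hm.ins g
  · simpa using fun a ha => (hin a ha).alive
  rintro t₁ σ₁ ⟨ht₁, hm₁, h9, h10, k1, k2, k3, k4, k20⟩
  simp only [hC.mem] at h9 h10
  simp at hm₁ k1 k2 k3 k4
  refine (gateValue_spec hC.homogenized ν g _ (by simp [k20]) (by simp [k4, h4]) ?_ ?_ ?_
    ?_).mono ?_
  · simp [hm₁, k4, h4, hm.type]
  · simpa [hm₁] using h2
  · simpa using h9
  · simpa using h10
  rintro t₂ σ₂ ⟨ht₂, hm₂, h7, l1, l2, l3, l4, l8, l20⟩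
  simp [hm₁, k1, k2, k3, k4] at hm₂ l1 l2 l3 l4 l8
  refine (gateExits_spec (outL := outL) hC ν g σ₂ l20 (by rw [hm₂]; exact hm) (by rw [l4, h4])
    (by rw [l8, h4, hm.type]) h7 (by rw [hm₂]; exact hin)).mono ?_
  rintro t₃ σ₃ ⟨ht₃, hf, hlk, h11, h12, hlg, j1, j2, j3, j4, j20, j7⟩
  rw [hm₂] at hf hlk
  simp only [MachineState.setCell_mem, MachineState.setCell_reg, MachineState.touch_mem,
    MachineState.touch_reg]
  refine ⟨by omega, ?_, ?_, ?_, ?_, ?_, ?_, ?_, j20⟩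
  · intro b hb
    have e1 : b ≠ 11 := by omega
    have e2 : b ≠ 12 := by omega
    have e3 : b ≠ 13 := by omega
    simp [e1, e2, e3, hf b (by omega)]
  · constructor
    · simpa [j4, l4, h4, j7] using h7
    · simp [j4, l4, h4, h11]
    · simp [j4, l4, h4, h12]
    · simpa using hlg
  · intro h hne hcor
    have hne' : (h : ℕ) ≠ g := by simpa [Fin.ext_iff] using hne
    constructor
    · simpa [j4, l4, h4, hne', hf 11] using hcor.alive
    · simpa [j4, l4, h4, hne', hf 12] using hcor.first
    · simpa [j4, l4, h4, hne', hf 13] using hcor.last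
    · simpa using hlk h hcor.linked
  · rw [j1, l1]
  · rw [j2, l2]
  · rw [j3, l3]
  · rw [j4, l4]

/-! ### Propagating changes in topological order -/

/-- Decrease the counter of the target of the wire with the pointer in register `5`, and append the
target to the queue if its counter reaches zero. -/
def propagateWire : Program :=
  .instr (.move 6 5) ;; .instr (.pred 6) ;; .instr (.load 6 .index 4 6) ;;
  .instr (.load 7 .index 9 6) ;; .instr (.pred 7) ;; .instr (.store .index 9 6 7) ;;
  .branch (.eq 7 20) (.instr (.store .index 10 3 6) ;; .instr (.succ 3)) .skip ;;
  .instr (.load 5 .index 6 5)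

/-- Treat all the wires that leave a gate, the first of which has the pointer in
register `5`. -/
def propagateWires : Program :=
  .loop (.lt 20 5) propagateWire

theorem propagateWires_spec {n : ℕ} (l : List (Fin n)) (q : List (Fin n)) (σ : MachineState)
    (hz : σ.reg 20 = 0) (hl : Chained (σ.mem .index 4) (σ.mem .index 6) (σ.reg 5) l)
    (hnd : l.Nodup) (hq : QueueIs (σ.mem .index 10) q) (hw : σ.reg 3 = q.length)
    (hpos : ∀ x ∈ l, 0 < σ.mem .index 9 x) :
    Halts propagateWires σ fun t σ' =>
      t ≤ 12 * l.length + 1 ∧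
      QueueIs (σ'.mem .index 10) (q ++ l.filter (fun x : Fin n => σ.mem .index 9 x = 1)) ∧
      σ'.reg 3 = (q ++ l.filter (fun x : Fin n => σ.mem .index 9 x = 1)).length ∧
      (∀ x : Fin n, σ'.mem .index 9 x + (if x ∈ l then 1 else 0) = σ.mem .index 9 x) ∧
      (∀ b, b ≠ 9 → b ≠ 10 → σ'.mem .index b = σ.mem .index b) ∧
      σ'.reg 1 = σ.reg 1 ∧ σ'.reg 2 = σ.reg 2 ∧ σ'.reg 20 = 0 := by
  induction l generalizing σ q with
  | nil =>
    refine Halts.loop_done ?_ ?_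
    · simp only [Chained] at hl
      simp [hl, hz]
    · simp [hq, hw, hz]
  | cons x l ih =>
    obtain ⟨hp, hlt, hx, hl⟩ := hl
    obtain ⟨hxl, hnd⟩ := List.nodup_cons.mp hnd
    refine Halts.loop_step (by simpa [hz] using hp) ?_
    rw [← propagateWires]
    simp only [propagateWire, Halts.seq_iff, Halts.instr_iff, Halts.branch_iff, Halts.skip_iff]
    have key : ∀ y : Fin n, (y : ℕ) = x ↔ y = x := fun y => Fin.ext_iff.symm
    have hf : ∀ v, l.filter (fun y : Fin n =>
        Function.update (σ.mem .index 9) (x : ℕ) v y = 1) =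
        l.filter (fun y : Fin n => σ.mem .index 9 y = 1) := by
      intro v
      refine List.filter_congr fun y hy => ?_
      rw [Function.update_of_ne]
      rw [Ne, key]
      rintro rfl
      exact hxl hy
    have hpx := hpos x (by simp)
    have hpos' : ∀ y ∈ l, 0 < Function.update (σ.mem .index 9) (x : ℕ)
        (σ.mem .index 9 x - 1) y := by
      intro y hy
      rw [Function.update_of_ne]
      · exact hpos y (by simp [hy])
      · rw [Ne, key]
        rintro rfl
        exact hxl hy
    simp only [Instr.exec_move, Instr.exec_pred, Instr.exec_load, Instr.exec_store,
      Instr.exec_succ]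
    constructor
    · intro h0
      simp [hz, hx] at h0
      have h1 : σ.mem .index 9 x = 1 := by omega
      refine (ih (q ++ [x]) _ (by simp [hz]) ?_ hnd ?_ ?_ ?_).mono ?_
      · simpa [hz, hx] using hl
      · simpa [hz, hx, hw] using hq.snoc x
      · simp [hx, hw]
      · simpa [hz, hx] using hpos'
      · simp [hx, hf, h1]
        intro t σ' ht h1 h2 h3 h4 h5 h6 h7
        refine ⟨by omega, h1, by omega, fun y => ?_, fun b hb hb' => ?_, h5, h6, h7⟩
        · have h3 := h3 y
          rw [Function.update_apply] at h3
          by_cases hy : y = x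
          · subst hy
            simp [hxl] at h3
            simp
            omega
          · simpa [key, hy] using h3
        · rw [h4 b hb hb']
          simp [hb, hb']
    · intro h0
      simp [hz, hx] at h0
      have h1 : σ.mem .index 9 x ≠ 1 := by omega
      refine (ih q _ (by simp [hz]) ?_ hnd ?_ ?_ ?_).mono ?_
      · simpa [hz, hx] using hl
      · simpa [hz, hx, hw] using hq
      · simp [hx, hw]
      · simpa [hz, hx] using hpos'
      · simp [hx, hf, h1]
        intro t σ' ht h1 h2 h3 h4 h5 h6 h7
        refine ⟨by omega, h1, by omega, fun y => ?_, fun b hb hb' => ?_, h5, h6, h7⟩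
        · have h3 := h3 y
          rw [Function.update_apply] at h3
          by_cases hy : y = x
          · subst hy
            simp [hxl] at h3
            simp
            omega
          · simpa [key, hy] using h3
        · rw [h4 b hb hb']
          simp [hb]

/-- Recompute the index at the gates reached by `explore`. A gate enters the queue when all of
its inputs have been treated. -/
def propagate : Program :=
  .instr (.const 2 0) ;; .instr (.move 3 1) ;;
  .loop (.lt 2 3)
    (.instr (.load 4 .index 10 2) ;; .instr (.succ 2) ;; recompute ;;
     .instr (.load 5 .index 5 4) ;; propagateWires)

/-- What the index contains under the valuation `ν`, with correct information about
the gates that satisfy `P`. -/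
structure IndexOK {n : ℕ} (C : HybridCircuit (Fin n)) (inL outL : Fin n → List (Fin n))
    (ν : C.Valuation) (P : Fin n → Prop) (m : Memory) : Prop where
  circuit : HoldsCircuit C inL outL m
  valuation : ∀ (g : Fin n) (h : C.type g = .bvar), m .index 2 g = (ν ⟨g, h⟩).toNat
  correct : ∀ g, P g → Correct C inL ν m g

theorem countP_le_of_nodup {α : Type*} (p : α → Bool) {l l' : List α} (h : l.Nodup)
    (hs : ∀ x ∈ l, p x → x ∈ l') : l.countP p ≤ l'.countP p := by
  rw [List.countP_eq_length_filter, List.countP_eq_length_filter]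
  refine ((h.filter p).subperm fun x hx => ?_).length_le
  rw [List.mem_filter] at hx ⊢
  exact ⟨hs x hx.1 hx.2, hx.2⟩

/-- The gates `done` have been recomputed, and the gates `todo` are those of `dl` that
remain and whose counter is zero. The counter of a gate is its number of inputs in `dl` that have
not been recomputed yet. -/
theorem propagateLoop_spec {n : ℕ} {C : HybridCircuit (Fin n)}
    {inL outL : Fin n → List (Fin n)} (hC : C.Admissible inL)
    (hout : ∀ g a, a ∈ outL g ↔ C.Wire g a) (hnd : ∀ g, (outL g).Nodup) (ν : C.Valuation)
    (dl : List (Fin n)) (hdl : dl.Nodup) (hclosed : ∀ h ∈ dl, ∀ x ∈ outL h, x ∈ dl)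
    (k : ℕ) (done todo : List (Fin n)) (hk : dl.length ≤ done.length + k) (σ : MachineState)
    (hz : σ.reg 20 = 0)
    (hI : IndexOK C inL outL ν (fun g => g ∉ dl ∨ g ∈ done) σ.mem)
    (hq : QueueIs (σ.mem .index 10) (done ++ todo)) (h2 : σ.reg 2 = done.length)
    (h3 : σ.reg 3 = (done ++ todo).length) (hqn : (done ++ todo).Nodup)
    (hmem : ∀ x, x ∈ done ++ todo ↔ x ∈ dl ∧ σ.mem .index 9 x = 0)
    (h9 : ∀ x : Fin n,
      σ.mem .index 9 x + done.countP (x ∈ outL ·) = dl.countP (x ∈ outL ·)) :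
    Halts (.loop (.lt 2 3)
      (.instr (.load 4 .index 10 2) ;; .instr (.succ 2) ;; recompute ;;
       .instr (.load 5 .index 5 4) ;; propagateWires)) σ fun t σ' =>
      IndexOK C inL outL ν (fun _ => True) σ'.mem ∧
      (∀ x : Fin n, σ'.mem .index 9 x = 0) ∧ σ'.reg 20 = 0 ∧
      ∃ rest, (done ++ rest).Nodup ∧ (∀ x ∈ done ++ rest, x ∈ dl) ∧
      t ≤ (rest.map fun h => 12 * (outL h).length + 19 * (inL h).length + 37).sum + 1 := by
  -- If the queue is empty then, by induction along the wires, every gate has been treated.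
  have final : ∀ (done : List (Fin n)) (σ : MachineState),
      IndexOK C inL outL ν (fun g => g ∉ dl ∨ g ∈ done) σ.mem →
      (∀ x, x ∈ done ↔ x ∈ dl ∧ σ.mem .index 9 x = 0) →
      (∀ x : Fin n,
        σ.mem .index 9 x + done.countP (x ∈ outL ·) = dl.countP (x ∈ outL ·)) →
      IndexOK C inL outL ν (fun _ => True) σ.mem ∧ ∀ x : Fin n, σ.mem .index 9 x = 0 := by
    intro done σ hI hmem h9
    have hall : ∀ x, x ∈ dl → x ∈ done := by
      intro x
      induction x using C.wire_wellFounded.induction with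
      | h x ih =>
        intro hx
        refine (hmem x).mpr ⟨hx, ?_⟩
        have := countP_le_of_nodup (fun y => decide (x ∈ outL y)) (l' := done) hdl
          fun y hy hxy => ih y ((hout y x).mp (by simpa using hxy)) hy
        have := h9 x
        omega
    refine ⟨⟨hI.circuit, hI.valuation, fun g _ => hI.correct g ?_⟩, fun x => ?_⟩
    · by_cases hg : g ∈ dl
      · exact .inr (hall g hg)
      · exact .inl hg
    · by_cases hx : x ∈ dl
      · exact ((hmem x).mp (hall x hx)).2
      · have h0 : dl.countP (x ∈ outL ·) = 0 := by
          rw [List.countP_eq_zero]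
          intro h hh hx'
          exact hx (hclosed h hh x (by simpa using hx'))
        have := h9 x
        omega
  induction k generalizing done todo σ with
  | zero =>
    have hdone : ∀ x ∈ done ++ todo, x ∈ dl := fun x hx => ((hmem x).mp hx).1
    have hlen : (done ++ todo).length ≤ dl.length := (hqn.subperm hdone).length_le
    have : todo = [] := by
      rw [List.length_append] at hlen
      exact List.length_eq_zero_iff.mp (by omega)
    subst this
    exact Halts.loop_done (by simp [h2, h3])
      ⟨(final done σ hI (by simpa using hmem) h9).1,
        (final done σ hI (by simpa using hmem) h9).2, hz, [], hqn, hdone, by simp⟩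
  | succ k ih =>
    have hdone : ∀ x ∈ done ++ todo, x ∈ dl := fun x hx => ((hmem x).mp hx).1
    cases todo with
    | nil =>
      exact Halts.loop_done (by simp [h2, h3])
        ⟨(final done σ hI (by simpa using hmem) h9).1,
        (final done σ hI (by simpa using hmem) h9).2, hz, [], hqn, hdone, by simp⟩
    | cons h todo =>
      have hh : σ.mem .index 10 done.length = (h : ℕ) := by
        rw [hq done.length (by simp)]
        simp
      obtain ⟨hhdl, hh9⟩ := (hmem h).mp (by simp)
      have happ1 : done ++ h :: todo = (done ++ [h]) ++ todo := by simp
      have hdn : (done ++ [h]).Nodup := by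
        rw [happ1] at hqn
        exact hqn.of_append_left
      have hcnt : ∀ x, (done ++ [h]).countP (x ∈ outL ·) =
          done.countP (x ∈ outL ·) + if x ∈ outL h then 1 else 0 := by
        intro x
        simp [List.countP_append, List.countP_cons]
      have hhd : h ∉ done := by
        intro hd
        simp [List.nodup_append] at hdn
        exact hdn.2 h hd rfl
      -- All the inputs of the gate that are to be treated have been treated.
      have hinputs : ∀ a ∈ inL h, a ∉ dl ∨ a ∈ done := by
        intro a ha
        by_contra hn
        rw [not_or, not_not] at hn
        have hw : h ∈ outL a := (hout a h).mpr ((hC.mem h a).mp ha)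
        have hn' : (done ++ [a]).Nodup := by
          refine List.nodup_append.mpr ⟨hqn.of_append_left, by simp, ?_⟩
          rintro x hx y hy rfl
          rw [List.mem_singleton] at hy
          subst hy
          exact hn.2 hx
        have := countP_le_of_nodup (fun y => decide (h ∈ outL y)) (l' := dl) hn' (by
          intro x hx _
          rcases List.mem_append.mp hx with hx | hx
          · exact hdone x (List.mem_append_left _ hx)
          · rw [List.mem_singleton] at hx
            subst hx
            exact hn.1)
        have h9' := h9 h
        simp [List.countP_append, hw] at this
        omega
      refine Halts.loop_step (by simp [h2, h3]) ?_
      simp only [Halts.seq_iff, Halts.instr_iff, Instr.exec_load, Instr.exec_succ]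
      refine (recompute_spec (outL := outL) hC ν h _ (by simp [hz]) ?_ (by simp [h2, hh])
        ?_ ?_).mono ?_
      · simpa using hI.circuit
      · intro ht
        simp only [MachineState.setReg_mem, MachineState.touch_mem]
        rw [hI.valuation h ht]
        cases ν ⟨h, ht⟩ <;> simp [IsBit]
      · simpa using fun a ha => hI.correct a (hinputs a ha)
      rintro t₁ σ₁ ⟨ht₁, hf₁, hcor, hkeep, k1, k2, k3, k4, k20⟩
      simp [h2, hh] at hf₁ hkeep k2 k3 k4
      refine (propagateWires_spec (outL h) (done ++ h :: todo) _ (by simp [k20]) ?_ (hnd h)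
        ?_ ?_ ?_).mono ?_
      · simpa [hf₁ 4, hf₁ 5, hf₁ 6, k4] using hI.circuit.outs h
      · simpa [hf₁ 10] using hq
      · simpa [k3] using h3
      · intro x hx
        simp only [MachineState.setReg_mem, MachineState.touch_mem]
        rw [hf₁ 9 (by simp)]
        have := countP_le_of_nodup (fun y => decide (x ∈ outL y)) (l' := dl) hdn
          fun y hy _ => hdone y (by rw [happ1]; exact List.mem_append_left _ hy)
        rw [hcnt, if_pos hx] at this
        have := h9 x
        omega
      intro t₂ σ₂
      simp only [MachineState.setReg_mem, MachineState.touch_mem, MachineState.setReg_reg,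
        MachineState.touch_reg, hf₁ 9 (by simp)]
      rintro ⟨ht₂, hq₂, h3₂, h9₂, hf₂, h1₂, h2₂, h20₂⟩
      set new := (outL h).filter fun x : Fin n => decide (σ.mem .index 9 x = 1) with hnew
      have hnewm : ∀ x, x ∈ new ↔ x ∈ outL h ∧ σ.mem .index 9 x = 1 := by
        intro x
        rw [hnew, List.mem_filter, decide_eq_true_iff]
      have happ : done ++ h :: todo ++ new = (done ++ [h]) ++ (todo ++ new) := by simp
      rw [happ] at hq₂ h3₂
      have hmem' : ∀ x, x ∈ done ++ [h] ++ (todo ++ new) ↔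
          x ∈ dl ∧ σ₂.mem .index 9 x = 0 := by
        intro x
        rw [← happ, List.mem_append, hmem, hnewm]
        have := h9₂ x
        by_cases hx : x ∈ outL h
        · have hxd := hclosed h hhdl x hx
          simp only [hx, if_true] at this
          simp only [hx, hxd, true_and]
          omega
        · simp only [hx, if_false] at this
          simp only [hx, false_and, or_false]
          rw [← this, Nat.add_zero]
      have hqn' : (done ++ [h] ++ (todo ++ new)).Nodup := by
        rw [← happ, List.nodup_append]
        refine ⟨hqn, (hnd h).filter _, ?_⟩
        rintro x hx y hy rfl
        have h0 := ((hmem x).mp hx).2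
        have h1 := ((hnewm x).mp hy).2
        omega
      have hI' : IndexOK C inL outL ν (fun g => g ∉ dl ∨ g ∈ done ++ [h]) σ₂.mem := by
        have hf : ∀ b, b < 9 → σ₂.mem .index b = σ.mem .index b := fun b hb => by
          rw [hf₂ b (by omega) (by omega), hf₁ b (by omega)]
        have htr : ∀ g, Correct C inL ν σ₁.mem g → Correct C inL ν σ₂.mem g := by
          intro g hg
          constructor
          · rw [hf₂ 11 (by simp) (by simp)]
            exact hg.alive
          · rw [hf₂ 12 (by simp) (by simp)]
            exact hg.first
          · rw [hf₂ 13 (by simp) (by simp)]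
            exact hg.last
          · rw [hf₂ 14 (by simp) (by simp)]
            exact hg.linked
        refine ⟨hI.circuit.congr fun b hb _ => hf b hb, ?_, ?_⟩
        · rw [hf 2 (by simp)]
          exact hI.valuation
        · intro g hg
          by_cases hgh : g = h
          · subst hgh
            exact htr g hcor
          · refine htr g (hkeep g hgh (hI.correct g ?_))
            simpa [hgh] using hg
      have h9' : ∀ x : Fin n, σ₂.mem .index 9 x + (done ++ [h]).countP (x ∈ outL ·) =
          dl.countP (x ∈ outL ·) := by
        intro x
        rw [hcnt, ← h9 x, ← h9₂ x]
        omega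
      refine (ih (done ++ [h]) (todo ++ new) (by simp; omega) σ₂ h20₂ hI' hq₂ ?_ h3₂ hqn' hmem'
        h9').mono ?_
      · simp [h2₂, k2]
      · rintro t' σ₃ ⟨hI₃, h9₃, h20₃, rest, hrn, hrd, ht₃⟩
        have e : done ++ [h] ++ rest = done ++ h :: rest := by simp
        rw [e] at hrn hrd
        refine ⟨hI₃, h9₃, h20₃, h :: rest, hrn, hrd, ?_⟩
        simp only [List.map_cons, List.sum_cons]
        omega

theorem propagate_spec {n : ℕ} {C : HybridCircuit (Fin n)}
    {inL outL : Fin n → List (Fin n)} (hC : C.Admissible inL)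
    (hout : ∀ g a, a ∈ outL g ↔ C.Wire g a) (hnd : ∀ g, (outL g).Nodup) (ν : C.Valuation)
    (dl S : List (Fin n)) (hdl : dl.Nodup) (hclosed : ∀ h ∈ dl, ∀ x ∈ outL h, x ∈ dl)
    (hS : S <+: dl) (hsrc : ∀ x, x ∈ S ↔ x ∈ dl ∧ dl.countP (x ∈ outL ·) = 0)
    (σ : MachineState) (hz : σ.reg 20 = 0)
    (hI : IndexOK C inL outL ν (fun g => g ∉ dl) σ.mem)
    (hq : QueueIs (σ.mem .index 10) dl) (h1 : σ.reg 1 = S.length)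
    (h9 : ∀ x : Fin n, σ.mem .index 9 x = dl.countP (x ∈ outL ·)) :
    Halts propagate σ fun t σ' =>
      IndexOK C inL outL ν (fun _ => True) σ'.mem ∧
      (∀ x : Fin n, σ'.mem .index 9 x = 0) ∧ σ'.reg 20 = 0 ∧
      ∃ rest : List (Fin n), rest.Nodup ∧ (∀ x ∈ rest, x ∈ dl) ∧
      t ≤ (rest.map fun h => 12 * (outL h).length + 19 * (inL h).length + 37).sum + 3 := by
  simp only [propagate, Halts.seq_iff, Halts.instr_iff, Instr.exec_const, Instr.exec_move]
  refine (propagateLoop_spec hC hout hnd ν dl hdl hclosed dl.length [] S (by simp) _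
    (by simp [hz]) (by simpa using hI) (by simpa using hq.prefix hS) (by simp) (by simp [h1])
    (by simpa using hdl.sublist hS.sublist) (by simpa [h9] using hsrc)
    (by simpa using h9)).mono ?_
  rintro t σ' ⟨h, h9', h20, rest, hn, hr, ht⟩
  rw [List.nil_append] at hn hr
  exact ⟨h, h9', h20, rest, hn, hr, by omega⟩

/-! ### Preprocessing and updates -/

/-- Start the enumeration: the first position is at the first exit of the output gate. -/
def initState : Program :=
  .instr (.const 2 2) ;; .instr (.load 2 .index 0 2) ;; .instr (.load 3 .index 12 2) ;;
  .instr (.load 4 .index 13 2) ;; .instr (.load 6 .index 11 2) ;; .instr (.const 5 1) ;;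
  .instr (.store .work 1 5 3) ;; .instr (.store .work 2 5 4) ;; .instr (.store .work 3 5 20) ;;
  .instr (.store .work 0 20 6)

/-- The initial enumeration state. -/
structure IsInitial {n : ℕ} (C : HybridCircuit (Fin n)) (inL : Fin n → List (Fin n))
    (ν : C.Valuation) (m : Memory) : Prop where
  flag : IsBit (m .work 0 0) (C.Alive ν C.output)
  exit : m .work 1 1 = headPtr (C.exits inL ν C.output)
  last : m .work 2 1 = lastPtr (C.exits inL ν C.output)
  pending : m .work 3 1 = 0

theorem IndexOK.congr {n : ℕ} {C : HybridCircuit (Fin n)} {inL outL : Fin n → List (Fin n)}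
    {ν : C.Valuation} {P : Fin n → Prop} {m m' : Memory} (h : IndexOK C inL outL ν P m)
    (hm : ∀ b, b ≠ 9 → b ≠ 10 → m' .index b = m .index b) : IndexOK C inL outL ν P m' := by
  refine ⟨h.circuit.congr fun b hb _ => hm b (by omega) (by omega), ?_, fun g hg => ?_⟩
  · rw [hm 2 (by simp) (by simp)]
    exact h.valuation
  · have := h.correct g hg
    constructor
    · rw [hm 11 (by simp) (by simp)]
      exact this.alive
    · rw [hm 12 (by simp) (by simp)]
      exact this.first
    · rw [hm 13 (by simp) (by simp)]
      exact this.last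
    · rw [hm 14 (by simp) (by simp)]
      exact this.linked

theorem initState_spec {n : ℕ} {C : HybridCircuit (Fin n)} {inL outL : Fin n → List (Fin n)}
    {ν : C.Valuation} (σ : MachineState) (hz : σ.reg 20 = 0)
    (hI : IndexOK C inL outL ν (fun _ => True) σ.mem) :
    Halts initState σ fun t σ' => t ≤ 10 ∧ IsInitial C inL ν σ'.mem ∧
      (∀ b, σ'.mem .index b = σ.mem .index b) := by
  simp only [initState, Halts.seq_iff, Halts.instr_iff, Instr.exec_load, Instr.exec_const,
    Instr.exec_store]
  have ho := hI.circuit.output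
  have hc := hI.correct C.output trivial
  refine ⟨by simp, ⟨?_, ?_, ?_, ?_⟩, by simp⟩
  · simpa [ho, hz] using hc.alive
  · simpa [ho, hz] using hc.first
  · simpa [ho, hz] using hc.last
  · simp [hz]

/-- Recompute the index at all the gates that depend on the gates in the queue, whose number is in
register `1`, and restart the enumeration. -/
def refresh : Program := explore ;; propagate ;; initState

/-- In a set of gates that is closed under outgoing wires there are at most as many outgoing
wires as there are incoming ones. -/
theorem sum_out_le_sum_in {n : ℕ} {W : Fin n → Fin n → Prop} {inL outL : Fin n → List (Fin n)}
    (hin : ∀ g a, a ∈ inL g ↔ W a g) (hout : ∀ g a, a ∈ outL g ↔ W g a)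
    (hnd : ∀ g, (outL g).Nodup) (D : Finset (Fin n)) (hD : ∀ h ∈ D, ∀ x ∈ outL h, x ∈ D) :
    ∑ h ∈ D, (outL h).length ≤ ∑ h ∈ D, (inL h).length := by
  classical
  calc ∑ h ∈ D, (outL h).length = ∑ h ∈ D, (D.bipartiteAbove W h).card := by
        refine Finset.sum_congr rfl fun h hh => ?_
        rw [← List.toFinset_card_of_nodup (hnd h)]
        congr 1
        ext x
        rw [List.mem_toFinset, Finset.mem_bipartiteAbove, hout]
        exact ⟨fun hw => ⟨hD h hh x ((hout h x).mpr hw), hw⟩, fun hw => hw.2⟩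
    _ = ∑ h ∈ D, (D.bipartiteBelow W h).card :=
        Finset.sum_card_bipartiteAbove_eq_sum_card_bipartiteBelow W
    _ ≤ ∑ h ∈ D, (inL h).length := by
        refine Finset.sum_le_sum fun h _ => ?_
        refine le_trans (Finset.card_le_card fun x hx => ?_) (List.toFinset_card_le (inL h))
        rw [List.mem_toFinset, hin]
        exact ((Finset.mem_bipartiteBelow W).mp hx).2

theorem sum_map_le_sum {n : ℕ} (f : Fin n → ℕ) {l : List (Fin n)} {D : Finset (Fin n)}
    (hl : l.Nodup) (hD : ∀ x ∈ l, x ∈ D) : (l.map f).sum ≤ ∑ h ∈ D, f h := by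
  rw [← List.sum_toFinset f hl]
  exact Finset.sum_le_sum_of_subset fun x hx => hD x (by simpa using hx)

/-- The set `D` of gates is closed under outgoing wires, and all its gates depend on its source
gates, listed in `S`. The running time is linear in `D`, as the wires that leave a gate
of `D` also enter a gate of `D`, and each gate has at most `k` inputs. -/
theorem refresh_spec {n : ℕ} {C : HybridCircuit (Fin n)}
    {inL outL : Fin n → List (Fin n)} (hC : C.Admissible inL)
    (hout : ∀ g a, a ∈ outL g ↔ C.Wire g a) (hnd : ∀ g, (outL g).Nodup) (ν : C.Valuation)
    {k : ℕ} (hk : ∀ g, (inL g).length ≤ k) (D : Finset (Fin n)) (S : List (Fin n))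
    (hD : ∀ h ∈ D, ∀ x ∈ outL h, x ∈ D) (hsrc : ∀ h ∈ D, ∀ x ∈ outL h, x ∉ S)
    (hreach : ∀ x ∈ D, x ∈ S ∨ ∃ h ∈ D, C.Wire h x) (hS : S.Nodup) (hSD : ∀ s ∈ S, s ∈ D)
    (σ : MachineState) (hz : σ.reg 20 = 0)
    (hI : IndexOK C inL outL ν (fun g => g ∉ D) σ.mem)
    (hq : QueueIs (σ.mem .index 10) S) (h1 : σ.reg 1 = S.length)
    (h9 : ∀ x : Fin n, σ.mem .index 9 x = 0) :
    Halts refresh σ fun t σ' =>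
      IndexOK C inL outL ν (fun _ => True) σ'.mem ∧ (∀ x : Fin n, σ'.mem .index 9 x = 0) ∧
      IsInitial C inL ν σ'.mem ∧ t ≤ 43 * (k + 1) * D.card + 16 := by
  simp only [refresh, Halts.seq_iff]
  refine (explore_spec outL S D hnd hD hsrc hS hSD σ hz hI.circuit.outs hq h1 h9).mono ?_
  rintro t₁ σ₁ ⟨dl, hSdl, hdl, hdlD, hmem, h9₁, hq₁, hf₁, h1₁, h20₁, ht₁⟩
  have hclosed : ∀ h ∈ dl, ∀ x ∈ outL h, x ∈ dl := by
    intro h hh x hx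
    exact (hmem x).mpr (.inr (List.countP_pos_iff.mpr ⟨h, hh, by simpa using hx⟩))
  have hDdl : ∀ x, x ∈ D → x ∈ dl := by
    intro x
    induction x using C.wire_wellFounded.induction with
    | h x ih =>
      intro hx
      rcases hreach x hx with hs | ⟨h, hh, hw⟩
      · exact hSdl.subset hs
      · exact hclosed h (ih h hw hh) x ((hout h x).mpr hw)
  have hsrc' : ∀ x, x ∈ S ↔ x ∈ dl ∧ dl.countP (x ∈ outL ·) = 0 := by
    intro x
    constructor
    · intro hx
      refine ⟨hSdl.subset hx, List.countP_eq_zero.mpr fun h hh hw => ?_⟩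
      exact hsrc h (hdlD h hh) x (by simpa using hw) hx
    · rintro ⟨hx, h0⟩
      rcases (hmem x).mp hx with hs | hs
      · exact hs
      · omega
  have hI₁ : IndexOK C inL outL ν (fun g => g ∉ dl) σ₁.mem := by
    have := hI.congr hf₁
    exact ⟨this.circuit, this.valuation, fun g hg => this.correct g fun hgD => hg (hDdl g hgD)⟩
  refine (propagate_spec hC hout hnd ν dl S hdl hclosed hSdl hsrc' σ₁ h20₁ hI₁ hq₁
    (h1₁.trans h1) h9₁).mono ?_
  rintro t₂ σ₂ ⟨hI₂, h9₂, h20₂, rest, hrn, hrd, ht₂⟩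
  refine (initState_spec σ₂ h20₂ hI₂).mono ?_
  rintro t₃ σ₃ ⟨ht₃, hinit, hf₃⟩
  refine ⟨hI₂.congr fun b _ _ => hf₃ b, by rw [hf₃ 9]; exact h9₂, hinit, ?_⟩
  have hin : ∑ h ∈ D, (inL h).length ≤ k * D.card := by
    calc ∑ h ∈ D, (inL h).length ≤ ∑ _h ∈ D, k := Finset.sum_le_sum fun h _ => hk h
      _ = k * D.card := by rw [Finset.sum_const, smul_eq_mul, Nat.mul_comm]
  have hio := sum_out_le_sum_in hC.mem hout hnd D hD
  have e₁ := sum_map_le_sum (fun h => 12 * (outL h).length + 6) hdl hdlD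
  have e₂ := sum_map_le_sum (fun h => 12 * (outL h).length + 19 * (inL h).length + 37) hrn
    fun x hx => hdlD x (hrd x hx)
  simp only [Finset.sum_add_distrib, ← Finset.mul_sum, Finset.sum_const, smul_eq_mul] at e₁ e₂
  have : 43 * (k + 1) * D.card = 43 * (k * D.card) + 43 * D.card := by ring
  omega

/-- Toggle the Boolean variable in register `0` and recompute the index at the gates that
depend on it. -/
def updateProgram : Program :=
  .instr (.load 2 .index 2 0) ;;
  .branch (.eq 2 20) (.instr (.const 2 1)) (.instr (.const 2 0)) ;;
  .instr (.store .index 2 0 2) ;; .instr (.store .index 10 20 0) ;; .instr (.const 1 1) ;;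
  refresh

theorem updateProgram_spec {n : ℕ} {C : HybridCircuit (Fin n)}
    {inL outL : Fin n → List (Fin n)} (hC : C.Admissible inL)
    (hout : ∀ g a, a ∈ outL g ↔ C.Wire g a) (hnd : ∀ g, (outL g).Nodup) (ν : C.Valuation)
    {k : ℕ} (hk : ∀ g, (inL g).length ≤ k) (v : {g : Fin n // C.type g = .bvar})
    (m : Memory) (hI : IndexOK C inL outL ν (fun _ => True) m)
    (h9 : ∀ x : Fin n, m .index 9 x = 0) :
    Halts updateProgram (MachineState.call m (v : Fin n)) fun t σ' =>
      IndexOK C inL outL (C.toggle ν v) (fun _ => True) σ'.mem ∧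
      (∀ x : Fin n, σ'.mem .index 9 x = 0) ∧
      IsInitial C inL (C.toggle ν v) σ'.mem ∧ t ≤ 65 * (k + 1) * C.dependencySize := by
  classical
  set D : Finset (Fin n) := Finset.univ.filter fun g => C.Path v g with hDdef
  have hDm : ∀ g, g ∈ D ↔ C.Path v g := fun g => by simp [hDdef]
  have hDcard : D.card ≤ C.dependencySize := by
    have e : (C.dependents (v : Fin n)).ncard = D.card := by
      rw [← Set.ncard_coe_finset]
      congr 1
      ext g
      simp [hDm, Circuit.dependents]
    rw [← e]
    exact Finset.le_sup (f := fun g => (C.dependents g).ncard) (Finset.mem_univ (v : Fin n))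
  have hDpos : 0 < D.card := Finset.card_pos.mpr ⟨v, (hDm _).mpr .refl⟩
  have hz : ∀ r, r ≠ 0 → (MachineState.call m (v : Fin n)).reg r = 0 :=
    fun r hr => MachineState.call_reg m _ r hr
  have hval := hI.valuation v v.2
  -- What `refresh` does, in either case of the branch in which the variable is toggled.
  have main : ∀ σ : MachineState, σ.reg 20 = 0 → σ.reg 1 = 1 →
      σ.mem .index 10 0 = ((v : Fin n) : ℕ) →
      (∀ b, b ≠ 2 → b ≠ 10 → σ.mem .index b = m .index b) →
      σ.mem .index 2 = Function.update (m .index 2) ((v : Fin n) : ℕ) (!(ν v)).toNat →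
      Halts refresh σ fun t σ' =>
        IndexOK C inL outL (C.toggle ν v) (fun _ => True) σ'.mem ∧
        (∀ x : Fin n, σ'.mem .index 9 x = 0) ∧
        IsInitial C inL (C.toggle ν v) σ'.mem ∧ t ≤ 43 * (k + 1) * D.card + 16 := by
    intro σ h20 h1 h10 hf h2
    refine refresh_spec hC hout hnd (C.toggle ν v) hk D [(v : Fin n)] ?_ ?_ ?_ (by simp) ?_ σ h20
      ?_ ?_ (by simp [h1]) ?_
    · intro h hh x hx
      exact (hDm x).mpr (((hDm h).mp hh).tail ((hout h x).mp hx))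
    · intro h hh x hx hxv
      rw [List.mem_singleton] at hxv
      subst hxv
      exact C.acyclic v (Relation.TransGen.tail' ((hDm h).mp hh) ((hout h _).mp hx))
    · intro x hx
      rcases Relation.ReflTransGen.cases_tail ((hDm x).mp hx) with h | ⟨h, hp, hw⟩
      · exact .inl (by simp [h])
      · exact .inr ⟨h, (hDm h).mpr hp, hw⟩
    · intro s hs
      rw [List.mem_singleton] at hs
      subst hs
      exact (hDm _).mpr .refl
    · refine ⟨hI.circuit.congr fun b hb hb' => hf b hb' (by omega), ?_, ?_⟩
      · intro g hg
        rw [h2]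
        by_cases hgv : g = v
        · subst hgv
          rw [Function.update_self, HybridCircuit.toggle, Function.update_self]
        · rw [Function.update_of_ne (by simpa [Fin.ext_iff] using hgv), hI.valuation g hg,
            HybridCircuit.toggle, Function.update_of_ne]
          rintro h
          exact hgv (congrArg Subtype.val h)
      · intro g hg
        rw [hDm] at hg
        have hc := hI.correct g trivial
        have he := hC.exits_toggle ν v g hg
        constructor
        · rw [hf 11 (by simp) (by simp)]
          exact hc.alive.congr (C.alive_toggle ν hC.homogenized v g hg).symm
        · rw [hf 12 (by simp) (by simp), he]
          exact hc.first
        · rw [hf 13 (by simp) (by simp), he]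
          exact hc.last
        · rw [hf 14 (by simp) (by simp), he]
          exact hc.linked
    · intro i hi
      have : i = 0 := by simpa using hi
      subst this
      simpa using h10
    · rw [hf 9 (by simp) (by simp)]
      exact h9
  have bound : ∀ t, t ≤ 43 * (k + 1) * D.card + 16 →
      t + 6 ≤ 65 * (k + 1) * C.dependencySize := by
    intro t ht
    have h1 : (k + 1) * D.card ≤ (k + 1) * C.dependencySize := Nat.mul_le_mul_left _ hDcard
    have h2 : 1 ≤ (k + 1) * D.card := Nat.mul_pos (by omega) hDpos
    rw [Nat.mul_assoc] at ht ⊢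
    omega
  simp only [updateProgram, Halts.seq_iff, Halts.instr_iff, Halts.branch_iff, Instr.exec_load,
    Instr.exec_const, Instr.exec_store]
  constructor
  · intro h0
    simp [hz, hval] at h0
    refine (main _ (by simp [hz]) (by simp) (by simp [hz]) ?_ (by simp [h0])).mono ?_
    · intro b hb hb'
      simp [hb, hb']
    · rintro t σ' ⟨a, b, c, ht⟩
      refine ⟨a, b, c, ?_⟩
      have := bound t ht
      omega
  · intro h0
    simp [hz, hval] at h0
    refine (main _ (by simp [hz]) (by simp) (by simp [hz]) ?_ (by simp [h0])).mono ?_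
    · intro b hb hb'
      simp [hb, hb']
    · rintro t σ' ⟨a, b, c, ht⟩
      refine ⟨a, b, c, ?_⟩
      have := bound t ht
      omega

/-! ### Building the adjacency lists -/

theorem Chained.update {n : ℕ} {val nxt : ℕ → ℕ} {p e v : ℕ} {l : List (Fin n)}
    (h : Chained val nxt p l) (hp : p ≤ e) :
    Chained val (Function.update nxt (e + 1) v) p l := by
  induction l generalizing p with
  | nil => exact h
  | cons x l ih =>
    obtain ⟨h0, hlt, hx, hl⟩ := h
    have e1 : Function.update nxt (e + 1) v p = nxt p := Function.update_of_ne (by omega) _ _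
    exact ⟨h0, by rw [e1]; exact hlt, hx, by rw [e1]; exact ih hl (by omega)⟩

theorem Chained.eq_zero_iff {n : ℕ} {val nxt : ℕ → ℕ} {p : ℕ} {l : List (Fin n)}
    (h : Chained val nxt p l) : p = 0 ↔ l = [] := by
  cases l with
  | nil => exact iff_of_true h rfl
  | cons x l => exact iff_of_false h.1.ne' (by simp)

/-- The targets of the wires in `ws` that leave `g`, the last wire first. -/
def targets {n : ℕ} (ws : List (Fin n × Fin n)) (g : Fin n) : List (Fin n) :=
  ((ws.filter fun w => w.1 = g).map Prod.snd).reverse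

/-- The origins of the wires in `ws` that enter `g`, the last wire first. -/
def origins {n : ℕ} (ws : List (Fin n × Fin n)) (g : Fin n) : List (Fin n) :=
  ((ws.filter fun w => w.2 = g).map Prod.fst).reverse

theorem targets_snoc {n : ℕ} (ws : List (Fin n × Fin n)) (w : Fin n × Fin n) (g : Fin n) :
    targets (ws ++ [w]) g = if w.1 = g then w.2 :: targets ws g else targets ws g := by
  by_cases h : w.1 = g <;> simp [targets, h, List.filter_append]

theorem origins_snoc {n : ℕ} (ws : List (Fin n × Fin n)) (w : Fin n × Fin n) (g : Fin n) :
    origins (ws ++ [w]) g = if w.2 = g then w.1 :: origins ws g else origins ws g := by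
  by_cases h : w.2 = g <;> simp [origins, h, List.filter_append]

theorem mem_targets {n : ℕ} {ws : List (Fin n × Fin n)} {g a : Fin n} :
    a ∈ targets ws g ↔ (g, a) ∈ ws := by
  simp [targets]

theorem mem_origins {n : ℕ} {ws : List (Fin n × Fin n)} {g a : Fin n} :
    a ∈ origins ws g ↔ (a, g) ∈ ws := by
  simp [origins]

theorem targets_nodup {n : ℕ} {ws : List (Fin n × Fin n)} (h : ws.Nodup) (g : Fin n) :
    (targets ws g).Nodup := by
  rw [targets, List.nodup_reverse]
  refine List.Nodup.map_on ?_ (h.filter _)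
  rintro ⟨a, b⟩ ha ⟨a', b'⟩ ha' rfl
  simp only [List.mem_filter, decide_eq_true_iff] at ha ha'
  rw [ha.2, ha'.2]

theorem origins_nodup {n : ℕ} {ws : List (Fin n × Fin n)} (h : ws.Nodup) (g : Fin n) :
    (origins ws g).Nodup := by
  rw [origins, List.nodup_reverse]
  refine List.Nodup.map_on ?_ (h.filter _)
  rintro ⟨a, b⟩ ha ⟨a', b'⟩ ha' rfl
  simp only [List.mem_filter, decide_eq_true_iff] at ha ha'
  rw [ha.2, ha'.2]

/-- Insert one wire, whose number is in register `3`, into the list of outputs of its origin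
and into the list of inputs of its target. -/
def buildStep : Program :=
  .instr (.load 4 .index 3 3) ;; .instr (.load 5 .index 4 3) ;;
  .instr (.load 6 .index 5 4) ;; .instr (.load 7 .index 7 5) ;; .instr (.succ 3) ;;
  .instr (.store .index 6 3 6) ;; .instr (.store .index 5 4 3) ;;
  .instr (.store .index 8 3 7) ;; .instr (.store .index 7 5 3)

theorem buildLoop_spec {n : ℕ} (ws pre suf : List (Fin n × Fin n)) (hws : ws = pre ++ suf)
    (σ : MachineState) (hz : σ.reg 20 = 0) (h2 : σ.reg 2 = ws.length)
    (h3 : σ.reg 3 = pre.length)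
    (horig : ∀ (e : ℕ) (h : e < ws.length), σ.mem .index 3 e = (ws[e].1 : ℕ))
    (htarg : ∀ (e : ℕ) (h : e < ws.length), σ.mem .index 4 e = (ws[e].2 : ℕ))
    (hout : ∀ g : Fin n, σ.mem .index 5 g ≤ pre.length ∧
      Chained (σ.mem .index 4) (σ.mem .index 6) (σ.mem .index 5 g) (targets pre g))
    (hin : ∀ g : Fin n, σ.mem .index 7 g ≤ pre.length ∧
      Chained (σ.mem .index 3) (σ.mem .index 8) (σ.mem .index 7 g) (origins pre g)) :
    Halts (.loop (.lt 3 2) buildStep) σ fun t σ' =>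
      t ≤ 10 * suf.length + 1 ∧ σ'.reg 20 = 0 ∧
      (∀ g : Fin n, Chained (σ'.mem .index 4) (σ'.mem .index 6) (σ'.mem .index 5 g)
        (targets ws g)) ∧
      (∀ g : Fin n, Chained (σ'.mem .index 3) (σ'.mem .index 8) (σ'.mem .index 7 g)
        (origins ws g)) ∧
      (∀ b, b < 5 ∨ 8 < b → σ'.mem .index b = σ.mem .index b) := by
  induction suf generalizing pre σ with
  | nil =>
    rw [List.append_nil] at hws
    subst hws
    exact Halts.loop_done (by simp [h2, h3])
      ⟨by simp, hz, fun g => (hout g).2, fun g => (hin g).2, fun _ _ => rfl⟩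
  | cons w suf ih =>
    have hlt : pre.length < ws.length := by simp [hws]
    have hw : ws[pre.length] = w := by simp [hws]
    have ho := horig _ hlt
    have ht := htarg _ hlt
    rw [hw] at ho ht
    refine Halts.loop_step (by simp [h2, h3, hlt]) ?_
    simp only [buildStep, Halts.seq_iff, Halts.instr_iff, Instr.exec_load, Instr.exec_store,
      Instr.exec_succ]
    refine (ih (pre ++ [w]) (by simp [hws]) _ (by simp [hz]) ?_ ?_ ?_ ?_ ?_ ?_).mono ?_
    · simp [h2]
    · simp [h3]
    · simpa using horig
    · simpa using htarg
    · intro g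
      obtain ⟨hb, hc⟩ := hout g
      rw [targets_snoc]
      by_cases hg : w.1 = g
      · subst hg
        simp [h3, ho]
        refine ⟨by simp, ?_, ?_, ?_⟩
        · rw [Function.update_self]
          omega
        · simpa using ht
        · rw [Function.update_self]
          exact hc.update hb
      · have hg' : (g : ℕ) ≠ w.1 := fun h => hg (Fin.ext h.symm)
        simp [h3, ho, hg, hg']
        exact ⟨by omega, hc.update hb⟩
    · intro g
      obtain ⟨hb, hc⟩ := hin g
      rw [origins_snoc]
      by_cases hg : w.2 = g
      · subst hg
        simp [h3, ht]
        refine ⟨by simp, ?_, ?_, ?_⟩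
        · rw [Function.update_self]
          omega
        · simpa using ho
        · rw [Function.update_self]
          exact hc.update hb
      · have hg' : (g : ℕ) ≠ w.2 := fun h => hg (Fin.ext h.symm)
        simp [h3, ht, hg, hg']
        exact ⟨by omega, hc.update hb⟩
    · rintro t σ' ⟨h1, h2, h3, h4, h5⟩
      refine ⟨by simp only [List.length_cons]; omega, h2, h3, h4, fun b hb => ?_⟩
      rw [h5 b hb]
      have e5 : b ≠ 5 := by omega
      have e6 : b ≠ 6 := by omega
      have e7 : b ≠ 7 := by omega
      have e8 : b ≠ 8 := by omega
      simp [e5, e6, e7, e8]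

/-- Append the gate in register `3` to the queue if it has no inputs. -/
def sourceStep : Program :=
  .instr (.load 4 .index 7 3) ;;
  .branch (.eq 4 20) (.instr (.store .index 10 1 3) ;; .instr (.succ 1)) .skip ;;
  .instr (.succ 3)

theorem sourceLoop_spec {n : ℕ} (pre suf : List (Fin n)) (hn : List.finRange n = pre ++ suf)
    (σ : MachineState) (hz : σ.reg 20 = 0) (h2 : σ.reg 2 = n) (h3 : σ.reg 3 = pre.length)
    (hq : QueueIs (σ.mem .index 10) (pre.filter fun x : Fin n => σ.mem .index 7 x = 0))
    (h1 : σ.reg 1 = (pre.filter fun x : Fin n => σ.mem .index 7 x = 0).length) :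
    Halts (.loop (.lt 3 2) sourceStep) σ fun t σ' =>
      t ≤ 6 * suf.length + 1 ∧ σ'.reg 20 = 0 ∧
      QueueIs (σ'.mem .index 10)
        ((List.finRange n).filter fun x : Fin n => σ.mem .index 7 x = 0) ∧
      σ'.reg 1 = ((List.finRange n).filter fun x : Fin n => σ.mem .index 7 x = 0).length ∧
      (∀ b, b ≠ 10 → σ'.mem .index b = σ.mem .index b) := by
  have hlen := congrArg List.length hn
  rw [List.length_finRange, List.length_append] at hlen
  induction suf generalizing pre σ with
  | nil =>
    rw [List.append_nil] at hn
    rw [hn]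
    exact Halts.loop_done (by simp at hlen; simp [h2, h3, ← hlen])
      ⟨by simp, hz, hq, h1, fun _ _ => rfl⟩
  | cons g suf ih =>
    have hg : pre.length = (g : ℕ) := by
      have h : (List.finRange n)[pre.length]? = some g := by simp [hn]
      obtain ⟨h', he⟩ := List.getElem?_eq_some_iff.mp h
      rw [List.getElem_finRange] at he
      rw [← he]
      rfl
    refine Halts.loop_step (by simp at hlen; simp [h2, h3]; omega) ?_
    simp only [sourceStep, Halts.seq_iff, Halts.instr_iff, Halts.branch_iff, Halts.skip_iff,
      Instr.exec_load, Instr.exec_store, Instr.exec_succ]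
    have hlen' : n = (pre ++ [g]).length + suf.length := by
      simp at hlen ⊢
      omega
    constructor
    · intro h0
      simp [h3, hg, hz] at h0
      have hfil : (pre ++ [g]).filter (fun x : Fin n => σ.mem .index 7 x = 0) =
          pre.filter (fun x : Fin n => σ.mem .index 7 x = 0) ++ [g] := by
        simp [List.filter_append, h0]
      refine (ih (pre ++ [g]) (by simp [hn]) _ (by simp [hz]) (by simp [h2]) (by simp [h3])
        ?_ ?_ hlen').mono ?_
      · have := hq.snoc g
        rw [← h1, ← hfil] at this
        simpa [h3, hg] using this
      · have := congrArg List.length hfil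
        rw [List.length_append, ← h1] at this
        simpa using this.symm
      · rintro t σ' ⟨k1, k2, k3, k4, k5⟩
        simp at k3 k4
        refine ⟨by simp only [List.length_cons]; omega, k2, k3, k4, fun b hb => ?_⟩
        rw [k5 b hb]
        simp [hb]
    · intro h0
      simp [h3, hg, hz] at h0
      have hfil : (pre ++ [g]).filter (fun x : Fin n => σ.mem .index 7 x = 0) =
          pre.filter (fun x : Fin n => σ.mem .index 7 x = 0) := by
        simp [List.filter_append, h0]
      refine (ih (pre ++ [g]) (by simp [hn]) _ (by simp [hz]) (by simp [h2]) (by simp [h3])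
        ?_ ?_ hlen').mono ?_
      · rw [← hfil] at hq
        simpa using hq
      · rw [← hfil] at h1
        simpa using h1
      · rintro t σ' ⟨k1, k2, k3, k4, k5⟩
        simp at k3 k4
        refine ⟨by simp only [List.length_cons]; omega, k2, k3, k4, fun b hb => ?_⟩
        rw [k5 b hb]
        simp

/-- Build the adjacency lists, put the gates without inputs in the queue, and
compute the index at all gates. -/
def preprocessProgram : Program :=
  .instr (.const 2 1) ;; .instr (.load 2 .index 0 2) ;; .instr (.const 3 0) ;;
  .loop (.lt 3 2) buildStep ;;
  .instr (.const 1 0) ;; .instr (.load 2 .index 0 20) ;; .instr (.const 3 0) ;;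
  .loop (.lt 3 2) sourceStep ;; refresh

theorem preprocessProgram_spec {n : ℕ} {C : HybridCircuit (Fin n)} {ws : List (Fin n × Fin n)}
    (hnd : ws.Nodup) (hws : ∀ w, w ∈ ws ↔ w ∈ C.wires) (hC : C.Admissible (origins ws))
    (ν : C.Valuation) {k : ℕ} (hk : ∀ g, (origins ws g).length ≤ k) :
    Halts preprocessProgram (MachineState.call (encode C ws ν) 0) fun t σ' =>
      IndexOK C (origins ws) (targets ws) ν (fun _ => True) σ'.mem ∧
      (∀ x : Fin n, σ'.mem .index 9 x = 0) ∧
      IsInitial C (origins ws) ν σ'.mem ∧ t ≤ 100 * (k + 1) * C.size := by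
  have hz : ∀ r, (MachineState.call (encode C ws ν) 0).reg r = 0 := fun r => by
    by_cases h : r = 0
    · subst h
      rfl
    · exact MachineState.call_reg _ _ r h
  have hout : ∀ g a, a ∈ targets ws g ↔ C.Wire g a := fun g a => by
    rw [mem_targets, hws]
    rfl
  have hsize : C.size = n + ws.length := by
    have : ws.toFinset = C.wires := by
      ext w
      rw [List.mem_toFinset, hws]
    rw [Circuit.size, Fintype.card_fin, ← this, List.toFinset_card_of_nodup hnd]
  have hnpos : 0 < n := Fin.pos C.output
  have enc0 : encode C ws ν .index 0 0 = n := rfl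
  have enc1 : encode C ws ν .index 0 1 = ws.length := rfl
  have enc2 : encode C ws ν .index 0 2 = C.output := rfl
  have encz : ∀ b, 5 ≤ b → ∀ i, encode C ws ν .index b i = 0 := by
    intro b hb i
    obtain ⟨b, rfl⟩ := Nat.exists_eq_add_of_le' hb
    rfl
  simp only [preprocessProgram, Halts.seq_iff, Halts.instr_iff, Instr.exec_load,
    Instr.exec_const]
  refine (buildLoop_spec ws [] ws rfl _ (by simp [hz]) (by simp [enc1]) (by simp) ?_ ?_ ?_
    ?_).mono ?_
  · intro e he
    simp [encode, he]
  · intro e he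
    simp [encode, he]
  · intro g
    simp [encz, targets, Chained]
  · intro g
    simp [encz, origins, Chained]
  rintro t₁ σ₁ ⟨ht₁, h20₁, hout₁, hin₁, hf₁⟩
  simp at hf₁
  refine (sourceLoop_spec [] (List.finRange n) rfl _ (by simp [h20₁])
    (by simp [h20₁, hf₁ 0, enc0]) (by simp) ?_ (by simp)).mono ?_
  · intro i hi
    simp at hi
  rintro t₂ σ₂ ⟨ht₂, h20₂, hq₂, h1₂, hf₂⟩
  simp at hq₂ h1₂ hf₂
  set S := (List.finRange n).filter fun x : Fin n => decide (σ₁.mem .index 7 x = 0) with hS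
  have hSm : ∀ x, x ∈ S ↔ origins ws x = [] := by
    intro x
    rw [hS, List.mem_filter, decide_eq_true_iff, ← (hin₁ x).eq_zero_iff]
    simp
  refine (refresh_spec hC hout (targets_nodup hnd) ν hk Finset.univ S (by simp) ?_ ?_
    ((List.nodup_finRange n).filter _) (by simp) σ₂ h20₂ ?_ hq₂ h1₂ ?_).mono ?_
  · intro h _ x hx hxS
    rw [hSm] at hxS
    rw [mem_targets, ← mem_origins, hxS] at hx
    simp at hx
  · intro x _
    by_cases hx : origins ws x = []
    · exact .inl ((hSm x).mpr hx)
    · obtain ⟨h, hh⟩ := List.exists_mem_of_ne_nil _ hx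
      exact .inr ⟨h, Finset.mem_univ h, (hC.mem x h).mp hh⟩
  · refine ⟨⟨?_, fun g => ?_, fun g => ?_, fun g => ?_⟩, fun g hg => ?_, fun g hg => ?_⟩
    · rw [hf₂ 0 (by simp), hf₁ 0 (by simp)]
      exact enc2
    · rw [hf₂ 1 (by simp), hf₁ 1 (by simp)]
      simp [encode]
    · rw [hf₂ 4 (by simp), hf₂ 5 (by simp), hf₂ 6 (by simp)]
      exact hout₁ g
    · rw [hf₂ 3 (by simp), hf₂ 7 (by simp), hf₂ 8 (by simp)]
      exact hin₁ g
    · rw [hf₂ 2 (by simp), hf₁ 2 (by simp)]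
      simp [encode, hg]
    · exact absurd (Finset.mem_univ g) hg
  · intro x
    rw [hf₂ 9 (by simp), hf₁ 9 (by simp)]
    exact encz 9 (by simp) x
  · rintro t₃ σ₃ ⟨hI, h9, hinit, ht₃⟩
    refine ⟨hI, h9, hinit, ?_⟩
    rw [Finset.card_univ, Fintype.card_fin] at ht₃
    rw [List.length_finRange] at ht₂
    rw [hsize]
    have e1 : 43 * (k + 1) * n = 43 * (k * n) + 43 * n := by ring
    have e2 : 100 * (k + 1) * (n + ws.length) =
      100 * (k * n) + 100 * n + 100 * (k * ws.length) + 100 * ws.length := by ring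
    omega

/-! ### Partial derivations -/

/-- One position of a derivation: the exit that is chosen, the exits that come after it and remain
to be tried, the gates that remain to be expanded after this position, and the position of the
product whose second input is the first of these gates (`0` if there is no such gate). -/
structure Frame (G : Type) where
  exit : G
  rest : List G
  pend : List G
  up : ℕ

namespace HybridCircuit

section Frames

variable {G : Type} [Fintype G] [DecidableEq G] (C : HybridCircuit G) (inL : G → List G)
  (ν : C.Valuation)

/-- The gates that remain to be expanded in a partial derivation, the last position of
which comes first. -/
def pending : List (Frame G) → List G
  | [] => [C.output]
  | f :: _ => C.children inL f.exit ++ f.pend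

/-- The position `u` describes the stack `st` of gates: either both are trivial, or the first gate
is the second input of the product at this position, and the other gates are those that
remain to be expanded after this product. -/
def IsLink (fs : List (Frame G)) (u : ℕ) (st : List G) : Prop :=
  (u = 0 ∧ st = []) ∨ ∃ f fs' a b, f :: fs' <:+ fs ∧ u = fs'.length + 1 ∧
    C.type f.exit = .times ∧ inL f.exit = [a, b] ∧ st = b :: f.pend

/-- The list of frames is a partial derivation from the output gate. -/
def Valid : List (Frame G) → Prop
  | [] => True
  | f :: fs => (∃ g pre, C.pending inL fs = g :: f.pend ∧
      C.exits inL ν g = pre ++ f.exit :: f.rest) ∧ C.IsLink inL fs f.up f.pend ∧ Valid fs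

/-- The exits chosen so far. -/
def chosen (fs : List (Frame G)) : List G := (fs.map Frame.exit).reverse

/-- The derivations that come after all those that extend the given partial derivation. -/
noncomputable def later : List (Frame G) → List (List G)
  | [] => []
  | f :: fs => (f.rest.flatMap fun e => (C.words inL ν (C.children inL e ++ f.pend)).map
      fun w => chosen fs ++ e :: w) ++ later fs

/-- The derivations that extend the given partial derivation, and those that come after. -/
noncomputable def remaining (fs : List (Frame G)) : List (List G) :=
  ((C.words inL ν (C.pending inL fs)).map fun w => chosen fs ++ w) ++ C.later inL ν fs

/-- The last position at which there remain exits to be tried, or `0`. -/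
def lastOpen : List (Frame G) → ℕ
  | [] => 0
  | f :: fs => if f.rest = [] then lastOpen fs else fs.length + 1

variable {C inL ν}

theorem Valid.suffix {fs fs' : List (Frame G)} (h : C.Valid inL ν fs) (hs : fs' <:+ fs) :
    C.Valid inL ν fs' := by
  induction fs with
  | nil =>
    rw [List.suffix_nil] at hs
    rw [hs]
    exact h
  | cons f fs ih =>
    rcases List.suffix_cons_iff.mp hs with rfl | hs
    · exact h
    · exact ih h.2.2 hs

theorem IsLink.mono {fs fs' : List (Frame G)} {u : ℕ} {st : List G}
    (h : C.IsLink inL fs u st) (hs : fs <:+ fs') : C.IsLink inL fs' u st := by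
  rcases h with h | ⟨f, gs, a, b, hf, h⟩
  · exact .inl h
  · exact .inr ⟨f, gs, a, b, hf.trans hs, h⟩

/-- Expanding the first pending gate by its first exit does not change what remains. -/
theorem Admissible.remaining_cons (hC : C.Admissible inL) {fs : List (Frame G)} {g e : G}
    {r st : List G} {u : ℕ} (hp : C.pending inL fs = g :: st)
    (he : C.exits inL ν g = e :: r) :
    C.remaining inL ν (⟨e, r, st, u⟩ :: fs) = C.remaining inL ν fs := by
  rw [remaining, remaining, hp, hC.words_cons, he, later]
  simp [pending, chosen, List.map_flatMap]
  rfl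

/-- A complete derivation is the first of those that remain. -/
theorem remaining_of_pending_nil {fs : List (Frame G)} (hp : C.pending inL fs = []) :
    C.remaining inL ν fs = chosen fs :: C.later inL ν fs := by
  rw [remaining, hp, Admissible.words_nil]
  simp

/-- Backtracking to the last position where exits remain to be tried, and choosing the next
exit there. -/
theorem later_eq {fs : List (Frame G)} (h : lastOpen fs ≠ 0) :
    ∃ f gs e r, f :: gs <:+ fs ∧ f.rest = e :: r ∧ lastOpen fs = gs.length + 1 ∧
      C.later inL ν fs = C.remaining inL ν (⟨e, r, f.pend, f.up⟩ :: gs) := by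
  induction fs with
  | nil => exact absurd rfl h
  | cons f fs ih =>
    rw [lastOpen] at h
    rcases hr : f.rest with _ | ⟨e, r⟩
    · rw [if_pos hr] at h
      obtain ⟨f', gs, e, r, hs, hr', hl, he⟩ := ih h
      refine ⟨f', gs, e, r, hs.trans (List.suffix_cons _ _), hr', ?_, ?_⟩
      · rw [lastOpen, if_pos hr, hl]
      · rw [← he, later, hr]
        simp
    · refine ⟨f, fs, e, r, List.suffix_rfl, hr, ?_, ?_⟩
      · rw [lastOpen, if_neg (by rw [hr]; simp)]
      · rw [remaining, later, later, hr]
        simp [pending, chosen]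

theorem later_eq_nil {fs : List (Frame G)} (h : lastOpen fs = 0) : C.later inL ν fs = [] := by
  induction fs with
  | nil => rfl
  | cons f fs ih =>
    rw [lastOpen] at h
    by_cases hr : f.rest = []
    · rw [if_pos hr] at h
      rw [later, hr, ih h]
      rfl
    · rw [if_neg hr] at h
      omega

/-- The gates that remain to be expanded in a partial derivation are alive. -/
theorem Admissible.alive_pending (hC : C.Admissible inL) (hout : C.Alive ν C.output)
    {fs : List (Frame G)} (hv : C.Valid inL ν fs) :
    ∀ g ∈ C.pending inL fs, C.Alive ν g ∧ (C.type g).isBoolean = false := by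
  induction fs with
  | nil =>
    intro g hg
    rw [pending, List.mem_singleton] at hg
    rw [hg]
    exact ⟨hout, C.output_set⟩
  | cons f fs ih =>
    obtain ⟨⟨g', pre, hp, he⟩, -, hv⟩ := hv
    intro g hg
    rw [pending, List.mem_append] at hg
    rcases hg with hg | hg
    · have hex : f.exit ∈ C.exits inL ν g' := by rw [he]; simp
      obtain ⟨hal, ht | ht⟩ := hC.of_mem_exits hex
      · simp [children_svar ht] at hg
      · rw [children, if_pos ht, hC.mem] at hg
        exact ⟨(C.alive_all ν hC.homogenized (.inl ht)).mp hal g hg,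
          C.inputs_set _ (.inr ht) g (C.mem_inputs.mpr hg)⟩
    · exact ih hv g (by rw [hp]; exact List.mem_cons_of_mem _ hg)

/-- How the enumeration finds the next gate to be expanded: after a product, it is the first
input of the product; after a variable, it is given by the link of the current position. -/
theorem Admissible.pending_cases (hC : C.Admissible inL) {f : Frame G} {fs : List (Frame G)}
    (hv : C.Valid inL ν (f :: fs)) :
    (C.type f.exit = .svar ∧ f.up = 0 ∧ C.pending inL (f :: fs) = []) ∨
    (C.type f.exit = .svar ∧ ∃ f' fs' a b, f' :: fs' <:+ fs ∧ f.up = fs'.length + 1 ∧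
      inL f'.exit = [a, b] ∧ C.pending inL (f :: fs) = b :: f'.pend ∧
      C.IsLink inL (f :: fs) f'.up f'.pend) ∨
    (C.type f.exit = .times ∧ ∃ a b, inL f.exit = [a, b] ∧
      C.pending inL (f :: fs) = a :: b :: f.pend ∧
      C.IsLink inL (f :: fs) (fs.length + 1) (b :: f.pend)) := by
  have hv' := hv
  obtain ⟨⟨g, pre, -, he⟩, hl, hvs⟩ := hv'
  have hex : f.exit ∈ C.exits inL ν g := by rw [he]; simp
  rcases (hC.of_mem_exits hex).2 with ht | ht
  · have hp : C.pending inL (f :: fs) = f.pend := by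
      rw [pending, Admissible.children_svar ht, List.nil_append]
    rw [hp]
    rcases hl with ⟨hu, hn⟩ | ⟨f', fs', a, b, hs, hu, -, hi, hst⟩
    · exact .inl ⟨ht, hu, hn⟩
    · exact .inr (.inl ⟨ht, f', fs', a, b, hs, hu, hi, hst,
        ((hvs.suffix hs).2.1.mono (List.suffix_cons _ _)).mono
          (hs.trans (List.suffix_cons _ _))⟩)
  · obtain ⟨a, b, -, hc, hi, -⟩ := hC.children_times ht
    refine .inr (.inr ⟨ht, a, b, hi, by rw [pending, hc]; rfl, ?_⟩)
    exact .inr ⟨f, fs, a, b, List.suffix_rfl, rfl, ht, hi, rfl⟩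

end Frames

end HybridCircuit

/-! ### Producing the next assignment -/

/-- The working memory holds a partial derivation: at each position, a pointer to the
chosen exit, a pointer to the last exit that can be chosen, and the link. -/
def Represents {n : ℕ} (m : Memory) : List (Frame (Fin n)) → Prop
  | [] => True
  | f :: fs => m .work 1 (fs.length + 1) = f.exit + 1 ∧
      m .work 2 (fs.length + 1) = lastPtr (f.exit :: f.rest) ∧
      m .work 3 (fs.length + 1) = f.up ∧ Represents m fs

theorem Represents.suffix {n : ℕ} {m : Memory} {fs fs' : List (Frame (Fin n))}
    (h : Represents m fs) (hs : fs' <:+ fs) : Represents m fs' := by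
  induction fs with
  | nil =>
    rw [List.suffix_nil] at hs
    rw [hs]
    exact h
  | cons f fs ih =>
    rcases List.suffix_cons_iff.mp hs with rfl | hs
    · exact h
    · exact ih h.2.2.2 hs

theorem Represents.congr {n : ℕ} {m m' : Memory} {fs : List (Frame (Fin n))}
    (h : Represents m fs)
    (hm : ∀ b i, 0 < b → i ≤ fs.length → m' .work b i = m .work b i) : Represents m' fs := by
  induction fs with
  | nil => exact h
  | cons f fs ih =>
    obtain ⟨h1, h2, h3, h4⟩ := h
    refine ⟨?_, ?_, ?_, ih h4 fun b i hb hi => hm b i hb (by simp; omega)⟩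
    · rw [hm 1 _ (by simp) (by simp)]
      exact h1
    · rw [hm 2 _ (by simp) (by simp)]
      exact h2
    · rw [hm 3 _ (by simp) (by simp)]
      exact h3

/-- The cells of the working memory that hold the positions up to `N`, and the flag. -/
def stateCells (N : ℕ) : Finset (ℕ × ℕ) :=
  insert (0, 0) (Finset.Icc 1 3 ×ˢ Finset.Icc 1 N)

theorem mem_stateCells {N b i : ℕ} (hb : 1 ≤ b ∧ b ≤ 3) (hi : 1 ≤ i ∧ i ≤ N) :
    (b, i) ∈ stateCells N := by
  simp [stateCells, hb, hi]

theorem stateCells_mono {N N' : ℕ} (h : N ≤ N') : stateCells N ⊆ stateCells N' :=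
  Finset.insert_subset_insert _
    (Finset.product_subset_product_right (Finset.Icc_subset_Icc_right h))

theorem card_stateCells_le (N : ℕ) : (stateCells N).card ≤ 3 * N + 1 := by
  refine (Finset.card_insert_le _ _).trans ?_
  simp [Finset.card_product]

/-- Go to the next position; unless it is occupied, choose there the first exit of the gate at the
origin of the wire in register `9`, with the link in register `8`. -/
def pushFrame : Program :=
  .instr (.pred 9) ;; .instr (.load 9 .index 3 9) ;; .instr (.succ 1) ;;
  .branch (.lt 2 1)
    (.instr (.load 4 .index 12 9) ;; .instr (.store .work 1 1 4) ;;
     .instr (.load 4 .index 13 9) ;; .instr (.store .work 2 1 4) ;;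
     .instr (.store .work 3 1 8))
    .skip

/-- Load the position in register `1`, and record it in register `3` if there remain exits
to be tried at this position. -/
def checkRest : Program :=
  .instr (.load 4 .work 1 1) ;; .instr (.load 5 .work 2 1) ;; .instr (.load 8 .work 3 1) ;;
  .branch (.eq 4 5) .skip (.instr (.move 3 1))

/-- Expand the exit with the pointer in register `4`, at the position in register `1`, with the
link in register `8`. -/
def expandExit : Program :=
  .instr (.pred 4) ;; .instr (.load 6 .index 1 4) ;; .instr (.load 9 .index 7 4) ;;
  .branch (.eq 6 20)
    (.instr (.emit 4) ;;
     .branch (.eq 8 20) (.instr (.const 10 0))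
       (.instr (.load 4 .work 1 8) ;; .instr (.pred 4) ;; .instr (.load 9 .index 7 4) ;;
        .instr (.load 9 .index 8 9) ;; .instr (.load 8 .work 3 8) ;; pushFrame))
    (.instr (.move 8 1) ;; pushFrame)

/-- Treat one position: register `1` holds the position, register `2` the number of positions that
are occupied initially, register `3` the last position at which exits remain to be
tried, and register `10` tells whether to go on. -/
def nextStep : Program := checkRest ;; expandExit

theorem pushFrame_spec {n : ℕ} {C : HybridCircuit (Fin n)} {inL outL : Fin n → List (Fin n)}
    {ν : C.Valuation} (g : Fin n) (i : ℕ) (σ : MachineState)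
    (hI : IndexOK C inL outL ν (fun _ => True) σ.mem)
    (h9 : σ.mem .index 3 (σ.reg 9 - 1) = g) (h1 : σ.reg 1 = i)
    (hu : σ.used ⊆ stateCells i) :
    Halts pushFrame σ fun t σ' => t ≤ 10 ∧
      (∀ b, σ'.mem .index b = σ.mem .index b) ∧ σ'.reg 1 = i + 1 ∧ σ'.reg 2 = σ.reg 2 ∧
      σ'.reg 3 = σ.reg 3 ∧ σ'.reg 10 = σ.reg 10 ∧ σ'.reg 20 = σ.reg 20 ∧ σ'.out = σ.out ∧
      σ'.used ⊆ stateCells (i + 1) ∧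
      (i + 1 ≤ σ.reg 2 → σ'.mem = σ.mem) ∧
      (σ.reg 2 < i + 1 → σ'.mem .work 1 (i + 1) = headPtr (C.exits inL ν g) ∧
        σ'.mem .work 2 (i + 1) = lastPtr (C.exits inL ν g) ∧
        σ'.mem .work 3 (i + 1) = σ.reg 8 ∧
        ∀ b j, j ≠ i + 1 → σ'.mem .work b j = σ.mem .work b j) := by
  have hc := hI.correct g trivial
  have hu' := hu.trans (stateCells_mono (Nat.le_add_right i 1))
  simp only [pushFrame, Halts.seq_iff, Halts.instr_iff, Halts.branch_iff, Halts.skip_iff,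
    Instr.exec_load, Instr.exec_store, Instr.exec_succ, Instr.exec_pred]
  constructor
  · intro h
    simp [h1] at h
    simp [h1, h9, hc.first, hc.last]
    refine ⟨?_, by omega, ?_⟩
    · simp only [Finset.insert_subset_iff]
      exact ⟨mem_stateCells (by simp) (by simp), mem_stateCells (by simp) (by simp),
        mem_stateCells (by simp) (by simp), hu'⟩
    · intro _ b j hj
      split_ifs with e1 e2 e3 <;> simp_all
  · intro h
    simp [h1] at h
    simp [h1, hu']
    omega

theorem lastPtr_cons_eq {n : ℕ} {x : Fin n} {l : List (Fin n)} (h : (x :: l).Nodup) :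
    ((x : ℕ) + 1 = lastPtr (x :: l)) ↔ l = [] := by
  rcases List.eq_nil_or_concat l with rfl | ⟨l, y, rfl⟩
  · simp [lastPtr]
  · rw [List.concat_eq_append] at h ⊢
    refine iff_of_false ?_ (by simp)
    rw [← List.cons_append, lastPtr_append (by simp)]
    have : x ≠ y := by
      rintro rfl
      simp at h
    simpa [lastPtr, Fin.ext_iff] using this

theorem checkRest_spec {n : ℕ} {f : Frame (Fin n)} {fs : List (Frame (Fin n))}
    (σ : MachineState) (hnd : (f.exit :: f.rest).Nodup) (hr : Represents σ.mem (f :: fs))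
    (h1 : σ.reg 1 = fs.length + 1) (hu : σ.used ⊆ stateCells (fs.length + 1)) :
    Halts checkRest σ fun t σ' => t ≤ 5 ∧ σ'.mem = σ.mem ∧ σ'.out = σ.out ∧
      σ'.used ⊆ stateCells (fs.length + 1) ∧ σ'.reg 1 = σ.reg 1 ∧ σ'.reg 2 = σ.reg 2 ∧
      σ'.reg 3 = (if f.rest = [] then σ.reg 3 else fs.length + 1) ∧
      σ'.reg 4 = f.exit + 1 ∧ σ'.reg 8 = f.up ∧ σ'.reg 10 = σ.reg 10 ∧
      σ'.reg 20 = σ.reg 20 := by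
  obtain ⟨e1, e2, e3, -⟩ := hr
  have hused : insert (3, fs.length + 1) (insert (2, fs.length + 1)
      (insert (1, fs.length + 1) σ.used)) ⊆ stateCells (fs.length + 1) := by
    simp only [Finset.insert_subset_iff]
    exact ⟨mem_stateCells (by simp) (by simp), mem_stateCells (by simp) (by simp),
      mem_stateCells (by simp) (by simp), hu⟩
  simp only [checkRest, Halts.seq_iff, Halts.instr_iff, Halts.branch_iff, Halts.skip_iff,
    Instr.exec_load, Instr.exec_move]
  constructor
  · intro h
    simp [h1, e1, e2, lastPtr_cons_eq hnd] at h
    simp [h1, e1, e3, h, hused]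
  · intro h
    simp [h1, e1, e2, lastPtr_cons_eq hnd] at h
    simp [h1, e1, e3, h, hused]

theorem expandExit_spec {n : ℕ} {C : HybridCircuit (Fin n)} {inL outL : Fin n → List (Fin n)}
    {ν : C.Valuation} (hC : C.Admissible inL) {f : Frame (Fin n)} {fs : List (Frame (Fin n))}
    (hv : C.Valid inL ν (f :: fs)) (σ : MachineState)
    (hI : IndexOK C inL outL ν (fun _ => True) σ.mem) (hr : Represents σ.mem (f :: fs))
    (h1 : σ.reg 1 = fs.length + 1) (h4 : σ.reg 4 = f.exit + 1) (h8 : σ.reg 8 = f.up)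
    (h10 : σ.reg 10 = 1) (h20 : σ.reg 20 = 0) (hu : σ.used ⊆ stateCells (fs.length + 1)) :
    Halts expandExit σ fun t σ' => t ≤ 24 ∧
      (∀ b, σ'.mem .index b = σ.mem .index b) ∧ σ'.reg 2 = σ.reg 2 ∧
      σ'.reg 3 = σ.reg 3 ∧ σ'.reg 20 = 0 ∧
      σ'.out = σ.out ++ (C.vars [f.exit]).map Fin.val ∧
      ((C.pending inL (f :: fs) = [] ∧ σ'.reg 10 = 0 ∧ σ'.mem = σ.mem ∧
          σ'.used ⊆ stateCells (fs.length + 1)) ∨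
        ∃ g st u, C.pending inL (f :: fs) = g :: st ∧ C.IsLink inL (f :: fs) u st ∧
          σ'.reg 10 = 1 ∧ σ'.reg 1 = fs.length + 2 ∧ σ'.used ⊆ stateCells (fs.length + 2) ∧
          (fs.length + 2 ≤ σ.reg 2 → σ'.mem = σ.mem) ∧
          (σ.reg 2 < fs.length + 2 →
            σ'.mem .work 1 (fs.length + 2) = headPtr (C.exits inL ν g) ∧
            σ'.mem .work 2 (fs.length + 2) = lastPtr (C.exits inL ν g) ∧
            σ'.mem .work 3 (fs.length + 2) = u ∧
            ∀ b j, j ≠ fs.length + 2 → σ'.mem .work b j = σ.mem .work b j)) := by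
  have hty := hI.circuit.type f.exit
  -- The two inputs of a product can be read in the index.
  have inputs : ∀ {e a b : Fin n}, inL e = [a, b] →
      σ.mem .index 3 (σ.mem .index 7 e - 1) = a ∧
      σ.mem .index 3 (σ.mem .index 8 (σ.mem .index 7 e) - 1) = b := by
    intro e a b he
    have := hI.circuit.ins e
    rw [he] at this
    exact ⟨this.2.2.1, this.2.2.2.2.2.1⟩
  simp only [expandExit, Halts.seq_iff, Halts.instr_iff, Halts.branch_iff, Instr.exec_load,
    Instr.exec_move, Instr.exec_pred, Instr.exec_const, Instr.exec_emit_reg]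
  rcases hC.pending_cases hv with ⟨ht, hup, hp⟩ | ⟨ht, f', fs', a, b, hs, hup, hi, hp, hl⟩ |
    ⟨ht, a, b, hi, hp, hl⟩
  · rw [ht] at hty
    refine ⟨fun _ => ⟨fun _ => ?_, fun h => ?_⟩, fun h => ?_⟩
    · simp [h4, h20, hp, hu, HybridCircuit.vars, ht]
    · simp [h8, h20, hup] at h
    · simp [h4, hty, h20, HybridGate.code] at h
  · rw [ht] at hty
    have hlen := hs.length_le
    simp only [List.length_cons] at hlen
    obtain ⟨r1, -, r3, -⟩ := hr.suffix (hs.trans (List.suffix_cons _ _))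
    refine ⟨fun _ => ⟨fun h => ?_, fun _ => ?_⟩, fun h => ?_⟩
    · simp [h8, h20, hup] at h
    · refine (pushFrame_spec (C := C) (inL := inL) (outL := outL) (ν := ν) b (fs.length + 1) _
        ?_ ?_ (by simp [h1]) ?_).mono ?_
      · simpa using hI
      · simpa [h8, hup, r1] using (inputs hi).2
      · simp [h8, hup, Finset.insert_subset_iff]
        exact ⟨mem_stateCells (by simp) (by omega), mem_stateCells (by simp) (by omega), hu⟩
      · rintro t σ' ⟨k0, k1, k2, k3, k4, k5, k6, k7, k8, k9, k10⟩
        simp [h8, hup, r3, h4] at k1 k3 k4 k5 k6 k7 k9 k10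
        refine ⟨by omega, k1, k3, k4, by rw [k6, h20], ?_, .inr ⟨b, _, f'.up, hp, hl, ?_⟩⟩
        · simp [k7, HybridCircuit.vars, ht]
        · exact ⟨by rw [k5, h10], k2, k8, fun h => k9 (by omega), fun h => k10 (by omega)⟩
    · simp [h4, hty, h20, HybridGate.code] at h
  · rw [ht] at hty
    refine ⟨fun h => ?_, fun _ => ?_⟩
    · simp [h4, hty, h20, HybridGate.code] at h
    · refine (pushFrame_spec (C := C) (inL := inL) (outL := outL) (ν := ν) a (fs.length + 1) _
        ?_ ?_ (by simp [h1]) ?_).mono ?_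
      · simpa using hI
      · simpa [h4] using (inputs hi).1
      · simpa using hu
      · rintro t σ' ⟨k0, k1, k2, k3, k4, k5, k6, k7, k8, k9, k10⟩
        simp [h1] at k1 k3 k4 k5 k6 k7 k9 k10
        refine ⟨by omega, k1, k3, k4, by rw [k6, h20], ?_,
          .inr ⟨a, _, fs.length + 1, hp, hl, ?_⟩⟩
        · simp [k7, HybridCircuit.vars, ht]
        · exact ⟨by rw [k5, h10], k2, k8, fun h => k9 (by omega), fun h => k10 (by omega)⟩

theorem nextStep_spec {n : ℕ} {C : HybridCircuit (Fin n)} {inL outL : Fin n → List (Fin n)}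
    {ν : C.Valuation} (hC : C.Admissible inL) {f : Frame (Fin n)} {fs : List (Frame (Fin n))}
    (hv : C.Valid inL ν (f :: fs)) (σ : MachineState)
    (hI : IndexOK C inL outL ν (fun _ => True) σ.mem) (hr : Represents σ.mem (f :: fs))
    (h1 : σ.reg 1 = fs.length + 1) (h10 : σ.reg 10 = 1) (h20 : σ.reg 20 = 0)
    (hu : σ.used ⊆ stateCells (fs.length + 1)) :
    Halts nextStep σ fun t σ' => t ≤ 29 ∧
      (∀ b, σ'.mem .index b = σ.mem .index b) ∧ σ'.reg 2 = σ.reg 2 ∧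
      σ'.reg 3 = (if f.rest = [] then σ.reg 3 else fs.length + 1) ∧ σ'.reg 20 = 0 ∧
      σ'.out = σ.out ++ (C.vars [f.exit]).map Fin.val ∧
      ((C.pending inL (f :: fs) = [] ∧ σ'.reg 10 = 0 ∧ σ'.mem = σ.mem ∧
          σ'.used ⊆ stateCells (fs.length + 1)) ∨
        ∃ g st u, C.pending inL (f :: fs) = g :: st ∧ C.IsLink inL (f :: fs) u st ∧
          σ'.reg 10 = 1 ∧ σ'.reg 1 = fs.length + 2 ∧ σ'.used ⊆ stateCells (fs.length + 2) ∧
          (fs.length + 2 ≤ σ.reg 2 → σ'.mem = σ.mem) ∧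
          (σ.reg 2 < fs.length + 2 →
            σ'.mem .work 1 (fs.length + 2) = headPtr (C.exits inL ν g) ∧
            σ'.mem .work 2 (fs.length + 2) = lastPtr (C.exits inL ν g) ∧
            σ'.mem .work 3 (fs.length + 2) = u ∧
            ∀ b j, j ≠ fs.length + 2 → σ'.mem .work b j = σ.mem .work b j)) := by
  obtain ⟨g, pre, -, he⟩ := hv.1
  have hnd : (f.exit :: f.rest).Nodup := by
    have := hC.exits_nodup ν g
    rw [he] at this
    exact this.of_append_right
  rw [nextStep, Halts.seq_iff]
  refine (checkRest_spec σ hnd hr h1 hu).mono ?_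
  rintro t1 σ1 ⟨a0, a1, a2, a3, a4, a5, a6, a7, a8, a9, a10⟩
  refine (expandExit_spec hC hv σ1 (by rwa [a1]) (by rwa [a1]) (by rw [a4, h1]) a7 a8
    (by rw [a9, h10]) (by rw [a10, h20]) a3).mono ?_
  rintro t2 σ2 ⟨b0, b1, b2, b3, b4, b5, b6⟩
  rw [a1, a5] at b6
  exact ⟨by omega, by rwa [a1] at b1, by rw [b2, a5], by rw [b3, a6], b4, by rw [b5, a2], b6⟩

section Completion

open HybridCircuit (chosen lastOpen)

variable {n : ℕ} {C : HybridCircuit (Fin n)} {inL outL : Fin n → List (Fin n)}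
  {ν : C.Valuation}

/-- The result of `nextStep`, repeated from the position after `gs`, on a memory that holds the
partial derivation `fs`: this partial derivation is completed by always choosing the first exit. -/
structure Completed (C : HybridCircuit (Fin n)) (inL : Fin n → List (Fin n)) (ν : C.Valuation)
    (fs gs : List (Frame (Fin n))) (m : Memory) (t : ℕ) (σ : MachineState) : Prop where
  derivation : ∃ F, fs <:+ F ∧ C.Valid inL ν F ∧ C.pending inL F = [] ∧
    C.remaining inL ν F = C.remaining inL ν fs ∧ Represents σ.mem F ∧
    σ.out = (C.vars (chosen F)).map Fin.val ∧ σ.reg 3 = lastOpen F ∧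
    σ.used ⊆ stateCells F.length ∧ t + 30 * gs.length ≤ 30 * F.length + 1
  index : ∀ b, σ.mem .index b = m .index b
  zero : σ.reg 20 = 0

theorem vars_chosen_cons (C : HybridCircuit (Fin n)) (f : Frame (Fin n))
    (gs : List (Frame (Fin n))) :
    C.vars (chosen (f :: gs)) = C.vars (chosen gs) ++ C.vars [f.exit] := by
  simp [HybridCircuit.vars, chosen]

/-- Once all the positions that were occupied are treated, the derivation is completed. -/
theorem expandLoop_spec (hC : C.Admissible inL) (hout : C.Alive ν C.output)
    (f : Frame (Fin n)) (gs : List (Frame (Fin n))) (σ : MachineState)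
    (hv : C.Valid inL ν (f :: gs)) (hI : IndexOK C inL outL ν (fun _ => True) σ.mem)
    (hr : Represents σ.mem (f :: gs)) (h1 : σ.reg 1 = gs.length + 1)
    (h2 : σ.reg 2 ≤ gs.length + 1) (h3 : σ.reg 3 = lastOpen gs) (h10 : σ.reg 10 = 1)
    (h20 : σ.reg 20 = 0) (hu : σ.used ⊆ stateCells (gs.length + 1))
    (ho : σ.out = (C.vars (chosen gs)).map Fin.val) :
    Halts (.loop (.lt 20 10) nextStep) σ (Completed C inL ν (f :: gs) gs σ.mem) := by
  generalize hst : C.pending inL (f :: gs) = st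
  induction st using hC.stack_induction ν generalizing f gs σ with
  | nil =>
    refine Halts.loop_step (by simp [h10, h20]) ((nextStep_spec hC hv σ hI hr h1 h10 h20 hu).mono ?_)
    rintro t σ' ⟨a0, a1, a2, a3, a4, a5, ⟨-, a6, a7, a8⟩ | ⟨g, st, u, hp, -⟩⟩
    · refine Halts.loop_done (by simp [a6, a4]) ⟨⟨f :: gs, List.suffix_rfl, hv, hst, rfl, ?_, ?_,
        ?_, a8, ?_⟩, a1, a4⟩
      · rwa [a7]
      · rw [a5, ho, vars_chosen_cons, List.map_append]
      · rw [a3, lastOpen, h3]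
      · simp
        omega
    · rw [hst] at hp
      cases hp
  | cons g st ih =>
    refine Halts.loop_step (by simp [h10, h20]) ((nextStep_spec hC hv σ hI hr h1 h10 h20 hu).mono ?_)
    rintro t σ' ⟨a0, a1, a2, a3, a4, a5, ⟨hp, -⟩ | ⟨g', st', u, hp, hl, a6, a7, a8, -, a9⟩⟩
    · rw [hst] at hp
      cases hp
    obtain ⟨b1, b2, b3, b4⟩ := a9 (by omega)
    rw [hst] at hp
    obtain ⟨rfl, rfl⟩ := List.cons.inj hp
    obtain ⟨hal, hb⟩ := hC.alive_pending hout hv g (by rw [hst]; simp)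
    obtain ⟨e, r, he⟩ := List.exists_cons_of_ne_nil ((hC.exits_ne_nil ν hb).mpr hal)
    have hv' : C.Valid inL ν (⟨e, r, st, u⟩ :: f :: gs) :=
      ⟨⟨g, [], hst, by simpa using he⟩, hl, hv⟩
    have hr' : Represents σ'.mem (⟨e, r, st, u⟩ :: f :: gs) := by
      refine ⟨?_, ?_, b3, hr.congr fun b i _ hi => b4 b i ?_⟩
      · simpa [he, headPtr] using b1
      · simpa [he] using b2
      · simp at hi
        omega
    refine (ih e (by rw [he]; simp) ⟨e, r, st, u⟩ (f :: gs) σ' hv' (hI.congr fun b _ _ => a1 b) hr'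
      a7 (by simp; omega) (by rw [a3, lastOpen, h3]) a6 a4 a8
      (by rw [a5, ho, vars_chosen_cons, List.map_append]) rfl).mono ?_
    rintro t' σ'' ⟨⟨F, c1, c2, c3, c4, c5, c6, c7, c8, c9⟩, c10, c11⟩
    refine ⟨⟨F, (List.suffix_cons _ _).trans c1, c2, c3,
      c4.trans (hC.remaining_cons hst he), c5, c6, c7, c8, ?_⟩, fun b => (c10 b).trans (a1 b), c11⟩
    simp at c9
    omega

/-- The positions that are occupied are scanned, and then the derivation is completed. -/
theorem scanLoop_spec (hC : C.Admissible inL) (hout : C.Alive ν C.output)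
    {fs : List (Frame (Fin n))} (hv : C.Valid inL ν fs)
    (f : Frame (Fin n)) (gs : List (Frame (Fin n))) (hs : f :: gs <:+ fs) (σ : MachineState)
    (hI : IndexOK C inL outL ν (fun _ => True) σ.mem)
    (hr : Represents σ.mem fs) (h1 : σ.reg 1 = gs.length + 1)
    (h2 : σ.reg 2 = fs.length) (h3 : σ.reg 3 = lastOpen gs) (h10 : σ.reg 10 = 1)
    (h20 : σ.reg 20 = 0) (hu : σ.used ⊆ stateCells (gs.length + 1))
    (ho : σ.out = (C.vars (chosen gs)).map Fin.val) :
    Halts (.loop (.lt 20 10) nextStep) σ (Completed C inL ν fs gs σ.mem) := by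
  generalize hd : fs.length - (gs.length + 1) = d
  have hlen := hs.length_le
  simp only [List.length_cons] at hlen
  induction d generalizing f gs σ with
  | zero =>
    obtain rfl : f :: gs = fs := hs.eq_of_length (by simp; omega)
    exact expandLoop_spec hC hout f gs σ hv hI hr h1 (by rw [h2]; simp) h3 h10 h20 hu ho
  | succ d ih =>
    obtain ⟨f', hs'⟩ : ∃ f', f' :: f :: gs <:+ fs := by
      obtain ⟨l, hl⟩ := hs
      rcases List.eq_nil_or_concat l with rfl | ⟨l, f', rfl⟩
      · have := congrArg List.length hl
        simp at this
        omega
      · exact ⟨f', l, by rw [← hl]; simp⟩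
    have hv' := hv.suffix hs'
    obtain ⟨⟨g, -, hp, -⟩, -, -⟩ := hv'
    have hlen' := hs'.length_le
    simp only [List.length_cons] at hlen'
    refine Halts.loop_step (by simp [h10, h20]) ((nextStep_spec hC (hv.suffix hs) σ hI
      (hr.suffix hs) h1 h10 h20 hu).mono ?_)
    rintro t σ' ⟨a0, a1, a2, a3, a4, a5, ⟨hp', -⟩ | ⟨g', st', u, -, -, a6, a7, a8, a9, -⟩⟩
    · rw [hp] at hp'
      cases hp'
    have hm := a9 (by omega)
    refine (ih f' (f :: gs) hs' σ' (by rwa [hm]) (by rwa [hm]) a7 (by rw [a2, h2])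
      (by rw [a3, lastOpen, h3]) a6 a4 a8 (by rw [a5, ho, vars_chosen_cons, List.map_append])
      (by simp; omega) (by simp; omega)).mono ?_
    rintro t' σ'' ⟨⟨F, c1, c2, c3, c4, c5, c6, c7, c8, c9⟩, c10, c11⟩
    refine ⟨⟨F, c1, c2, c3, c4, c5, c6, c7, c8, ?_⟩, fun b => (c10 b).trans (a1 b), c11⟩
    simp at c9
    omega

end Completion

/-- Produce the next assignment: scan the partial derivation in memory, complete it, and prepare the
next partial derivation by advancing to the next exit at the last position where this
is possible. -/
def nextProgram : Program :=
  .instr (.load 2 .work 0 20) ;; .instr (.const 1 1) ;; .instr (.const 10 1) ;;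
  .loop (.lt 20 10) nextStep ;; .instr (.store .work 0 20 3) ;;
  .branch (.eq 3 20) .skip
    (.instr (.load 4 .work 1 3) ;; .instr (.load 4 .index 14 4) ;; .instr (.store .work 1 3 4))

theorem nextProgram_readOnly : nextProgram.IndexReadOnly := by
  simp [nextProgram, nextStep, checkRest, expandExit, pushFrame, Program.IndexReadOnly]

section Production

open HybridCircuit (chosen lastOpen)

variable {n : ℕ} {C : HybridCircuit (Fin n)} {inL outL : Fin n → List (Fin n)}
  {ν : C.Valuation}

/-- The working memory is an enumeration state in which the derivations in `rem` remain to
be produced: either the enumeration is over, or the memory holds a nonempty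
partial derivation. -/
def EnumState (C : HybridCircuit (Fin n)) (inL : Fin n → List (Fin n)) (ν : C.Valuation)
    (m : Memory) (rem : List (List (Fin n))) : Prop :=
  (m .work 0 0 = 0 ∧ rem = []) ∨ ∃ f gs, m .work 0 0 = gs.length + 1 ∧
    C.Alive ν C.output ∧ C.Valid inL ν (f :: gs) ∧ Represents m (f :: gs) ∧ rem = C.remaining inL ν (f :: gs)

theorem length_chosen (fs : List (Frame (Fin n))) : (chosen fs).length = fs.length := by
  simp [chosen]

/-- After preprocessing or an update, all the derivations of the output gate remain to be produced. -/
theorem IsInitial.enumState (hC : C.Admissible inL) {m : Memory} (h : IsInitial C inL ν m) :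
    EnumState C inL ν m (C.words inL ν [C.output]) := by
  have hw : C.words inL ν [C.output] = C.remaining inL ν [] := by
    simp [HybridCircuit.remaining, HybridCircuit.pending, HybridCircuit.later, chosen]
  have hne := hC.exits_ne_nil ν C.output_set
  by_cases hal : C.Alive ν C.output
  · obtain ⟨e, r, he⟩ := List.exists_cons_of_ne_nil (hne.mpr hal)
    refine .inr ⟨⟨e, r, [], 0⟩, [], ?_, hal, ⟨⟨C.output, [], rfl, by simpa using he⟩, .inl ⟨rfl, rfl⟩,
      trivial⟩, ⟨?_, ?_, h.pending, trivial⟩, ?_⟩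
    · have := h.flag
      simp_all [IsBit]
    · have := h.exit
      rw [he] at this
      simpa [headPtr] using this
    · have := h.last
      rw [he] at this
      exact this
    · rw [hw, hC.remaining_cons (by rfl) he]
  · refine .inl ⟨?_, ?_⟩
    · have := h.flag
      simp_all [IsBit]
    · rw [hC.words_cons, not_not.mp (mt hne.mp hal)]
      rfl

/-- One call produces the first derivation that remains, in time linear in its length. -/
theorem nextProgram_spec (hC : C.Admissible inL) (m : Memory) (rem : List (List (Fin n)))
    (hI : IndexOK C inL outL ν (fun _ => True) m) (hs : EnumState C inL ν m rem)
    (h0 : ¬ EnumerationOver m) :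
    Halts nextProgram (MachineState.call m 0) fun t σ => ∃ w rem', rem = w :: rem' ∧
      σ.out = (C.vars w).map Fin.val ∧ t ≤ 30 * w.length + 10 ∧
      σ.used ⊆ stateCells w.length ∧ (∀ b, σ.mem .index b = m .index b) ∧
      EnumState C inL ν σ.mem rem' := by
  rcases hs with ⟨h, -⟩ | ⟨f, gs, hlen, hout, hv, hr, rfl⟩
  · exact absurd h h0
  have hz : ∀ r, r ≠ 0 → (MachineState.call m 0).reg r = 0 := MachineState.call_reg m 0
  obtain ⟨f₀, hs⟩ : ∃ f₀, [f₀] <:+ f :: gs := by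
    refine ⟨(f :: gs).getLast (by simp), (f :: gs).dropLast, ?_⟩
    exact List.dropLast_append_getLast _
  simp only [nextProgram, Halts.seq_iff, Halts.instr_iff, Instr.exec_load, Instr.exec_const]
  refine (scanLoop_spec hC hout hv f₀ [] hs _ (by simpa using hI) (by simpa using hr) (by simp)
    ?_ (by simp [lastOpen, hz]) (by simp) (by simp [hz]) ?_ (by simp [chosen, HybridCircuit.vars])).mono ?_
  · simp [hz, hlen]
  · simp [stateCells, hz]
  rintro t σ ⟨⟨F, -, hF, hp, hrem, hR, ho, h3, hu, ht⟩, hidx, h20⟩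
  simp at hidx ht
  have h00 : (0, 0) ∈ stateCells F.length := by simp [stateCells]
  simp only [Halts.branch_iff, Halts.skip_iff, Halts.seq_iff, Halts.instr_iff, Instr.exec_load,
    Instr.exec_store]
  rw [← hrem, HybridCircuit.remaining_of_pending_nil hp]
  constructor
  · intro h
    simp [h20, h3] at h
    refine ⟨_, _, rfl, by simpa using ho, ?_, ?_, by simpa using hidx, .inl ⟨?_, ?_⟩⟩
    · rw [length_chosen]
      omega
    · rw [length_chosen]
      simp [h20, Finset.insert_subset_iff, h00, hu]
    · simp [h20, h3, h]
    · exact HybridCircuit.later_eq_nil h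
  · intro h
    simp [h20, h3] at h
    obtain ⟨g, gs', e, r, hsF, hrest, hl, hlater⟩ :=
      HybridCircuit.later_eq (C := C) (inL := inL) (ν := ν) h
    have hle := hsF.length_le
    simp only [List.length_cons] at hle
    obtain ⟨⟨x, pre, hpx, hex⟩, hlink, hv'⟩ := hF.suffix hsF
    obtain ⟨r1, r2, r3, r4⟩ := hR.suffix hsF
    have hcell : (1, gs'.length + 1) ∈ stateCells F.length := mem_stateCells (by simp) (by omega)
    -- The next exit is found by following the shared links.
    have hnext : m .index 14 (g.exit + 1) = e + 1 := by
      refine (hI.correct x trivial).linked g.exit e ⟨pre, r, ?_⟩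
      rw [hex, hrest]
      simp
    refine ⟨_, _, rfl, by simpa using ho, ?_, ?_, by simpa using hidx,
      .inr ⟨⟨e, r, g.pend, g.up⟩, gs', ?_, hout, ⟨⟨x, pre ++ [g.exit], hpx, ?_⟩, hlink, hv'⟩,
        ⟨?_, ?_, ?_, ?_⟩, hlater⟩⟩
    · rw [length_chosen]
      omega
    · rw [length_chosen]
      simp [h20, h3, hl, Finset.insert_subset_iff, h00, hu, hcell]
    · simp [h20, h3, hl]
    · rw [hex, hrest]
      simp
    · simp [h20, h3, hl, r1, hidx, hnext]
    · rw [hrest] at r2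
      simpa [h20, h3, hl, lastPtr] using r2
    · simpa [h20, h3, hl] using r3
    · refine r4.congr fun b i hb hi => ?_
      have h1 : i ≠ gs'.length + 1 := by omega
      have h2 : b ≠ 0 := by omega
      by_cases hb1 : b = 1
      · subst hb1
        simp [h20, h3, hl, h1]
      · simp [h20, h3, hl, h2, hb1]

end Production

/-! ### The algorithm -/

theorem ListsElements.unique {n : ℕ} {l : List ℕ} {B B' : Finset (Fin n)}
    (h : ListsElements l B) (h' : ListsElements l B') : B = B' := by
  ext g
  have key : ∀ {A : Finset (Fin n)}, ListsElements l A → (g ∈ A ↔ (g : ℕ) ∈ l) := by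
    intro A hA
    rw [hA.2]
    exact ⟨fun hg => ⟨g, hg, rfl⟩, fun ⟨x, hx, e⟩ => Fin.ext e ▸ hx⟩
  rw [key h, key h']

theorem listsElements_map {n : ℕ} {l : List (Fin n)} (h : l.Nodup) :
    ListsElements (l.map Fin.val) l.toFinset :=
  ⟨h.map Fin.val_injective, fun i => by simp⟩

/-- The algorithm for enumeration under updates. -/
def enumAlgorithm : EnumAlgorithm :=
  ⟨preprocessProgram, nextProgram, updateProgram, nextProgram_readOnly⟩

section Sessions

variable {n : ℕ} {C : HybridCircuit (Fin n)} {ws : List (Fin n × Fin n)} {ν : C.Valuation}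
  {L : List (Finset (Fin n))} {U : Finset (ℕ × ℕ)} {m : Memory}

namespace HybridCircuit

theorem independent_output (C : HybridCircuit (Fin n)) (ν : C.Valuation) :
    C.Independent ν [C.output] :=
  ⟨fun g hg => by rw [List.mem_singleton.mp hg]; exact C.output_set, List.pairwise_singleton _ _⟩

theorem Admissible.mem_answers_iff {inL : Fin n → List (Fin n)} (hC : C.Admissible inL)
    (B : Finset (Fin n)) :
    B ∈ C.answers ν ↔ ∃ w ∈ C.words inL ν [C.output], (C.vars w).toFinset = B := by
  rw [← hC.mem_stackCaptured_iff ν _ (C.independent_output ν).1]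
  simp [stackCaptured, answers]

end HybridCircuit

/-- What holds throughout a session: the index is correct for the current valuation, and the
derivations of the output gate are those of the assignments produced so far followed by those
that remain in the enumeration state. A call that produces an assignment of cardinality `c`
accesses at most `2 * c - 1` positions, which are always the first ones. -/
structure SessionOK (C : HybridCircuit (Fin n)) (ws : List (Fin n × Fin n)) (ν : C.Valuation)
    (L : List (Finset (Fin n))) (U : Finset (ℕ × ℕ)) (m : Memory) : Prop where
  index : IndexOK C (origins ws) (targets ws) ν (fun _ => True) m
  counters : ∀ x : Fin n, m .index 9 x = 0
  state : ∃ P rem, P ++ rem = C.words (origins ws) ν [C.output] ∧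
    L = P.map (fun w => (C.vars w).toFinset) ∧ EnumState C (origins ws) ν m rem
  cells : ∀ M : ℕ, (∀ B ∈ C.answers ν, B.card ≤ M) →
    U = ∅ ∨ (1 ≤ M ∧ U ⊆ stateCells (2 * M - 1))

theorem SessionOK.initial (hC : C.Admissible (origins ws))
    (hI : IndexOK C (origins ws) (targets ws) ν (fun _ => True) m)
    (h9 : ∀ x : Fin n, m .index 9 x = 0) (hinit : IsInitial C (origins ws) ν m) :
    SessionOK C ws ν [] ∅ m :=
  ⟨hI, h9, ⟨[], _, rfl, rfl, hinit.enumState hC⟩, fun _ _ => .inl rfl⟩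

theorem SessionOK.next (hC : C.Admissible (origins ws)) (h : SessionOK C ws ν L U m)
    (h0 : ¬ EnumerationOver m) :
    Halts nextProgram (MachineState.call m 0) fun t σ => ∃ B, ListsElements σ.out B ∧
      B ∈ C.answers ν ∧ B ∉ L ∧ t ≤ 60 * B.card ∧ σ.used.card ≤ 6 * B.card ∧
      SessionOK C ws ν (L ++ [B]) (U ∪ σ.used) σ.mem := by
  obtain ⟨P, rem, hP, rfl, hs⟩ := h.state
  refine (nextProgram_spec hC m rem h.index hs h0).mono ?_
  rintro t σ ⟨w, rem', rfl, ho, ht, hu, hidx, hs'⟩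
  have hw : w ∈ C.words (origins ws) ν [C.output] := by
    rw [← hP]
    simp
  have hnd := hC.vars_nodup ν _ (C.independent_output ν) w hw
  have hlen := hC.length_add_length ν _ w hw
  have hcard : (C.vars w).toFinset.card = (C.vars w).length := List.toFinset_card_of_nodup hnd
  have hans : (C.vars w).toFinset ∈ C.answers ν := hC.mem_answers_iff _ |>.mpr ⟨w, hw, rfl⟩
  simp only [List.length_singleton] at hlen
  refine ⟨(C.vars w).toFinset, ?_, hans, ?_, ?_, ?_, ?_⟩
  · rw [ho]
    exact listsElements_map hnd
  · have := hC.map_vars_nodup ν _ (C.independent_output ν)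
    rw [← hP, List.map_append, List.map_cons] at this
    exact fun hm => List.disjoint_of_nodup_append this hm (by simp)
  · omega
  · have := (Finset.card_le_card hu).trans (card_stateCells_le _)
    omega
  · refine ⟨h.index.congr fun b _ _ => hidx b, fun x => by rw [hidx, h.counters],
      ⟨P ++ [w], rem', by rw [← hP]; simp, by simp, hs'⟩, fun M hM => .inr ?_⟩
    have hle := hM _ hans
    have hu' := hu.trans (stateCells_mono (N' := 2 * M - 1) (by omega))
    refine ⟨by omega, Finset.union_subset ?_ hu'⟩
    rcases h.cells M hM with rfl | ⟨-, hU⟩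
    · simp
    · exact hU

theorem SessionOK.update (hC : C.Admissible (origins ws)) (hnd : ws.Nodup)
    (hws : ∀ w, w ∈ ws ↔ w ∈ C.wires) {k : ℕ} (hk : ∀ g, (origins ws g).length ≤ k)
    (h : SessionOK C ws ν L U m) (g : {g : Fin n // C.type g = .bvar}) :
    Halts updateProgram (MachineState.call m (g : Fin n)) fun t σ =>
      SessionOK C ws (C.toggle ν g) [] ∅ σ.mem ∧ t ≤ 65 * (k + 1) * C.dependencySize := by
  have hout : ∀ g a, a ∈ targets ws g ↔ C.Wire g a := fun g a => by
    rw [mem_targets, hws]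
    rfl
  refine (updateProgram_spec hC hout (targets_nodup hnd) ν hk g m h.index h.counters).mono ?_
  rintro t σ ⟨hI, h9, hinit, ht⟩
  exact ⟨.initial hC hI h9 hinit, ht⟩

theorem Session.sessionOK (hC : C.Admissible (origins ws)) (hnd : ws.Nodup)
    (hws : ∀ w, w ∈ ws ↔ w ∈ C.wires) {k : ℕ} (hk : ∀ g, (origins ws g).length ≤ k)
    {ν₀ : C.Valuation} (h : Session enumAlgorithm C ws ν₀ ν L U m) : SessionOK C ws ν L U m := by
  induction h with
  | start hr =>
    obtain ⟨hI, h9, hinit, -⟩ := (preprocessProgram_spec hnd hws hC ν₀ hk).of_runs hr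
    exact .initial hC hI h9 hinit
  | next _ h0 hr hB ih =>
    obtain ⟨B', hB', -, -, -, -, h⟩ := (ih.next hC h0).of_runs hr
    rwa [hB.unique hB']
  | update g _ hr ih => exact ((ih.update hC hnd hws hk g).of_runs hr).1

end Sessions

theorem mainTheorem2 :
    ∃ 𝒜 : EnumAlgorithm, ∀ k : ℕ, ∃ K : ℕ,
      ∀ (n : ℕ) (C : HybridCircuit (Fin n)),
        C.UpwardsDeterministic → C.IsDDNNF → C.Homogenized → C.maxFanIn ≤ k →
        ∀ ws : List (Fin n × Fin n), ws.Nodup → (∀ w, w ∈ ws ↔ w ∈ C.wires) →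
        ∀ ν : C.Valuation, EnumeratesUnderUpdates 𝒜 K C ws ν := by
  refine ⟨enumAlgorithm, fun k => ⟨100 * (k + 1), fun n C hup hdd hhom hfan ws hnd hws ν₀ => ?_⟩⟩
  have hmem : ∀ g a, a ∈ origins ws g ↔ C.Wire a g := fun g a => by
    rw [mem_origins, hws]
    rfl
  have hC : C.Admissible (origins ws) := ⟨hhom, hup, hdd, hmem, origins_nodup hnd⟩
  have hk : ∀ g, (origins ws g).length ≤ k := by
    intro g
    have e : (origins ws g).toFinset = C.inputs g := by
      ext a
      rw [List.mem_toFinset, hmem, HybridCircuit.mem_inputs]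
    rw [← List.toFinset_card_of_nodup (origins_nodup hnd g), e]
    exact (Finset.le_sup (f := C.fanIn) (Finset.mem_univ g)).trans hfan
  constructor
  · obtain ⟨t, σ, hr, -, -, -, ht⟩ := preprocessProgram_spec hnd hws hC ν₀ hk
    exact ⟨t, σ, hr, ht⟩
  · intro ν L U m hs h0
    obtain ⟨t, σ, hr, B, hB, hans, hL, ht, hu, -⟩ := (hs.sessionOK hC hnd hws hk).next hC h0
    refine ⟨t, σ, B, hr, hB, hans, hL, ht.trans ?_, hu.trans ?_⟩ <;>
      exact Nat.mul_le_mul_right _ (by omega)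
  · intro ν L U m hs h0 B hB
    obtain ⟨P, rem, hP, rfl, ⟨-, rfl⟩ | ⟨f, gs, hf, -⟩⟩ := (hs.sessionOK hC hnd hws hk).state
    · obtain ⟨w, hw, rfl⟩ := (hC.mem_answers_iff B).mp hB
      rw [← hP, List.append_nil] at hw
      exact List.mem_map.mpr ⟨w, hw, rfl⟩
    · rw [EnumerationOver, hf] at h0
      omega
  · intro ν L U m hs M hM
    rcases (hs.sessionOK hC hnd hws hk).cells M hM with rfl | ⟨h1, hU⟩
    · simp
    · have := (Finset.card_le_card hU).trans (card_stateCells_le _)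
      calc U.card ≤ 100 * M := by omega
        _ ≤ 100 * (k + 1) * M := Nat.mul_le_mul_right _ (by omega)
  · intro ν L U m hs g
    obtain ⟨t, σ, hr, -, ht⟩ := (hs.sessionOK hC hnd hws hk).update hC hnd hws hk g
    exact ⟨t, σ, hr, ht.trans (Nat.mul_le_mul_right _ (by omega))⟩
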